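/- **Setting.** Let $n=l+m$, let $\mathcal Q\subset\mathbb R^n$ be an open configuration domain with coordinates $q=(q^u,q^a)\in\mathbb R^l\times\mathbb R^m$, and let $B=\begin{bmatrix}0\\ 1_{m}\end{bmatrix}$, $B_c=\begin{bmatrix}1_{l}\\ 0\end{bmatrix}$. The robot dynamics are $D(q)\ddot q+C(q,\dot q)\dot q+G(q)=Bu$, $u\in\mathbb R^m$, in state-space form $\dot x=f(x)+g(x)u$ with $x=(q,\dot q)$, where $D\in C^2$, $C,G\in C^1$, $D$ is symmetric positive definite, $\dot D-2C$ is skew-symmetric, and for some $c_l,c_u>0$ one has, on all of $T\mathcal Q=\mathcal Q\times\mathbb R^n$, $c_l\le\|D\|\le c_u$, $c_l\le\|D^{-1}\|\le c_u$, $\|\dot D\|\le c_u|\dot q|$, $\|C\|\le c_u|\dot q|$, $|G|\le c_u$. With a $C^2$ foot height $h:\mathcal Q\to\mathbb R$, the domain is $\mathbb D=\{h(q)\ge 0\}$ and the guard is $\mathbb G=\{h(q)=0,\ L_fh(q,\dot q)=\partial_q h(q)\dot q<0\}$. The impact map $R:\mathbb G\to\mathbb D$ is locally Lipschitz and $R(\mathbb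 G)\cap\mathbb G=\emptyset$. The output is $e(q)=q^a-q^a_d(\tau(q))\in\mathbb R^m$ with $q^a_d,\tau\in C^3$; put $J=\partial e/\partial q^a$, $\dot e=(\partial e/\partial q)\,\dot q$, and let the PD control law be $u_{\rm PD}=-J^Tk_pe-J^Tk_d\dot e$. Put $z=(q^u,B_c^TD\dot q)\in\mathbb R^{2l}$, $\Phi(q,\dot q)=(e,\dot e,z)$ and $\psi(\Phi(q,\dot q))=(\dot q^u,\ B_c^T(\dot D\dot q-C\dot q-G))$. In these coordinates the full-order closed-loop hybrid system $\mathcal H$ is $\ddot e=f_e+g_eu_{\rm PD}$, $\dot z=\psi(e,\dot e,z)$ on $\Phi(\mathbb D\setminus\mathbb G)$, with reset $\Delta=\Phi\circ R\circ\Phi^{-1}$ on $\Phi(\mathbb G)$; here $f_e+g_eu_{\rm PD}$ is the derivative of $\dot e$ along $f+gu_{\rm PD}$. Let $\mathbb Z=\{(q,\dot q)\in\mathbb D: e=0,\dot e=0\}$ and assume $R(\mathbb G\cap\mathbb Z)\subset\mathbb Z$. The hybrid zero dynamics $\mathcal Z$ is $\dot z=\psi(0,0,z)$ on $\{z:(0,0,z)\in\Phi(\mathbb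 Z\setminus\mathbb G)\}$, with $z^+=\Delta_z(0,0,z)$ on $\{z:(0,0,z)\in\Phi(\mathbb Z\cap\mathbb G)\}$, where $\Delta_z$ is the $z$-component of $\Delta$. Let $(q^*(t),\dot q^*(t))\in\mathbb Z$, $0\le t\le T^*$, $T^*>0$, be a continuous trajectory with $(q^*,\dot q^*)(T^*)\in\mathbb G$ and $(q^*,\dot q^*)(0)=R\big((q^*,\dot q^*)(T^*)\big)$ whose $z$-part $z^*(t)$ solves the continuous part of $\mathcal Z$ on $[0,T^*)$. Put $z^*=z^*(T^*)$, $\mathcal O_z=\{z^*(t):0\le t<T^*\}$, and $\mathcal O=\iota(\mathcal O_z)$ with $\iota(z)=(0,0,z)$. For some $r>0$ let $\mathbb N_r=\{q\in\mathcal Q:\operatorname{dist}(q,q^*([0,T^*]))\le r\}$. All of the above in the coordinates $(e,\dot e,z)$, including $\Phi^{-1}$, is taken over $q\in\mathbb N_r$. **Output assumptions on $\mathbb N_r$.** (i) $q\mapsto(q^u,e(q))$ is injective on $\mathbb N_r$ and a local diffeomorphism (of class $C^3$) at each of its points. (ii) For all $q\in\mathbb N_r$, with $J_e=\begin{bmatrix}1&0\\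 \partial e/\partial q^u&J\end{bmatrix}$, $D_e=J_e^{-T}DJ_e^{-1}$, $B_e=1+B^TD_eB_c(B_c^TD_eB_c)^{-1}(\partial e/\partial q^u)^T$ and $B_e'=1-(B_c^TDB_c)^{-1}B_c^TDB\,J^{-1}\,\partial e/\partial q^u$: the matrix $B_e'$ is invertible, and $$\Lambda_{B_e}=\begin{bmatrix}B_e+B_e^T& B_e+(1+|e|)(B_e^T-1)\\ B_e^T+(1+|e|)(B_e-1)&(1+|e|)(B_e+B_e^T)\end{bmatrix}\succ0 .$$ **Stability notions.** Solutions of hybrid systems are right-continuous on $[0,\infty)$ with locally finitely many jumps. $\mathcal O_z$ is locally exponentially stable (LES) for $\mathcal Z$ if there are $M,\rho,\lambda>0$ such that, from $\Delta_z(0,0,z)$ for every $z$ in the guard of $\mathcal Z$ with $|z-z^*|<\rho$, a solution of $\mathcal Z$ on $[0,\infty)$ exists and every such solution $\phi_t$ satisfies $\operatorname{dist}(\phi_t,\mathcal O_z)\le Me^{-\lambda t}\operatorname{dist}(\phi_0,\mathcal O_z)$ for $t\ge0$. $\mathcal O$ is locally exponentially ultimately bounded (LEUB) for $\mathcal H$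 with ultimate bound $d$ if there are $M,\rho,\lambda>0$ such that, from $\Delta(w)$ for every $w\in\Phi(\mathbb G)$ with $|w-(0,0,z^*)|<\rho$, a solution of $\mathcal H$ on $[0,\infty)$ exists and every such solution satisfies $\operatorname{dist}(\phi_t,\mathcal O)\le Me^{-\lambda t}\operatorname{dist}(\phi_0,\mathcal O)+d$ for $t\ge0$. **Theorem.** Suppose that $\mathcal O_z$ is LES for $\mathcal Z$ and that the orbit is transverse to the switching surface: $\partial_qh(q^*(t))\dot q^*(t)\ne0$ whenever $t\in[0,T^*]$ and $h(q^*(t))=0$. Then for sufficiently large gains $k_p,k_d>1$ the set $\mathcal O$ is LEUB for the full-order system $\mathcal H$, and the ultimate bound can be made arbitrarily small by raising the gains. Precisely: there is $k_0>1$ such that for every $k\ge k_0$ and every $d>0$ there is $\varepsilon_0>1$ such that for all $\varepsilon\ge\varepsilon_0$, with $k_p=\varepsilon^2$ and $k_d=k\varepsilon$, the set $\mathcal O$ is LEUB for $\mathcal H$ with ultimate bound $d$. -/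

import Mathlib

open Set Filter Topology
open scoped Matrix Matrix.Norms.L2Operator Manifold

noncomputable section

/-! ### Hybrid systems, their solutions, and stability of sets -/

/-- A hybrid system `w' = field w` on `flowSet`, `w⁺ = reset w` on `guard`. -/
structure HybridSystem (E : Type*) where
  flowSet : Set E
  field : E → E
  guard : Set E
  reset : E → E

namespace HybridSystem

variable {E : Type*} [NormedAddCommGroup E] [NormedSpace ℝ E]

/-- `w` is a right-continuous solution on `[0, ∞)` that starts from `w₀` at time `0`.  The jump times
form a locally finite set `J`.  At each time the state lies in the flow set and moves along the
field; at a jump time the left limit lies in the guard and is mapped by the reset. -/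
def IsSolution (S : HybridSystem E) (w₀ : E) (w : ℝ → E) : Prop :=
  ∃ J : Set ℝ, J ⊆ Ioi 0 ∧ (∀ b : ℝ, (J ∩ Iic b).Finite) ∧ w 0 = w₀ ∧
    (∀ t, 0 ≤ t → w t ∈ S.flowSet ∧ HasDerivWithinAt w (S.field (w t)) (Ici t) t) ∧
    (∀ t, 0 < t → t ∉ J → HasDerivAt w (S.field (w t)) t) ∧
    (∀ t ∈ J, ∃ p ∈ S.guard, Tendsto w (𝓝[<] t) (𝓝 p) ∧ w t = S.reset p)

/-- `γ` on `[0, T)` is one period of a periodic solution with one jump per period: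
it starts at `reset p`, flows on `[0, T)`, and tends to the fixed point `p` of the guard
as `t → T`. -/
def IsPeriodicArc (S : HybridSystem E) (p : E) (T : ℝ) (γ : ℝ → E) : Prop :=
  0 < T ∧ p ∈ S.guard ∧ γ 0 = S.reset p ∧
    (∀ t ∈ Ico 0 T, γ t ∈ S.flowSet ∧ HasDerivWithinAt γ (S.field (γ t)) (Ico 0 T) t) ∧
    Tendsto γ (𝓝[<] T) (𝓝 p)

/-- The set `O` with nominal point `p` in the guard is locally exponentially stable: solutions that
start on the guard near `p` exist for all times and converge exponentially to `O`. -/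
def IsLES (S : HybridSystem E) (O : Set E) (p : E) : Prop :=
  ∃ M r lam : ℝ, 0 < M ∧ 0 < r ∧ 0 < lam ∧ ∀ y ∈ Metric.ball p r ∩ S.guard,
    (∃ w, S.IsSolution (S.reset y) w) ∧
    ∀ w, S.IsSolution (S.reset y) w → ∀ t, 0 ≤ t →
      Metric.infDist (w t) O ≤ M * Real.exp (-lam * t) * Metric.infDist (S.reset y) O

/-- The set `O` with nominal point `p` in the guard is locally exponentially ultimately bounded,
with ultimate bound `d`. -/
def IsLEUB (S : HybridSystem E) (O : Set E) (p : E) (d : ℝ) : Prop :=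
  ∃ M r lam : ℝ, 0 < M ∧ 0 < r ∧ 0 < lam ∧ ∀ y ∈ Metric.ball p r ∩ S.guard,
    (∃ w, S.IsSolution (S.reset y) w) ∧
    ∀ w, S.IsSolution (S.reset y) w → ∀ t, 0 ≤ t →
      Metric.infDist (w t) O ≤ M * Real.exp (-lam * t) * Metric.infDist (S.reset y) O + d

end HybridSystem

/-! ### Spaces -/

/-- Configurations `q = (qᵘ, qᵃ)`: `l` unactuated and `m` actuated coordinates. -/
abbrev Config (l m : ℕ) := EuclideanSpace ℝ (Fin l ⊕ Fin m)

/-- States `x = (q, q̇)`. -/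
abbrev State (l m : ℕ) := Config l m × Config l m

/-- Zero coordinates `z = (z₁, z₂) ∈ ℝ²ˡ`, with the Euclidean norm. -/
abbrev ZeroSpace (l : ℕ) := WithLp 2 (EuclideanSpace ℝ (Fin l) × EuclideanSpace ℝ (Fin l))

/-- Output coordinates `(e, ė) ∈ ℝ²ᵐ`, with the Euclidean norm. -/
abbrev OutSpace (m : ℕ) := WithLp 2 (EuclideanSpace ℝ (Fin m) × EuclideanSpace ℝ (Fin m))

/-- Transformed coordinates `(e, ė, z) ∈ ℝ²ⁿ`, with the Euclidean norm. -/
abbrev TransSpace (l m : ℕ) := WithLp 2 (OutSpace m × ZeroSpace l)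

/-- The canonical embedding `ι z = (0, 0, z)`. -/
def zeroEmbed (l m : ℕ) (z : ZeroSpace l) : TransSpace l m := WithLp.toLp 2 (0, z)

/-- A matrix acting on a Euclidean vector. -/
def act {ι κ : Type*} [Fintype κ] (A : Matrix ι κ ℝ) (v : EuclideanSpace ℝ κ) :
    EuclideanSpace ℝ ι :=
  WithLp.toLp 2 (A *ᵥ v.ofLp)

/-- The actuation matrix `B`. -/
def actB (l m : ℕ) : Matrix (Fin l ⊕ Fin m) (Fin m) ℝ := Matrix.fromRows 0 1

/-- The complementary matrix `B_c`, with `[B_c, B] = 1`. -/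
def actBc (l m : ℕ) : Matrix (Fin l ⊕ Fin m) (Fin l) ℝ := Matrix.fromRows 1 0

/-- The unactuated part `qᵘ`. -/
def unactPart {l m : ℕ} (q : Config l m) : EuclideanSpace ℝ (Fin l) :=
  WithLp.toLp 2 fun i => q (Sum.inl i)

/-- The actuated part `qᵃ`. -/
def actPart {l m : ℕ} (q : Config l m) : EuclideanSpace ℝ (Fin m) :=
  WithLp.toLp 2 fun i => q (Sum.inr i)

/-! ### The walking model -/

/-- The underactuated walking model in coordinates, with its standing properties, together with the
phase variable `τ` and the desired configuration `q^a_d`. -/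
structure WalkingRobot (l m : ℕ) where
  /-- the configuration space, a coordinate domain -/
  configs : Set (Config l m)
  isOpen_configs : IsOpen configs
  /-- the inertia matrix `D(q)` -/
  inertia : Config l m → Matrix (Fin l ⊕ Fin m) (Fin l ⊕ Fin m) ℝ
  /-- the Coriolis-centrifugal matrix `C(q, q̇)` -/
  coriolis : Config l m → Config l m → Matrix (Fin l ⊕ Fin m) (Fin l ⊕ Fin m) ℝ
  /-- the gravity vector `G(q)` -/
  gravity : Config l m → Config l m
  /-- the height `h` of the swing foot -/
  height : Config l m → ℝ
  /-- the impact map `R` (only its values on the guard matter) -/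
  impact : State l m → State l m
  /-- the phase variable `τ` -/
  phase : Config l m → ℝ
  /-- the desired actuated configuration `q^a_d(τ)` -/
  desired : ℝ → EuclideanSpace ℝ (Fin m)
  contDiffOn_inertia : ContDiffOn ℝ 2 inertia configs
  contDiffOn_coriolis :
    ContDiffOn ℝ 1 (fun x : State l m => coriolis x.1 x.2) (configs ×ˢ univ)
  contDiffOn_gravity : ContDiffOn ℝ 1 gravity configs
  contDiffOn_height : ContDiffOn ℝ 2 height configs
  contDiffOn_phase : ContDiffOn ℝ 3 phase configs
  contDiff_desired : ContDiff ℝ 3 desired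
  inertia_posDef : ∀ q ∈ configs, (inertia q).PosDef
  /-- `Ḋ - 2C` is skew-symmetric -/
  skew : ∀ q ∈ configs, ∀ v,
    (fderiv ℝ inertia q v - (2 : ℝ) • coriolis q v)ᵀ =
      -(fderiv ℝ inertia q v - (2 : ℝ) • coriolis q v)
  /-- uniform bounds on the model -/
  bounds : ∃ cl cu : ℝ, 0 < cl ∧ 0 < cu ∧ ∀ q ∈ configs, ∀ v : Config l m,
    (cl ≤ ‖inertia q‖ ∧ ‖inertia q‖ ≤ cu) ∧
    (cl ≤ ‖(inertia q)⁻¹‖ ∧ ‖(inertia q)⁻¹‖ ≤ cu) ∧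
    ‖fderiv ℝ inertia q v‖ ≤ cu * ‖v‖ ∧
    ‖coriolis q v‖ ≤ cu * ‖v‖ ∧
    ‖gravity q‖ ≤ cu
  /-- the impact map sends the guard into the domain -/
  impact_mem : ∀ x : State l m,
    (x.1 ∈ configs ∧ height x.1 = 0 ∧ fderiv ℝ height x.1 x.2 < 0) →
      (impact x).1 ∈ configs ∧ 0 ≤ height (impact x).1
  /-- no consecutive impacts -/
  impact_notMem : ∀ x : State l m,
    (x.1 ∈ configs ∧ height x.1 = 0 ∧ fderiv ℝ height x.1 x.2 < 0) →
      ¬ (height (impact x).1 = 0 ∧ fderiv ℝ height (impact x).1 (impact x).2 < 0)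
  locallyLipschitzOn_impact : LocallyLipschitzOn
    {x : State l m | x.1 ∈ configs ∧ height x.1 = 0 ∧ fderiv ℝ height x.1 x.2 < 0} impact

namespace WalkingRobot

variable {l m : ℕ} (S : WalkingRobot l m)

/-- The domain `{h ≥ 0}` of admissible states. -/
def domain : Set (State l m) := {x | x.1 ∈ S.configs ∧ 0 ≤ S.height x.1}

/-- The guard `{h = 0, L_f h < 0}`; as `h` depends on `q` only, `L_f h (q, q̇) = Dh(q) q̇`. -/
def guard : Set (State l m) :=
  {x | x.1 ∈ S.configs ∧ S.height x.1 = 0 ∧ fderiv ℝ S.height x.1 x.2 < 0}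

/-- The drift `f` of `D q̈ + C q̇ + G = B u` in state-space form. -/
def drift (x : State l m) : State l m :=
  (x.2, act (S.inertia x.1)⁻¹ (-(act (S.coriolis x.1 x.2) x.2) - S.gravity x.1))

/-- The input term `g u` of `D q̈ + C q̇ + G = B u` in state-space form. -/
def inputTerm (x : State l m) (u : EuclideanSpace ℝ (Fin m)) : State l m :=
  (0, act (S.inertia x.1)⁻¹ (act (actB l m) u))

/-- The output `e(q) = qᵃ - q^a_d(τ(q))`. -/
def out (q : Config l m) : EuclideanSpace ℝ (Fin m) := actPart q - S.desired (S.phase q)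

/-- The output velocity `ė(q, q̇)`. -/
def outVel (x : State l m) : EuclideanSpace ℝ (Fin m) := fderiv ℝ S.out x.1 x.2

/-- The Jacobian matrix `∂e/∂q`. -/
def outJac (q : Config l m) : Matrix (Fin m) (Fin l ⊕ Fin m) ℝ :=
  Matrix.of fun i j => fderiv ℝ S.out q (EuclideanSpace.single j (1 : ℝ)) i

/-- `∂e/∂qᵘ`. -/
def outJacU (q : Config l m) : Matrix (Fin m) (Fin l) ℝ := (S.outJac q).toCols₁

/-- `J = ∂e/∂qᵃ`. -/
def outJacA (q : Config l m) : Matrix (Fin m) (Fin m) ℝ := (S.outJac q).toCols₂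

/-- The PD control law `u = -Jᵀ k_p e - Jᵀ k_d ė`. -/
def pdControl (kp kd : ℝ) (x : State l m) : EuclideanSpace ℝ (Fin m) :=
  -(act (S.outJacA x.1)ᵀ (kp • S.out x.1)) - act (S.outJacA x.1)ᵀ (kd • S.outVel x)

/-- The closed-loop vector field `f + g u_PD` on states `(q, q̇)`. -/
def closedField (kp kd : ℝ) (x : State l m) : State l m :=
  S.drift x + S.inputTerm x (S.pdControl kp kd x)

/-- The zero coordinates `z = (qᵘ, B_cᵀ D q̇)`. -/
def zeroCoord (x : State l m) : ZeroSpace l :=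
  WithLp.toLp 2 (unactPart x.1, act ((actBc l m)ᵀ * S.inertia x.1) x.2)

/-- The coordinate change `Φ(q, q̇) = (e, ė, z)`. -/
def trans (x : State l m) : TransSpace l m :=
  WithLp.toLp 2 (WithLp.toLp 2 (S.out x.1, S.outVel x), S.zeroCoord x)

/-- The passive vector field `ψ(Φ(q, q̇)) = (q̇ᵘ, B_cᵀ (Ḋ q̇ - C q̇ - G))`. -/
def passiveField (x : State l m) : ZeroSpace l :=
  WithLp.toLp 2 (unactPart x.2,
    act (actBc l m)ᵀ
      (act (fderiv ℝ S.inertia x.1 x.2) x.2 - act (S.coriolis x.1 x.2) x.2 - S.gravity x.1))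

/-- The zero dynamics surface. -/
def zeroSurface : Set (State l m) := {x | x ∈ S.domain ∧ S.out x.1 = 0 ∧ S.outVel x = 0}

/-- Hybrid invariance of the zero dynamics surface. -/
def HybridInvariant : Prop := MapsTo S.impact (S.guard ∩ S.zeroSurface) S.zeroSurface

/-! ### The coordinate change and the hybrid systems over a set `N` of configurations -/

/-- `Φ⁻¹`, with values in the states over `N`. -/
def transInv (N : Set (Config l m)) (w : TransSpace l m) : State l m :=
  Function.invFunOn S.trans (N ×ˢ univ) w

/-- The impact map `Δ = Φ ∘ R ∘ Φ⁻¹` in transformed coordinates. -/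
def transImpact (N : Set (Config l m)) (w : TransSpace l m) : TransSpace l m :=
  S.trans (S.impact (S.transInv N w))

/-- The hybrid zero dynamics: `ż = ψ(0, 0, z)`, `z⁺ = Δ_z(0, 0, z)`. -/
def zeroDynamics (N : Set (Config l m)) : HybridSystem (ZeroSpace l) where
  flowSet := {z | zeroEmbed l m z ∈
    S.trans '' ((S.zeroSurface \ (S.zeroSurface ∩ S.guard)) ∩ N ×ˢ univ)}
  field z := S.passiveField (S.transInv N (zeroEmbed l m z))
  guard := {z | zeroEmbed l m z ∈ S.trans '' ((S.zeroSurface ∩ S.guard) ∩ N ×ˢ univ)}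
  reset z := (S.transImpact N (zeroEmbed l m z)).snd

/-- The full-order hybrid system under PD control in the coordinates `(e, ė, z)`: here
`ë = f_e + g_e u_PD` is the derivative of `ė` along the closed-loop vector field. -/
def closedLoop (N : Set (Config l m)) (kp kd : ℝ) : HybridSystem (TransSpace l m) where
  flowSet := S.trans '' ((S.domain \ S.guard) ∩ N ×ˢ univ)
  field w :=
    let x := S.transInv N w
    WithLp.toLp 2
      (WithLp.toLp 2 (S.outVel x, fderiv ℝ S.outVel x (S.closedField kp kd x)),
        S.passiveField x)
  guard := S.trans '' (S.guard ∩ N ×ˢ univ)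
  reset w := S.transImpact N w

/-! ### The nominal orbit and the assumptions on the outputs -/

/-- The closed tube of radius `r` (in configuration space) around `q*([0, T])`. -/
def tube (T r : ℝ) (xs : ℝ → State l m) : Set (Config l m) :=
  {q | q ∈ S.configs ∧ Metric.infDist q ((fun t => (xs t).1) '' Icc 0 T) ≤ r}

/-- `xs t = (q*(t), q̇*(t))`, `0 ≤ t ≤ T`, is the trajectory in the zero dynamics surface of a
periodic orbit of the hybrid zero dynamics: its pre-impact state is `xs T`, its post-impact state
is `xs 0`, and its zero coordinates form a periodic arc with fixed point `z* = z(xs T)`. -/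
def IsPeriodicTrajectory (N : Set (Config l m)) (T : ℝ) (xs : ℝ → State l m) : Prop :=
  0 < T ∧ ContinuousOn xs (Icc 0 T) ∧ (∀ t ∈ Icc 0 T, xs t ∈ S.zeroSurface) ∧
    xs 0 = S.impact (xs T) ∧
    (S.zeroDynamics N).IsPeriodicArc (S.zeroCoord (xs T)) T (fun t => S.zeroCoord (xs t))

/-- The orbit `O_z = {z*(t) : 0 ≤ t < T}`. -/
def orbitZ (T : ℝ) (xs : ℝ → State l m) : Set (ZeroSpace l) :=
  (fun t => S.zeroCoord (xs t)) '' Ico 0 T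

/-- The orbit, end points included, crosses the surface `{h = 0}` only transversally. -/
def IsTransverse (T : ℝ) (xs : ℝ → State l m) : Prop :=
  ∀ t ∈ Icc 0 T, S.height (xs t).1 = 0 → fderiv ℝ S.height (xs t).1 (xs t).2 ≠ 0

/-- The map `q ↦ (qᵘ, e(q))`. -/
def outChart (q : Config l m) : Config l m :=
  WithLp.toLp 2 (Sum.elim (unactPart q).ofLp (S.out q).ofLp)

/-- `q ↦ (qᵘ, e(q))` is on `N` a local diffeomorphism onto its image. -/
def OutputsDiffeo (N : Set (Config l m)) : Prop :=
  InjOn S.outChart N ∧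
    IsLocalDiffeomorphOn 𝓘(ℝ, Config l m) 𝓘(ℝ, Config l m) 3 S.outChart N

/-- `J_e = [1, 0; ∂e/∂qᵘ, J]`. -/
def jacE (q : Config l m) : Matrix (Fin l ⊕ Fin m) (Fin l ⊕ Fin m) ℝ :=
  Matrix.fromBlocks 1 0 (S.outJacU q) (S.outJacA q)

/-- `D_e = J_e⁻ᵀ D J_e⁻¹`. -/
def inertiaE (q : Config l m) : Matrix (Fin l ⊕ Fin m) (Fin l ⊕ Fin m) ℝ :=
  ((S.jacE q)⁻¹)ᵀ * S.inertia q * (S.jacE q)⁻¹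

/-- `B_e = 1 + Bᵀ D_e B_c (B_cᵀ D_e B_c)⁻¹ (∂e/∂qᵘ)ᵀ`. -/
def matBe (q : Config l m) : Matrix (Fin m) (Fin m) ℝ :=
  1 + (actB l m)ᵀ * S.inertiaE q * actBc l m *
    ((actBc l m)ᵀ * S.inertiaE q * actBc l m)⁻¹ * (S.outJacU q)ᵀ

/-- `B_e' = 1 - (B_cᵀ D B_c)⁻¹ B_cᵀ D B J⁻¹ (∂e/∂qᵘ)`. -/
def matBe' (q : Config l m) : Matrix (Fin l) (Fin l) ℝ :=
  1 - ((actBc l m)ᵀ * S.inertia q * actBc l m)⁻¹ *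
    ((actBc l m)ᵀ * S.inertia q * actB l m) * (S.outJacA q)⁻¹ * S.outJacU q

/-- The block matrix `Λ_{B_e}`. -/
def matLambda (q : Config l m) : Matrix (Fin m ⊕ Fin m) (Fin m ⊕ Fin m) ℝ :=
  Matrix.fromBlocks
    (S.matBe q + (S.matBe q)ᵀ)
    (S.matBe q + (1 + ‖S.out q‖) • ((S.matBe q)ᵀ - 1))
    ((S.matBe q)ᵀ + (1 + ‖S.out q‖) • (S.matBe q - 1))
    ((1 + ‖S.out q‖) • (S.matBe q + (S.matBe q)ᵀ))

/-- The outputs vary so little with `qᵘ` that on `N` the matrix `B_e'` is invertible and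
`Λ_{B_e}` is symmetric positive definite. -/
def OutputsSmallVariation (N : Set (Config l m)) : Prop :=
  ∀ q ∈ N, IsUnit (S.matBe' q) ∧ (S.matLambda q).PosDef

end WalkingRobot

end

/-!
The gains are chosen before the constants of ultimate boundedness, so what has to be shown is a
practical stability statement: for large `ε` all solutions that leave the guard close enough to the
nominal pre-impact state exist for all times and stay within `d` of the orbit.

*Normal form.*  In the coordinates `(e, ė, z)` the output obeys
`ë = f - K (ε² e + k ε ė)` with `K = E D⁻¹ B Jᵀ`, `E = ∂e/∂q`.  Put `P = (E D⁻¹ Eᵀ)⁻¹`, the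
inertia seen by the outputs.  A block computation gives `P K = B_e`
(`WalkingRobot.matM_mul_matBe`), and the upper left block of `Λ` says that `B_e` has a positive
definite symmetric part.  So `P` is a Lyapunov matrix for the fast variables `(ε e, ė)`.  The
invertibility of `J_e` and `B_e'` makes `(e, ė, z)` a local diffeomorphism
(`WalkingRobot.fderiv_trans_injective`), so everything is `C¹` in these coordinates.  The result is
packaged as a `HighGainSystem`, of which the robot is the instance
`WalkingRobot.IsRegularOrbit.normalForm`; the rest of the argument is about such systems.

*One step.*  Along a flow line near the orbit `ε ‖e‖ + ‖ė‖` decays at a rate proportional to `ε`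
down to `O(1 / ε)`; at times bounded away from `0` it is even of that size for `ε e` shifted to the
quasi-steady state `K⁻¹ f / ε`, which gives `‖e‖ + ‖ė‖ = O(1 / ε²)` at the end of a period
(`HighGainSystem.Frame.exists_output_bound`).  The second estimate is needed because the reset
mixes `e` and `ė`: it turns outputs of order `1 / ε²` before an impact into outputs for which
`ε ‖e‖ + ‖ė‖` is again of order `1 / ε`, thanks to hybrid invariance.  By Gronwall's inequality the
`z`-part follows the zero dynamics, and transversality turns this into a comparison of the
return maps to the guard (`HighGainSystem.Frame.exists_return_map`).

*Many steps.*  Exponential stability of the orbit for the zero dynamics says that the return map of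
the zero dynamics keeps a neighbourhood of the pre-impact state small, and contracts it after some
number `N` of steps (`HighGainSystem.exists_return_chain`).  The full-order return map shadows `N`
such steps with a small error, so that it maps a neighbourhood into itself after `N` steps
(`HighGainSystem.isLEUB_full`).  Every solution runs along the arcs so obtained, and the arcs
concatenate to a solution (`HybridSystem.IsSolution.exists_arc`,
`HybridSystem.exists_isSolution_of_isArc`).
-/

/-! ### Flows of Lipschitz vector fields -/

theorem exists_hasDerivAt_of_lipschitzWith_of_bounded {E : Type*} [NormedAddCommGroup E]
    [NormedSpace ℝ E] [CompleteSpace E] {F : E → E} {K : NNReal} (hF : LipschitzWith K F) {B : ℝ}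
    (hB : ∀ x, ‖F x‖ ≤ B) (x₀ : E) (T : ℝ) :
    ∃ γ : ℝ → E, γ 0 = x₀ ∧ ∀ t ∈ Icc 0 T, HasDerivAt γ (F (γ t)) t := by
  have hB0 : 0 ≤ B := (norm_nonneg _).trans (hB x₀)
  have hT : 0 ≤ |T| + 1 := by positivity
  let t₀ : Icc (-1 : ℝ) (|T| + 1) := ⟨0, by constructor <;> linarith⟩
  have hpl : IsPicardLindelof (fun _ => F) t₀ x₀ (⟨B * (|T| + 1), by positivity⟩ : NNReal) 0
      (⟨B, hB0⟩ : NNReal) K := by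
    refine ⟨fun _ _ => hF.lipschitzOnWith, fun _ _ => continuousOn_const, fun _ _ x _ => hB x, ?_⟩
    have : max (|T| + 1 - (t₀ : ℝ)) ((t₀ : ℝ) - -1) = |T| + 1 := by
      simp only [t₀]
      rw [max_eq_left] <;> linarith [abs_nonneg T]
    rw [this]
    change B * (|T| + 1) ≤ B * (|T| + 1) - 0
    simp
  obtain ⟨γ, h0, hγ⟩ := hpl.exists_eq_forall_mem_Icc_hasDerivWithinAt₀
  refine ⟨γ, h0, fun t ht => ?_⟩
  have h1 : t < |T| + 1 := by linarith [ht.2, le_abs_self T]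
  exact (hγ t ⟨by linarith [ht.1], h1.le⟩).hasDerivAt
    (Icc_mem_nhds (by linarith [ht.1]) h1)

/-- A curve that follows `F` cannot leave a solution `γ` of a Lipschitz field that agrees with `F`
on an open set containing `γ`. -/
theorem eq_of_hasDerivWithinAt_of_eqOn {E : Type*} [NormedAddCommGroup E]
    [NormedSpace ℝ E] {F G : E → E} {K : NNReal} (hG : LipschitzWith K G) {V : Set E}
    (hV : IsOpen V) (hFG : EqOn F G V) {w γ : ℝ → E} {b : ℝ} (h0 : w 0 = γ 0)
    (hw : ∀ t ∈ Ico 0 b, HasDerivWithinAt w (F (w t)) (Ici t) t)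
    (hwc : ContinuousOn w (Ico 0 b))
    (hγ : ∀ t ∈ Ico 0 b, HasDerivAt γ (G (γ t)) t) (hγV : ∀ t ∈ Ico 0 b, γ t ∈ V) :
    ∀ t ∈ Ico 0 b, w t = γ t := by
  intro c hc
  have hγc : ContinuousOn γ (Ico 0 b) := fun t ht => (hγ t ht).continuousAt.continuousWithinAt
  have hsub : Icc 0 c ⊆ Ico 0 b := fun t ht => ⟨ht.1, ht.2.trans_lt hc.2⟩
  have key : Icc 0 c ⊆ {t | w t = γ t} := by
    refine IsClosed.Icc_subset_of_forall_exists_gt ?_ h0 ?_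
    · have : {t | w t = γ t} ∩ Icc 0 c = {t ∈ Icc 0 c | w t = γ t} := by
        ext t; simp [and_comm]
      rw [this]
      exact isClosed_Icc.isClosed_eq (hwc.mono hsub) (hγc.mono hsub)
    · rintro x ⟨hx, hx0, hxc⟩ y hy
      have hxb : x ∈ Ico 0 b := ⟨hx0, hxc.trans hc.2⟩
      have hwV : ∀ᶠ t in 𝓝[≥] x, w t ∈ V := by
        have hcont : ContinuousWithinAt w (Ici x) x := (hw x hxb).continuousWithinAt
        refine hcont.eventually_mem ?_
        have hx' : w x = γ x := hx
        rw [hx']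
        exact hV.mem_nhds (hγV x hxb)
      obtain ⟨u, hu, hxu⟩ := mem_nhdsGE_iff_exists_Icc_subset.1 hwV
      obtain ⟨v, hxv, hvu, hvy, hvc⟩ : ∃ v, x < v ∧ v ≤ u ∧ v ≤ y ∧ v ≤ c :=
        ⟨min u (min y c), lt_min hu (lt_min hy hxc), min_le_left _ _,
          (min_le_right _ _).trans (min_le_left _ _), (min_le_right _ _).trans (min_le_right _ _)⟩
      have hsub' : Icc x v ⊆ Ico 0 b := fun t ht =>
        ⟨hx0.trans ht.1, (ht.2.trans hvc).trans_lt hc.2⟩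
      have := ODE_solution_unique_of_mem_Icc_right (v := fun _ => F) (s := fun _ => V) (K := K)
        (f := w) (g := γ) (a := x) (b := v)
        (fun _ _ x hx y hy => by rw [hFG hx, hFG hy]; exact hG x y)
        (hwc.mono hsub') (fun t ht => hw t (hsub' ⟨ht.1, ht.2.le⟩))
        (fun t ht => hxu ⟨ht.1, ht.2.le.trans hvu⟩) (hγc.mono hsub')
        (fun t ht => by
          have h := hsub' ⟨ht.1, ht.2.le⟩
          rw [hFG (hγV t h)]
          exact (hγ t h).hasDerivWithinAt)
        (fun t ht => hγV t (hsub' ⟨ht.1, ht.2.le⟩)) hx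
      exact ⟨v, this ⟨hxv.le, le_rfl⟩, hxv, hvy⟩
  exact key ⟨hc.1, le_rfl⟩

/-! ### Arcs of hybrid systems -/

namespace HybridSystem

variable {E : Type*} [NormedAddCommGroup E] [NormedSpace ℝ E]

/-- `γ` is, on `[0, τ)`, the flow of `S` from `x₀` up to its first jump, which takes place at time
`τ` from the point `p` of the guard; every solution from `x₀` follows `γ` and jumps at `p`. -/
structure IsArc (S : HybridSystem E) (x₀ : E) (τ : ℝ) (γ : ℝ → E) (p : E) : Prop where
  pos : 0 < τ
  start : γ 0 = x₀
  flow : ∀ t ∈ Ico 0 τ, γ t ∈ S.flowSet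
  deriv : ∀ t ∈ Ico 0 τ, HasDerivAt γ (S.field (γ t)) t
  tendsto : Tendsto γ (𝓝[<] τ) (𝓝 p)
  mem_guard : p ∈ S.guard
  unique : ∀ w, S.IsSolution x₀ w → (∀ t ∈ Ico 0 τ, w t = γ t) ∧ w τ = S.reset p

/-- A solution can be restarted at any time. -/
theorem IsSolution.shift {S : HybridSystem E} {x₀ : E} {w : ℝ → E} (hw : S.IsSolution x₀ w) {s : ℝ}
    (hs : 0 ≤ s) : S.IsSolution (w s) (fun t => w (s + t)) := by
  obtain ⟨J, hJ, hfin, h0, hflow, hder, hjump⟩ := hw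
  refine ⟨{t | 0 < t ∧ s + t ∈ J}, fun t ht => ht.1, fun b => ?_, by simp, fun t ht => ?_,
    fun t ht htJ => ?_, fun t ht => ?_⟩
  · refine ((hfin (s + b)).preimage (f := fun t => s + t)
      ((add_right_injective s).injOn)).subset ?_
    rintro t ⟨⟨_, ht⟩, htb⟩
    exact ⟨ht, by simpa using htb⟩
  · refine ⟨(hflow (s + t) (by linarith)).1, ?_⟩
    have h := (hflow (s + t) (by linarith)).2
    have h1 : HasDerivWithinAt (fun t : ℝ => s + t) 1 (Ici t) t :=
      ((hasDerivAt_id t).const_add s).hasDerivWithinAt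
    have := HasDerivWithinAt.scomp t h h1 (fun u hu => by simpa using hu)
    simpa [Function.comp_def] using this
  · have h := hder (s + t) (by linarith) (fun h => htJ ⟨ht, h⟩)
    simpa using h.comp_const_add s t
  · obtain ⟨p, hp, hlim, hr⟩ := hjump (s + t) ht.2
    refine ⟨p, hp, hlim.comp ?_, hr⟩
    refine tendsto_nhdsWithin_iff.2 ⟨?_, ?_⟩
    · exact (tendsto_nhdsWithin_of_tendsto_nhds
        ((continuous_const.add continuous_id).tendsto t))
    · filter_upwards [self_mem_nhdsWithin] with u hu
      simpa using hu

/-- A solution follows a curve that stays off the guard until it reaches it, and then jumps. -/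
theorem IsSolution.follows {S : HybridSystem E} {G : E → E} {K : NNReal} (hG : LipschitzWith K G)
    {V : Set E} (hV : IsOpen V) (hFG : EqOn S.field G V) {γ : ℝ → E} {τ : ℝ} (hτ : 0 < τ)
    (hγ : ∀ t ∈ Icc 0 τ, HasDerivAt γ (G (γ t)) t) (hγV : ∀ t ∈ Icc 0 τ, γ t ∈ V)
    (hout : ∀ t ∈ Ioo 0 τ, γ t ∉ S.guard) (hfl : γ τ ∉ S.flowSet)
    {w : ℝ → E} (hw : S.IsSolution (γ 0) w) :
    (∀ t ∈ Ico 0 τ, w t = γ t) ∧ w τ = S.reset (γ τ) := by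
  obtain ⟨J, hJ, hfin, h0, hflow, hder, hjump⟩ := hw
  -- Up to a time before which there is no jump, `w` solves the differential equation.
  have follow : ∀ b ≤ τ, (∀ t ∈ J, b ≤ t) → ∀ t ∈ Ico 0 b, w t = γ t := by
    intro b hb hbJ
    have hn : ∀ t ∈ Ico 0 b, t ∉ J := fun t ht h => absurd (hbJ t h) (not_le.2 ht.2)
    refine eq_of_hasDerivWithinAt_of_eqOn hG hV hFG h0 (fun t ht => (hflow t ht.1).2) ?_
      (fun t ht => hγ t ⟨ht.1, ht.2.le.trans hb⟩) (fun t ht => hγV t ⟨ht.1, ht.2.le.trans hb⟩)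
    intro t ht
    rcases ht.1.eq_or_lt with h | h
    · subst h
      exact (hflow 0 le_rfl).2.continuousWithinAt.mono (fun u hu => hu.1)
    · exact (hder t h (hn t ht)).continuousAt.continuousWithinAt
  have hlimγ : ∀ t ∈ Ioc 0 τ, (∀ u ∈ Ico 0 t, w u = γ u) → Tendsto w (𝓝[<] t) (𝓝 (γ t)) := by
    intro t ht he
    have h1 : Tendsto γ (𝓝[<] t) (𝓝 (γ t)) :=
      (hγ t ⟨ht.1.le, ht.2⟩).continuousAt.tendsto.mono_left nhdsWithin_le_nhds
    refine h1.congr' ?_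
    filter_upwards [Ico_mem_nhdsLT ht.1] with u hu
    exact (he u hu).symm
  have hJτ : ∀ t ∈ J, τ ≤ t := by
    by_contra! hcon
    obtain ⟨t₁, ht₁, ht₁τ⟩ := hcon
    obtain ⟨t, ⟨htJ, htτ⟩, hmin⟩ := (hfin τ).exists_minimal ⟨t₁, ht₁, ht₁τ.le⟩
    have hmin' : ∀ u ∈ J, t ≤ u := by
      intro u hu
      by_contra! hut
      exact absurd (hmin ⟨hu, hut.le.trans htτ⟩ hut.le) (not_le.2 hut)
    have htτ' : t < τ := (hmin' t₁ ht₁).trans_lt ht₁τ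
    have ht0 : 0 < t := hJ htJ
    obtain ⟨p, hp, hlim, -⟩ := hjump t htJ
    have := tendsto_nhds_unique hlim (hlimγ t ⟨ht0, htτ⟩ (follow t htτ hmin'))
    exact hout t ⟨ht0, htτ'⟩ (this ▸ hp)
  have heq := follow τ le_rfl hJτ
  refine ⟨heq, ?_⟩
  have hlim := hlimγ τ ⟨hτ, le_rfl⟩ heq
  have hτJ : τ ∈ J := by
    by_contra hn
    have h1 : Tendsto w (𝓝[<] τ) (𝓝 (w τ)) :=
      (hder τ hτ hn).continuousAt.tendsto.mono_left nhdsWithin_le_nhds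
    exact hfl (tendsto_nhds_unique h1 hlim ▸ (hflow τ hτ.le).1)
  obtain ⟨p, hp, hl, hr⟩ := hjump τ hτJ
  rw [hr, tendsto_nhds_unique hl hlim]

theorem IsArc.isSolution_shift {S : HybridSystem E} {x₀ : E} {τ : ℝ} {γ : ℝ → E} {p : E}
    (h : S.IsArc x₀ τ γ p) {w : ℝ → E} (hw : S.IsSolution x₀ w) :
    S.IsSolution (S.reset p) (fun t => w (τ + t)) := by
  have := hw.shift h.pos.le
  rwa [(h.unique w hw).2] at this

section Chain

variable {S : HybridSystem E} {y : ℕ → E} {τ : ℕ → ℝ} {γ : ℕ → ℝ → E} {τ₀ : ℝ}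

theorem exists_mem_Ico_sum {τ : ℕ → ℝ} {τ₀ : ℝ} (hτ₀ : 0 < τ₀) (hτ : ∀ j, τ₀ ≤ τ j) {t : ℝ}
    (ht : 0 ≤ t) :
    ∃ j, ∑ i ∈ Finset.range j, τ i ≤ t ∧ t < ∑ i ∈ Finset.range (j + 1), τ i := by
  have hge : ∀ j : ℕ, j * τ₀ ≤ ∑ i ∈ Finset.range j, τ i := by
    intro j
    have := Finset.card_nsmul_le_sum (Finset.range j) τ τ₀ (fun i _ => hτ i)
    simpa using this
  have hex : ∃ j, t < ∑ i ∈ Finset.range (j + 1), τ i := by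
    obtain ⟨n, hn⟩ := exists_nat_gt (t / τ₀)
    refine ⟨n, ?_⟩
    have h1 : t < n * τ₀ := (div_lt_iff₀ hτ₀).1 hn
    have h2 := hge (n + 1)
    push_cast at h2
    linarith
  classical
  refine ⟨Nat.find hex, ?_, Nat.find_spec hex⟩
  rcases Nat.eq_zero_or_pos (Nat.find hex) with h | h
  · rw [h]; simpa using ht
  · have := Nat.find_min hex (Nat.sub_lt h Nat.one_pos)
    rw [Nat.sub_add_cancel h] at this
    exact not_lt.1 this

/-- Every solution from the start of a chain of arcs runs through these arcs. -/
theorem IsSolution.exists_arc (hτ₀ : 0 < τ₀) (hτ : ∀ j, τ₀ ≤ τ j)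
    (h : ∀ j, S.IsArc (S.reset (y j)) (τ j) (γ j) (y (j + 1))) {w : ℝ → E}
    (hw : S.IsSolution (S.reset (y 0)) w) {t : ℝ} (ht : 0 ≤ t) :
    ∃ j, ∃ s ∈ Ico 0 (τ j), w t = γ j s := by
  have hsh : ∀ j, S.IsSolution (S.reset (y j)) (fun t => w (∑ i ∈ Finset.range j, τ i + t)) := by
    intro j
    induction j with
    | zero => simpa using hw
    | succ j ih =>
      have := (h j).isSolution_shift ih
      simpa [Finset.sum_range_succ, add_assoc] using this
  obtain ⟨j, h1, h2⟩ := exists_mem_Ico_sum hτ₀ hτ ht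
  rw [Finset.sum_range_succ] at h2
  have hs : t - ∑ i ∈ Finset.range j, τ i ∈ Ico 0 (τ j) := ⟨by linarith, by linarith⟩
  refine ⟨j, _, hs, ?_⟩
  have := ((h j).unique _ (hsh j)).1 _ hs
  simpa using this

/-- A chain of arcs whose durations are bounded below makes up a solution on `[0, ∞)`. -/
theorem exists_isSolution_of_isArc (hτ₀ : 0 < τ₀) (hτ : ∀ j, τ₀ ≤ τ j)
    (h : ∀ j, S.IsArc (S.reset (y j)) (τ j) (γ j) (y (j + 1))) :
    ∃ w, S.IsSolution (S.reset (y 0)) w := by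
  set s : ℕ → ℝ := fun j => ∑ i ∈ Finset.range j, τ i with hs
  have hs0 : s 0 = 0 := by simp [hs]
  have hsucc : ∀ j, s (j + 1) = s j + τ j := fun j => Finset.sum_range_succ _ _
  have hpos : ∀ j, 0 < τ j := fun j => hτ₀.trans_le (hτ j)
  have hmono : StrictMono s := strictMono_nat_of_lt_succ fun j => by
    rw [hsucc]; linarith [hpos j]
  have hidx : ∀ t : ℝ, ∃ j, 0 ≤ t → t ∈ Ico (s j) (s (j + 1)) := by
    intro t
    by_cases ht : 0 ≤ t
    · obtain ⟨j, h1, h2⟩ := exists_mem_Ico_sum hτ₀ hτ ht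
      exact ⟨j, fun _ => ⟨h1, h2⟩⟩
    · exact ⟨0, fun h => absurd h ht⟩
  choose idx hidx using hidx
  have hsnn : ∀ j, 0 ≤ s j := fun j => hs0 ▸ hmono.monotone (Nat.zero_le j)
  have hidx_eq : ∀ j, ∀ t ∈ Ico (s j) (s (j + 1)), idx t = j := by
    intro j t ht
    have h1 := hidx t ((hsnn j).trans ht.1)
    have h2 : idx t < j + 1 := hmono.lt_iff_lt.1 (h1.1.trans_lt ht.2)
    have h3 : j < idx t + 1 := hmono.lt_iff_lt.1 (ht.1.trans_lt h1.2)
    omega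
  set w : ℝ → E := fun t => γ (idx t) (t - s (idx t)) with hwdef
  have hw : ∀ j, ∀ t ∈ Ico (s j) (s (j + 1)), w t = γ j (t - s j) := by
    intro j t ht
    simp only [hwdef, hidx_eq j t ht]
  have hws : ∀ j, w (s j) = S.reset (y j) := by
    intro j
    rw [hw j _ ⟨le_rfl, hmono (Nat.lt_succ_self j)⟩, sub_self, (h j).start]
  have hder : ∀ j, ∀ t ∈ Ico (s j) (s (j + 1)),
      HasDerivAt (fun u => γ j (u - s j)) (S.field (w t)) t := by
    intro j t ht
    rw [hw j t ht]
    have := (h j).deriv (t - s j) ⟨by linarith [ht.1], by linarith [ht.2, hsucc j]⟩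
    simpa using this.comp_sub_const t (s j)
  refine ⟨w, range fun j => s (j + 1), ?_, fun b => ?_, ?_, fun t ht => ?_, fun t ht htJ => ?_, ?_⟩
  · rintro _ ⟨j, rfl⟩
    exact hs0 ▸ hmono (Nat.succ_pos j)
  · obtain ⟨n, hn⟩ := exists_nat_gt (b / τ₀)
    refine ((Set.finite_Iio n).image fun j => s (j + 1)).subset ?_
    rintro _ ⟨⟨j, rfl⟩, hj⟩
    refine ⟨j, ?_, rfl⟩
    have h1 : ((j + 1 : ℕ) : ℝ) * τ₀ ≤ s (j + 1) := by
      have := Finset.card_nsmul_le_sum (Finset.range (j + 1)) τ τ₀ (fun i _ => hτ i)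
      simpa [hs] using this
    have h2 : b < n * τ₀ := (div_lt_iff₀ hτ₀).1 hn
    have h3 : ((j + 1 : ℕ) : ℝ) * τ₀ < n * τ₀ := (h1.trans hj).trans_lt h2
    have h4 : ((j + 1 : ℕ) : ℝ) < n := lt_of_mul_lt_mul_right h3 hτ₀.le
    have : j + 1 < n := by exact_mod_cast h4
    exact Set.mem_Iio.2 (by omega)
  · simpa [hs0] using hws 0
  · obtain ⟨j, htj⟩ : ∃ j, t ∈ Ico (s j) (s (j + 1)) := ⟨_, hidx t ht⟩
    constructor
    · rw [hw j t htj]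
      exact (h j).flow _ ⟨by linarith [htj.1], by linarith [htj.2, hsucc j]⟩
    · refine (hder j t htj).hasDerivWithinAt.congr_of_eventuallyEq ?_ (hw j t htj)
      filter_upwards [Ico_mem_nhdsGE htj.2] with u hu
      exact hw j u ⟨htj.1.trans hu.1, hu.2⟩
  · obtain ⟨j, htj⟩ : ∃ j, t ∈ Ico (s j) (s (j + 1)) := ⟨_, hidx t ht.le⟩
    have hlt : s j < t := by
      rcases htj.1.eq_or_lt with h | h
      · exfalso
        cases j with
        | zero => rw [hs0] at h; linarith
        | succ i => exact htJ ⟨i, h⟩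
      · exact h
    refine (hder j t htj).congr_of_eventuallyEq ?_
    filter_upwards [Ioo_mem_nhds hlt htj.2] with u hu
    exact hw j u ⟨hu.1.le, hu.2⟩
  · rintro _ ⟨j, rfl⟩
    refine ⟨y (j + 1), (h j).mem_guard, ?_, hws (j + 1)⟩
    have hlt : s j < s (j + 1) := hmono (Nat.lt_succ_self j)
    have h1 : Tendsto (fun u => γ j (u - s j)) (𝓝[<] s (j + 1)) (𝓝 (y (j + 1))) := by
      refine (h j).tendsto.comp (tendsto_nhdsWithin_iff.2 ⟨?_, ?_⟩)
      · have : Tendsto (fun u => u - s j) (𝓝 (s (j + 1))) (𝓝 (s (j + 1) - s j)) :=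
          (continuous_id.sub continuous_const).tendsto _
        have h2 : s (j + 1) - s j = τ j := by rw [hsucc]; ring
        rw [h2] at this
        exact this.mono_left nhdsWithin_le_nhds
      · filter_upwards [self_mem_nhdsWithin] with u hu
        have : u < s (j + 1) := hu
        rw [hsucc] at this
        exact Set.mem_Iio.2 (by linarith)
    refine h1.congr' ?_
    filter_upwards [Ico_mem_nhdsLT hlt] with u hu
    exact (hw j u hu).symm

end Chain

end HybridSystem

/-! ### Crossing a level set transversally -/

theorem sub_le_mul_sub_of_hasDerivAt_le {φ φ' : ℝ → ℝ} {s t C : ℝ} (hst : s ≤ t)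
    (h : ∀ u ∈ Icc s t, HasDerivAt φ (φ' u) u) (hC : ∀ u ∈ Icc s t, φ' u ≤ C) :
    φ t - φ s ≤ C * (t - s) := by
  refine Convex.image_sub_le_mul_sub_of_deriv_le (convex_Icc s t)
    (fun u hu => (h u hu).continuousAt.continuousWithinAt)
    (fun u hu => (h u (interior_subset hu)).differentiableAt.differentiableWithinAt)
    (fun u hu => ?_) s (left_mem_Icc.2 hst) t (right_mem_Icc.2 hst) hst
  rw [(h u (interior_subset hu)).deriv]
  exact hC u (interior_subset hu)

theorem mul_sub_le_sub_of_le_hasDerivAt {φ φ' : ℝ → ℝ} {s t C : ℝ} (hst : s ≤ t)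
    (h : ∀ u ∈ Icc s t, HasDerivAt φ (φ' u) u) (hC : ∀ u ∈ Icc s t, C ≤ φ' u) :
    C * (t - s) ≤ φ t - φ s := by
  have := sub_le_mul_sub_of_hasDerivAt_le (C := -C) hst (fun u hu => (h u hu).neg)
    (fun u hu => neg_le_neg (hC u hu))
  simp only [Pi.neg_apply] at this
  linarith

section Crossing

variable {E : Type*} [NormedAddCommGroup E] {H σ : E → ℝ} {L L' : NNReal}

theorem LipschitzWith.abs_sub_le_mul_norm {H : E → ℝ} {L : NNReal} (hH : LipschitzWith L H)
    {x y : E} {δ : ℝ} (h : ‖x - y‖ ≤ δ) : |H x - H y| ≤ L * δ := by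
  have := hH.dist_le_mul x y
  rw [Real.dist_eq, dist_eq_norm] at this
  exact this.trans (mul_le_mul_of_nonneg_left h L.2)

/-- Curves near `ξ` that start in `{H ≥ 0}` enter `{H > 0}` and stay there, if `ξ` itself does so
and either starts in `{H > 0}` or leaves `{H = 0}` at positive speed. -/
theorem exists_forall_pos_of_close (hH : LipschitzWith L H) (hσ : LipschitzWith L' σ) {ξ : ℝ → E}
    {s : ℝ} (hs : 0 < s) (hξ : ContinuousOn ξ (Icc 0 s)) (hpos : ∀ t ∈ Ioc 0 s, 0 < H (ξ t))
    (h0 : 0 < H (ξ 0) ∨ 0 < σ (ξ 0)) :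
    ∃ δ > 0, ∀ γ : ℝ → E,
      (∀ t ∈ Icc 0 s, ‖γ t - ξ t‖ ≤ δ ∧ HasDerivAt (H ∘ γ) (σ (γ t)) t) → 0 ≤ H (γ 0) →
        ∀ t ∈ Ioc 0 s, 0 < H (γ t) := by
  -- a positive lower bound of `H` along `ξ` on a compact interval is inherited by nearby curves
  have comp : ∀ s₀ ∈ Icc 0 s, (∀ t ∈ Icc s₀ s, 0 < H (ξ t)) → ∃ δ > 0, ∀ γ : ℝ → E,
      (∀ t ∈ Icc 0 s, ‖γ t - ξ t‖ ≤ δ ∧ HasDerivAt (H ∘ γ) (σ (γ t)) t) →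
        ∀ t ∈ Icc s₀ s, 0 < H (γ t) := by
    intro s₀ hs₀ hp
    have hc : ContinuousOn (fun t => H (ξ t)) (Icc s₀ s) :=
      hH.continuous.comp_continuousOn (hξ.mono (Icc_subset_Icc_left hs₀.1))
    obtain ⟨t₀, ht₀, hmin⟩ := isCompact_Icc.exists_isMinOn ⟨s₀, left_mem_Icc.2 hs₀.2⟩ hc
    have hm := hp t₀ ht₀
    refine ⟨H (ξ t₀) / (2 * (L + 1)), by positivity, fun γ hγ t ht => ?_⟩
    have h1 := hH.abs_sub_le_mul_norm (hγ t ⟨hs₀.1.trans ht.1, ht.2⟩).1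
    have h2 : H (ξ t₀) ≤ H (ξ t) := hmin ht
    have h3 : (L : ℝ) * (H (ξ t₀) / (2 * (L + 1))) ≤ H (ξ t₀) / 2 := by
      rw [mul_div_assoc', div_le_div_iff₀ (by positivity) (by positivity)]
      nlinarith [L.2]
    have h4 := (abs_le.1 h1).1
    linarith
  rcases h0 with h0 | h0
  · obtain ⟨δ, hδ, h⟩ := comp 0 (left_mem_Icc.2 hs.le) (fun t ht => by
      rcases ht.1.eq_or_lt with h | h
      · rwa [← h]
      · exact hpos t ⟨h, ht.2⟩)
    exact ⟨δ, hδ, fun γ hγ _ t ht => h γ hγ t ⟨ht.1.le, ht.2⟩⟩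
  · have hc : ContinuousWithinAt (fun t => σ (ξ t)) (Icc 0 s) 0 :=
      (hσ.continuous.comp_continuousOn hξ) 0 (left_mem_Icc.2 hs.le)
    have hev : ∀ᶠ t in 𝓝[≥] (0 : ℝ), σ (ξ 0) / 2 < σ (ξ t) := by
      rw [← nhdsWithin_Icc_eq_nhdsGE hs]
      exact hc.eventually (lt_mem_nhds (by linarith))
    obtain ⟨u, hu0, hu⟩ := mem_nhdsGE_iff_exists_Icc_subset.1 hev
    have hu0' : (0 : ℝ) < u := hu0
    have hs₀ : 0 < min u s := lt_min hu0' hs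
    obtain ⟨δ, hδ, h⟩ := comp (min u s) ⟨hs₀.le, min_le_right _ _⟩
      (fun t ht => hpos t ⟨hs₀.trans_le ht.1, ht.2⟩)
    refine ⟨min δ (σ (ξ 0) / (4 * (L' + 1))), lt_min hδ (by positivity),
      fun γ hγ hγ0 t ht => ?_⟩
    rcases le_or_gt (min u s) t with hcase | hcase
    · exact h γ (fun t ht => ⟨(hγ t ht).1.trans (min_le_left _ _), (hγ t ht).2⟩) t ⟨hcase, ht.2⟩
    · have hσγ : ∀ v ∈ Icc 0 t, σ (ξ 0) / 4 ≤ σ (γ v) := by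
        intro v hv
        have h1 := hσ.abs_sub_le_mul_norm
          ((hγ v ⟨hv.1, hv.2.trans ht.2⟩).1.trans (min_le_right _ _))
        have h2 : σ (ξ 0) / 2 < σ (ξ v) :=
          hu ⟨hv.1, hv.2.trans (hcase.le.trans (min_le_left _ _))⟩
        have h3 : (L' : ℝ) * (σ (ξ 0) / (4 * (L' + 1))) ≤ σ (ξ 0) / 4 := by
          rw [mul_div_assoc', div_le_div_iff₀ (by positivity) (by positivity)]
          nlinarith [L'.2]
        have h4 := (abs_le.1 h1).1
        linarith
      have := mul_sub_le_sub_of_le_hasDerivAt (φ := H ∘ γ) (φ' := fun v => σ (γ v)) ht.1.le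
        (fun v hv => (hγ v ⟨hv.1, hv.2.trans ht.2⟩).2) hσγ
      simp only [Function.comp_apply] at this
      have : 0 < σ (ξ 0) / 4 * (t - 0) := mul_pos (by linarith) (by linarith [ht.1])
      linarith

/-- Curves near a reference curve `ξ` that crosses `{H = 0}` transversally at time `T` cross it once,
near time `T`. -/
theorem exists_crossing_of_close (hH : LipschitzWith L H) (hσ : LipschitzWith L' σ) {ξ : ℝ → E}
    {T θ₀ : ℝ} (hT : 0 < T) (hθ₀ : 0 < θ₀) (hξ : ContinuousOn ξ (Icc 0 (T + θ₀)))
    (hpos : ∀ t ∈ Ioo 0 T, 0 < H (ξ t)) (h0 : 0 < H (ξ 0) ∨ 0 < σ (ξ 0))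
    (hHT : H (ξ T) = 0) (hσT : σ (ξ T) < 0) :
    ∃ θ > 0, θ ≤ θ₀ ∧ θ ≤ T / 2 ∧ ∃ a > 0, ∃ δ > 0, ∀ γ : ℝ → E,
      (∀ t ∈ Icc 0 (T + θ), ‖γ t - ξ t‖ ≤ δ ∧ HasDerivAt (H ∘ γ) (σ (γ t)) t) → 0 ≤ H (γ 0) →
        ∃ τ ∈ Ioo (T - θ) (T + θ), H (γ τ) = 0 ∧ (∀ t ∈ Ioo 0 τ, 0 < H (γ t)) ∧
          ∀ t ∈ Icc (T - θ) (T + θ), σ (γ t) ≤ -a := by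
  obtain ⟨a, ha, haT⟩ : ∃ a > 0, σ (ξ T) < -(2 * a) :=
    ⟨-σ (ξ T) / 4, by linarith, by linarith⟩
  have hcT : ContinuousAt (fun t => σ (ξ t)) T :=
    (hσ.continuous.comp_continuousOn hξ).continuousAt (Icc_mem_nhds hT (by linarith))
  obtain ⟨θ₁, hθ₁, hball⟩ := Metric.eventually_nhds_iff_ball.1
    (hcT.eventually (gt_mem_nhds haT))
  set θ := min (θ₁ / 2) (min θ₀ (T / 2)) with hθ
  have hθpos : 0 < θ := lt_min (by linarith) (lt_min hθ₀ (by linarith))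
  have hθθ₀ : θ ≤ θ₀ := (min_le_right _ _).trans (min_le_left _ _)
  have hθT : θ ≤ T / 2 := (min_le_right _ _).trans (min_le_right _ _)
  have hθθ₁ : θ < θ₁ := (min_le_left _ _).trans_lt (by linarith)
  have hσξ : ∀ t ∈ Icc (T - θ) (T + θ), σ (ξ t) < -(2 * a) := by
    intro t ht
    refine hball t ?_
    rw [Metric.mem_ball, Real.dist_eq, abs_lt]
    constructor <;> linarith [ht.1, ht.2]
  obtain ⟨δ₁, hδ₁, hδ₁pos⟩ := exists_forall_pos_of_close hH hσ (s := T - θ) (by linarith)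
    (hξ.mono (Icc_subset_Icc_right (by linarith)))
    (fun t ht => hpos t ⟨ht.1, by linarith [ht.2]⟩) h0
  refine ⟨θ, hθpos, hθθ₀, hθT, a, ha,
    min δ₁ (min (a / (L' + 1)) (a * θ / (2 * (L + 1)))),
    lt_min hδ₁ (lt_min (by positivity) (by positivity)), fun γ hγ hγ0 => ?_⟩
  have hσγ : ∀ t ∈ Icc (T - θ) (T + θ), σ (γ t) ≤ -a := by
    intro t ht
    have h1 := hσ.abs_sub_le_mul_norm ((hγ t ⟨by linarith [ht.1], ht.2⟩).1.trans
      ((min_le_right _ _).trans (min_le_left _ _)))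
    have h2 := hσξ t ht
    have h3 : (L' : ℝ) * (a / (L' + 1)) ≤ a := by
      rw [mul_div_assoc', div_le_iff₀ (by positivity)]
      nlinarith [L'.2]
    have h4 := (abs_le.1 h1).2
    linarith
  have hder : ∀ t ∈ Icc 0 (T + θ), HasDerivAt (H ∘ γ) (σ (γ t)) t := fun t ht => (hγ t ht).2
  have hpos₁ : ∀ t ∈ Ioc 0 (T - θ), 0 < H (γ t) := hδ₁pos γ
    (fun t ht => ⟨(hγ t ⟨ht.1, by linarith [ht.2]⟩).1.trans (min_le_left _ _),
      hder t ⟨ht.1, by linarith [ht.2]⟩⟩) hγ0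
  have hdec : ∀ u ∈ Icc (T - θ) (T + θ), ∀ v ∈ Icc (T - θ) (T + θ), u ≤ v →
      H (γ v) - H (γ u) ≤ -a * (v - u) := by
    intro u hu v hv huv
    exact sub_le_mul_sub_of_hasDerivAt_le (φ := H ∘ γ) (φ' := fun v => σ (γ v)) huv
      (fun t ht => hder t ⟨by linarith [hu.1, ht.1], ht.2.trans hv.2⟩)
      (fun t ht => hσγ t ⟨hu.1.trans ht.1, ht.2.trans hv.2⟩)
  have hHend : H (γ (T + θ)) < 0 := by
    have h1 := hH.abs_sub_le_mul_norm ((hγ T ⟨hT.le, by linarith⟩).1.trans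
      ((min_le_right _ _).trans (min_le_right _ _)))
    rw [hHT, sub_zero] at h1
    have h3 : (L : ℝ) * (a * θ / (2 * (L + 1))) ≤ a * θ / 2 := by
      rw [mul_div_assoc', div_le_div_iff₀ (by positivity) (by positivity)]
      nlinarith [mul_nonneg L.2 (mul_pos ha hθpos).le, mul_pos ha hθpos]
    have h2 := hdec T ⟨by linarith, by linarith⟩ (T + θ) ⟨by linarith, by linarith⟩ (by linarith)
    have h4 := (abs_le.1 h1).2
    nlinarith [mul_pos ha hθpos]
  have hstart : 0 < H (γ (T - θ)) := hpos₁ _ ⟨by linarith, le_rfl⟩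
  have hcont : ContinuousOn (H ∘ γ) (Icc (T - θ) (T + θ)) := fun t ht =>
    (hder t ⟨by linarith [ht.1], ht.2⟩).continuousAt.continuousWithinAt
  obtain ⟨τ, hτ, hτ0⟩ := intermediate_value_Icc' (by linarith : T - θ ≤ T + θ) hcont
    (show (0 : ℝ) ∈ Icc ((H ∘ γ) (T + θ)) ((H ∘ γ) (T - θ)) from ⟨hHend.le, hstart.le⟩)
  have hτ0' : H (γ τ) = 0 := hτ0
  refine ⟨τ, ⟨lt_of_le_of_ne hτ.1 ?_, lt_of_le_of_ne hτ.2 ?_⟩, hτ0', fun t ht => ?_, hσγ⟩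
  · rintro rfl; linarith
  · rintro rfl; linarith
  · rcases le_or_gt t (T - θ) with h | h
    · exact hpos₁ t ⟨ht.1, h⟩
    · have := hdec t ⟨h.le, ht.2.le.trans hτ.2⟩ τ hτ ht.2.le
      nlinarith [mul_pos ha (sub_pos.2 ht.2)]

/-- The crossing times of two nearby curves differ by a multiple of their distance. -/
theorem abs_crossing_time_sub_le (hH : LipschitzWith L H) {γ₁ γ₂ : ℝ → E} {a κ s t τ₁ τ₂ : ℝ}
    (ha : 0 < a) (hder : ∀ u ∈ Icc s t, HasDerivAt (H ∘ γ₂) (σ (γ₂ u)) u)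
    (hσ : ∀ u ∈ Icc s t, σ (γ₂ u) ≤ -a) (hτ₁ : τ₁ ∈ Icc s t) (hτ₂ : τ₂ ∈ Icc s t)
    (h₁ : H (γ₁ τ₁) = 0) (h₂ : H (γ₂ τ₂) = 0) (hκ : ‖γ₁ τ₁ - γ₂ τ₁‖ ≤ κ) :
    |τ₁ - τ₂| ≤ L * κ / a := by
  have h := hH.abs_sub_le_mul_norm hκ
  rw [h₁, zero_sub, abs_neg] at h
  have hdec : ∀ u ∈ Icc s t, ∀ v ∈ Icc s t, u ≤ v → H (γ₂ v) - H (γ₂ u) ≤ -a * (v - u) :=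
    fun u hu v hv huv => sub_le_mul_sub_of_hasDerivAt_le (φ := H ∘ γ₂)
      (φ' := fun v => σ (γ₂ v)) huv (fun x hx => hder x ⟨hu.1.trans hx.1, hx.2.trans hv.2⟩)
      (fun x hx => hσ x ⟨hu.1.trans hx.1, hx.2.trans hv.2⟩)
  rw [le_div_iff₀ ha]
  rcases le_total τ₁ τ₂ with hle | hle
  · have := hdec τ₁ hτ₁ τ₂ hτ₂ hle
    rw [abs_of_nonpos (by linarith)]
    have := (abs_le.1 h).2
    nlinarith
  · have := hdec τ₂ hτ₂ τ₁ hτ₁ hle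
    rw [abs_of_nonneg (by linarith)]
    have := (abs_le.1 h).1
    nlinarith

end Crossing

/-! ### High-gain output dynamics -/

theorem le_exp_mul_add_of_hasDerivAt {V V' : ℝ → ℝ} {μ R s t : ℝ} (hμ : 0 < μ) (hR : 0 ≤ R)
    (hV : ∀ u ∈ Icc s t, HasDerivAt V (V' u) u) (hle : ∀ u ∈ Icc s t, V' u ≤ -μ * V u + R) :
    ∀ u ∈ Icc s t, V u ≤ Real.exp (-μ * (u - s)) * V s + R / μ := by
  intro u hu
  have := le_gronwallBound_of_liminf_deriv_right_le (f := V) (f' := V') (δ := V s) (K := -μ)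
    (ε := R) (a := s) (b := t) (fun x hx => (hV x hx).continuousAt.continuousWithinAt)
    (fun x hx r hr => (hV x ⟨hx.1, hx.2.le⟩).hasDerivWithinAt.liminf_right_slope_le hr) le_rfl
    (fun x hx => hle x ⟨hx.1, hx.2.le⟩) u hu
  rw [gronwallBound_of_K_ne_0 (by linarith)] at this
  have h1 : R / -μ * (Real.exp (-μ * (u - s)) - 1) ≤ R / μ := by
    rw [div_neg]
    have : 0 ≤ R / μ := by positivity
    nlinarith [mul_nonneg this (Real.exp_pos (-μ * (u - s))).le]
  linarith

set_option maxHeartbeats 1000000 in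
open scoped RealInnerProductSpace in
/-- The system `a' = ε (c - a / k) + φ₁`, `c' = - ε k K c + (ε / k) (c - a / k) + φ₂` is
exponentially stable with rate of order `ε`, and with gain of order `1 / ε` from the perturbations,
if `P K` has a positive definite symmetric part for some symmetric positive definite `P` and if `k`
is large: the Lyapunov function is `(s / 2) |a|² + ⟪c, P c⟫`. -/
theorem exists_highGain_bound {E : Type*} [NormedAddCommGroup E] [InnerProductSpace ℝ E]
    {s p p₀ p₁ : ℝ} (hs : 0 < s) (hp : 0 < p) (hp₀ : 0 < p₀) :
    ∃ k₀ : ℝ, 1 < k₀ ∧ ∀ k, k₀ ≤ k → ∃ C > 0, ∃ lam > 0, ∃ ε₀ : ℝ, 1 ≤ ε₀ ∧ ∀ ε, ε₀ ≤ ε →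
      ∀ (t₀ t₁ M : ℝ) (a c φ₁ φ₂ : ℝ → E) (P K P' : ℝ → E →L[ℝ] E), 0 ≤ M →
      (∀ t ∈ Icc t₀ t₁, HasDerivAt a (ε • (c t - k⁻¹ • a t) + φ₁ t) t) →
      (∀ t ∈ Icc t₀ t₁, HasDerivAt c
        (-((ε * k) • K t (c t)) + (ε / k) • (c t - k⁻¹ • a t) + φ₂ t) t) →
      (∀ t ∈ Icc t₀ t₁, HasDerivAt P (P' t) t) →
      (∀ t ∈ Icc t₀ t₁, ‖φ₁ t‖ ≤ M ∧ ‖φ₂ t‖ ≤ M ∧ ‖P t‖ ≤ p ∧ ‖P' t‖ ≤ p₁) →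
      (∀ t ∈ Icc t₀ t₁, ∀ x, (∀ y, ⟪P t x, y⟫ = ⟪x, P t y⟫) ∧ p₀ * ‖x‖ ^ 2 ≤ ⟪x, P t x⟫ ∧
        s * ‖x‖ ^ 2 ≤ ⟪x, P t (K t x)⟫) →
      ∀ t ∈ Icc t₀ t₁, ‖a t‖ + ‖c t‖ ≤
        C * (Real.exp (-lam * ε * (t - t₀)) * (‖a t₀‖ + ‖c t₀‖) + M / ε) := by
  set κ := (4 * p + 8 * p ^ 2 / s) / s with hκ
  have hκ0 : 0 < κ := by positivity
  refine ⟨2 + κ, by linarith, fun k hk => ?_⟩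
  have hk1 : 1 ≤ k := by linarith
  have hk0 : 0 < k := by linarith
  set β := s / (4 * k) with hβ
  have hβ0 : 0 < β := by positivity
  set vmax := s + p with hvmax
  have hvmax0 : 0 < vmax := by positivity
  set vmin := min (s / 2) p₀ with hvmin
  have hvmin0 : 0 < vmin := lt_min (by linarith) hp₀
  set q := s + 2 * p with hq
  have hq0 : 0 < q := by positivity
  set lam := β / (4 * vmax) with hlam
  have hlam0 : 0 < lam := by positivity
  set C2 := 2 / vmin * (vmax + q ^ 2 / (lam * β)) with hC2
  have hC20 : 0 < C2 := by positivity
  refine ⟨√C2, by positivity, lam, hlam0, max 1 (4 * p₁ / β), le_max_left _ _, fun ε hε => ?_⟩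
  have hε1 : 1 ≤ ε := (le_max_left _ _).trans hε
  have hε0 : 0 < ε := by linarith
  have hεp : p₁ ≤ ε * β / 4 := by
    have := (div_le_iff₀ hβ0).1 ((le_max_right _ _).trans hε)
    linarith
  intro t₀ t₁ M a c φ₁ φ₂ P K P' hM ha hc hP hbd hform t ht
  have bound : ∀ (A B : E) {x y : ℝ}, ‖A‖ ≤ x → ‖B‖ ≤ y → ⟪A, B⟫ ≤ x * y := fun A B x y hx hy =>
    (real_inner_le_norm A B).trans (mul_le_mul hx hy (norm_nonneg _) ((norm_nonneg _).trans hx))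
  set V : ℝ → ℝ := fun t => s / 2 * ⟪a t, a t⟫ + ⟪c t, P t (c t)⟫ with hV
  have hVle : ∀ u ∈ Icc t₀ t₁, V u ≤ vmax * (‖a u‖ ^ 2 + ‖c u‖ ^ 2) := by
    intro u hu
    have h1 : ⟪c u, P u (c u)⟫ ≤ ‖c u‖ * (p * ‖c u‖) :=
      bound _ _ le_rfl ((P u).le_of_opNorm_le (hbd u hu).2.2.1 _)
    simp only [hV, hvmax, real_inner_self_eq_norm_sq]
    nlinarith [sq_nonneg ‖a u‖, sq_nonneg ‖c u‖]
  have hVge : ∀ u ∈ Icc t₀ t₁, vmin * (‖a u‖ ^ 2 + ‖c u‖ ^ 2) ≤ V u := by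
    intro u hu
    have h1 := ((hform u hu) (c u)).2.1
    have h2 : vmin ≤ s / 2 := min_le_left _ _
    have h3 : vmin ≤ p₀ := min_le_right _ _
    simp only [hV, real_inner_self_eq_norm_sq]
    nlinarith [sq_nonneg ‖a u‖, sq_nonneg ‖c u‖]
  set V' : ℝ → ℝ := fun t =>
    s / 2 * (⟪a t, ε • (c t - k⁻¹ • a t) + φ₁ t⟫ + ⟪ε • (c t - k⁻¹ • a t) + φ₁ t, a t⟫) +
    (⟪c t, P' t (c t) +
        P t (-((ε * k) • K t (c t)) + (ε / k) • (c t - k⁻¹ • a t) + φ₂ t)⟫ +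
      ⟪-((ε * k) • K t (c t)) + (ε / k) • (c t - k⁻¹ • a t) + φ₂ t, P t (c t)⟫) with hV'
  have hder : ∀ u ∈ Icc t₀ t₁, HasDerivAt V (V' u) u := by
    intro u hu
    exact (((ha u hu).inner ℝ (ha u hu)).const_mul (s / 2)).add
      ((hc u hu).inner ℝ ((hP u hu).clm_apply (hc u hu)))
  set R := 2 * q ^ 2 * M ^ 2 / (ε * β) with hR
  have hdecr : ∀ u ∈ Icc t₀ t₁, V' u ≤ -(2 * lam * ε) * V u + R := by
    intro u hu
    obtain ⟨hφ₁, hφ₂, hPn, hP'n⟩ := hbd u hu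
    obtain ⟨hsym, hpos, hPK⟩ := (hform u hu) (c u)
    have e1 : V' u = s * (ε * ⟪a u, c u⟫ - ε / k * ‖a u‖ ^ 2 + ⟪a u, φ₁ u⟫) + ⟪c u, P' u (c u)⟫
        + 2 * (-(ε * k) * ⟪c u, P u (K u (c u))⟫ + ε / k * ⟪c u, P u (c u)⟫
          - ε / k ^ 2 * ⟪P u (c u), a u⟫ + ⟪P u (c u), φ₂ u⟫) := by
      simp only [hV']
      rw [real_inner_comm (a u) (ε • (c u - k⁻¹ • a u) + φ₁ u),
        real_inner_comm (P u (c u)) (-((ε * k) • K u (c u)) + (ε / k) • (c u - k⁻¹ • a u) + φ₂ u),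
        inner_add_right (c u) (P' u (c u)),
        ← hsym (-((ε * k) • K u (c u)) + (ε / k) • (c u - k⁻¹ • a u) + φ₂ u)]
      simp only [inner_add_right, inner_sub_right, inner_neg_right, real_inner_smul_right]
      rw [hsym (K u (c u)), hsym (c u), real_inner_self_eq_norm_sq]
      field_simp
      ring
    set A := ‖a u‖ with hA
    set c' := ‖c u‖ with hc'
    have hA0 : 0 ≤ A := norm_nonneg _
    have hc0 : 0 ≤ c' := norm_nonneg _
    have hPc : ‖P u (c u)‖ ≤ p * c' := (P u).le_of_opNorm_le hPn _
    have b1 : ⟪a u, c u⟫ ≤ A * c' := bound _ _ le_rfl le_rfl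
    have b2 : ⟪a u, φ₁ u⟫ ≤ A * M := bound _ _ le_rfl hφ₁
    have b3 : ⟪c u, P' u (c u)⟫ ≤ c' * (p₁ * c') :=
      bound _ _ le_rfl ((P' u).le_of_opNorm_le hP'n _)
    have b4 : ⟪c u, P u (c u)⟫ ≤ c' * (p * c') := bound _ _ le_rfl hPc
    have b5 : -⟪P u (c u), a u⟫ ≤ p * c' * A := by
      rw [← inner_neg_left]
      exact bound _ _ (by rwa [norm_neg]) le_rfl
    have b6 : ⟪P u (c u), φ₂ u⟫ ≤ p * c' * M := bound _ _ hPc hφ₂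
    -- the cross terms, by the inequality between the means
    have y1 : s * (A * c') ≤ s / (2 * k) * A ^ 2 + s * k / 2 * c' ^ 2 := by
      have : s / (2 * k) * A ^ 2 + s * k / 2 * c' ^ 2 - s * (A * c')
          = s / (2 * k) * (A - k * c') ^ 2 := by field_simp; ring
      rw [← sub_nonneg, this]
      positivity
    have y2 : 2 * p / k ^ 2 * (c' * A) ≤ s / (4 * k) * A ^ 2 + 4 * p ^ 2 / (s * k ^ 3) * c' ^ 2 := by
      have : s / (4 * k) * A ^ 2 + 4 * p ^ 2 / (s * k ^ 3) * c' ^ 2 - 2 * p / k ^ 2 * (c' * A)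
          = s / (4 * k) * (A - 4 * p / (s * k) * c') ^ 2 := by field_simp; ring
      rw [← sub_nonneg, this]
      positivity
    have y3 : 2 * p / k + 4 * p ^ 2 / (s * k ^ 3) ≤ s * k / 2 := by
      have h1 : 2 * p / k + 4 * p ^ 2 / (s * k ^ 3) ≤ 2 * p + 4 * p ^ 2 / s := by
        have i1 : 2 * p / k ≤ 2 * p := div_le_self (by positivity) hk1
        have i2 : 4 * p ^ 2 / (s * k ^ 3) ≤ 4 * p ^ 2 / s :=
          div_le_div_of_nonneg_left (by positivity) hs
            (le_mul_of_one_le_right hs.le (one_le_pow₀ hk1))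
        linarith only [i1, i2]
      have h2 : s * κ = 4 * p + 8 * p ^ 2 / s := by rw [hκ]; field_simp
      have h3 : s * κ ≤ s * k := mul_le_mul_of_nonneg_left (by linarith) hs.le
      have h4 : 8 * p ^ 2 / s = 2 * (4 * p ^ 2 / s) := by ring
      linarith only [h1, h2, h3, h4]
    have y4 : q * M * (A + c') ≤ ε * β / 4 * (A ^ 2 + c' ^ 2) + R := by
      have : ε * β / 4 * (A ^ 2 + c' ^ 2) + R - q * M * (A + c')
          = ε * β / 4 * ((A - 2 * q * M / (ε * β)) ^ 2 + (c' - 2 * q * M / (ε * β)) ^ 2) := by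
        rw [hR]; field_simp; ring
      rw [← sub_nonneg, this]
      positivity
    have y5 : p₁ * c' ^ 2 ≤ ε * β / 4 * (A ^ 2 + c' ^ 2) := by
      have := mul_le_mul_of_nonneg_right hεp (sq_nonneg c')
      have h' : 0 ≤ ε * β / 4 * A ^ 2 := by positivity
      linarith only [this, h']
    have main : V' u ≤ ε * (s * (A * c') - s / k * A ^ 2 - 2 * k * (s * c' ^ 2) + 2 * p / k * c' ^ 2
        + 2 * p / k ^ 2 * (c' * A)) + p₁ * c' ^ 2 + q * M * (A + c') := by
      rw [e1]
      have m1 : s * ε * ⟪a u, c u⟫ ≤ s * ε * (A * c') :=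
        mul_le_mul_of_nonneg_left b1 (by positivity)
      have m2 : s * ⟪a u, φ₁ u⟫ ≤ s * (A * M) := mul_le_mul_of_nonneg_left b2 hs.le
      have m3 : (ε * k) * (s * c' ^ 2) ≤ (ε * k) * ⟪c u, P u (K u (c u))⟫ :=
        mul_le_mul_of_nonneg_left hPK (by positivity)
      have m4 : ε / k * ⟪c u, P u (c u)⟫ ≤ ε / k * (c' * (p * c')) :=
        mul_le_mul_of_nonneg_left b4 (by positivity)
      have m5 : ε / k ^ 2 * -⟪P u (c u), a u⟫ ≤ ε / k ^ 2 * (p * c' * A) :=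
        mul_le_mul_of_nonneg_left b5 (by positivity)
      have e2 : ε * (s * (A * c') - s / k * A ^ 2 - 2 * k * (s * c' ^ 2) + 2 * p / k * c' ^ 2
        + 2 * p / k ^ 2 * (c' * A)) = s * ε * (A * c') - s * (ε / k * A ^ 2)
          - 2 * ((ε * k) * (s * c' ^ 2)) + 2 * (ε / k * (c' * (p * c')))
          + 2 * (ε / k ^ 2 * (p * c' * A)) := by ring
      rw [e2, hq]
      have n1 := mul_nonneg hs.le (mul_nonneg hM hc0)
      have n2 := mul_nonneg hp.le (mul_nonneg hM hA0)
      linarith only [m1, m2, m3, m4, m5, b3, b6, n1, n2]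
    have br : s * (A * c') - s / k * A ^ 2 - 2 * k * (s * c' ^ 2) + 2 * p / k * c' ^ 2
        + 2 * p / k ^ 2 * (c' * A) ≤ -β * (A ^ 2 + c' ^ 2) := by
      have y3' := mul_le_mul_of_nonneg_right y3 (sq_nonneg c')
      have e3 : s / k * A ^ 2 = s / (2 * k) * A ^ 2 + s / (4 * k) * A ^ 2 + β * A ^ 2 := by
        rw [hβ]; field_simp; ring
      have h5 : β * c' ^ 2 ≤ s * k * c' ^ 2 := by
        refine mul_le_mul_of_nonneg_right ?_ (sq_nonneg _)
        rw [hβ, div_le_iff₀ (by positivity)]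
        nlinarith [mul_nonneg hs.le (sub_nonneg.2 hk1)]
      linarith only [y1, y2, y3', e3, h5]
    have br' := mul_le_mul_of_nonneg_left br hε0.le
    have hv := hVle u hu
    have e4 : 2 * lam * ε * (vmax * (A ^ 2 + c' ^ 2)) = ε * β / 2 * (A ^ 2 + c' ^ 2) := by
      rw [hlam]; field_simp; ring
    have hv' := mul_le_mul_of_nonneg_left hv (show 0 ≤ 2 * lam * ε by positivity)
    rw [e4] at hv'
    linarith only [main, br', hv', y4, y5]
  have hμ : 0 < 2 * lam * ε := by positivity
  have hfin := le_exp_mul_add_of_hasDerivAt hμ (by positivity) hder hdecr t ht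
  have ht₀ : t₀ ∈ Icc t₀ t₁ := left_mem_Icc.2 (ht.1.trans ht.2)
  set x := Real.exp (-lam * ε * (t - t₀)) with hx
  have hx0 : 0 < x := Real.exp_pos _
  have hx2 : Real.exp (-(2 * lam * ε) * (t - t₀)) = x ^ 2 := by
    rw [hx, ← Real.exp_nat_mul]; congr 1; push_cast; ring
  rw [hx2] at hfin
  set N := ‖a t₀‖ + ‖c t₀‖ with hN
  have hN0 : 0 ≤ N := by positivity
  have h1 : V t₀ ≤ vmax * N ^ 2 := by
    refine (hVle t₀ ht₀).trans (mul_le_mul_of_nonneg_left ?_ hvmax0.le)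
    linarith only [hN, mul_nonneg (norm_nonneg (a t₀)) (norm_nonneg (c t₀))]
  have h2 : (‖a t‖ + ‖c t‖) ^ 2 ≤ 2 / vmin * V t := by
    have := hVge t ht
    rw [div_mul_eq_mul_div, le_div_iff₀ hvmin0]
    linarith only [this, mul_nonneg hvmin0.le (sq_nonneg (‖a t‖ - ‖c t‖))]
  have h3 : R / (2 * lam * ε) = q ^ 2 / (lam * β) * (M / ε) ^ 2 := by
    rw [hR]; field_simp
  have h4 : (‖a t‖ + ‖c t‖) ^ 2 ≤ C2 * (x * N + M / ε) ^ 2 := by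
    have hMε : 0 ≤ M / ε := by positivity
    have h5 : V t ≤ (vmax + q ^ 2 / (lam * β)) * (x * N + M / ε) ^ 2 := by
      have h6 := mul_le_mul_of_nonneg_left h1 (sq_nonneg x)
      rw [h3] at hfin
      have h7 : 0 ≤ q ^ 2 / (lam * β) := by positivity
      have hxN : 0 ≤ x * N := by positivity
      have h8 : x ^ 2 * N ^ 2 ≤ (x * N + M / ε) ^ 2 := by
        rw [← mul_pow]
        exact pow_le_pow_left₀ hxN (by linarith only [hMε]) 2
      have h9 : (M / ε) ^ 2 ≤ (x * N + M / ε) ^ 2 :=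
        pow_le_pow_left₀ hMε (by linarith only [hxN]) 2
      linarith only [hfin, h6, mul_le_mul_of_nonneg_left h8 hvmax0.le,
        mul_le_mul_of_nonneg_left h9 h7]
    calc _ ≤ 2 / vmin * V t := h2
      _ ≤ 2 / vmin * ((vmax + q ^ 2 / (lam * β)) * (x * N + M / ε) ^ 2) :=
        mul_le_mul_of_nonneg_left h5 (by positivity)
      _ = _ := by rw [hC2]; ring
  have h10 : 0 ≤ x * N + M / ε := by positivity
  refine le_of_sq_le_sq ?_ (by positivity)
  rw [mul_pow, Real.sq_sqrt hC20.le]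
  exact h4

/-! ### High-gain hybrid systems in normal form -/

open scoped RealInnerProductSpace in
/-- A hybrid system with output `pe w`, output velocity `pb w` and zero coordinates `pz w`, under PD
control of the output with gains `ε ^ 2` and `k * ε`, together with its zero dynamics on
`range ι = {pe = 0, pb = 0}` and a periodic orbit `ζ` of the latter.  All data are described on an
open neighbourhood `U` of the orbit only.  The guard is `{H = 0, σ < 0}`, where `σ` is the derivative
of `H` along the flow; `H` does not see the control, and neither does `P`, whose derivative along
the flow is `P'`. -/
structure HighGainSystem (E Z W : Type*) [NormedAddCommGroup E] [InnerProductSpace ℝ E]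
    [NormedAddCommGroup Z] [NormedSpace ℝ Z] [NormedAddCommGroup W] [NormedSpace ℝ W] where
  pe : W →L[ℝ] E
  pb : W →L[ℝ] E
  pz : W →L[ℝ] Z
  ι : Z →L[ℝ] W
  pe_ι : ∀ z, pe (ι z) = 0
  pb_ι : ∀ z, pb (ι z) = 0
  pz_ι : ∀ z, pz (ι z) = z
  norm_le : ∀ w, ‖w‖ ≤ ‖pe w‖ + ‖pb w‖ + ‖pz w‖
  norm_pe_le : ∀ w, ‖pe w‖ ≤ ‖w‖
  norm_pb_le : ∀ w, ‖pb w‖ ≤ ‖w‖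
  norm_pz_le : ∀ w, ‖pz w‖ ≤ ‖w‖
  U : Set W
  isOpen_U : IsOpen U
  /-- the full-order system with gains `ε ^ 2` and `k * ε` -/
  full : ℝ → ℝ → HybridSystem W
  /-- the zero dynamics -/
  zero : HybridSystem Z
  f : W → E
  K : W → E →L[ℝ] E
  P : W → E →L[ℝ] E
  P' : W → E →L[ℝ] E
  ψ : W → Z
  H : W → ℝ
  σ : W → ℝ
  Δ : W → W
  contDiffOn_f : ContDiffOn ℝ 1 f U
  contDiffOn_K : ContDiffOn ℝ 1 K U
  contDiffOn_P : ContDiffOn ℝ 1 P U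
  continuousOn_P' : ContinuousOn P' U
  contDiffOn_ψ : ContDiffOn ℝ 1 ψ U
  contDiffOn_H : ContDiffOn ℝ 1 H U
  contDiffOn_σ : ContDiffOn ℝ 1 σ U
  contDiffOn_field : ∀ ε k, ContDiffOn ℝ 1 (full ε k).field U
  pe_field : ∀ ε k, ∀ w ∈ U, pe ((full ε k).field w) = pb w
  pb_field : ∀ ε k, ∀ w ∈ U,
    pb ((full ε k).field w) = f w - K w (ε ^ 2 • pe w + (k * ε) • pb w)
  pz_field : ∀ ε k, ∀ w ∈ U, pz ((full ε k).field w) = ψ w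
  fderiv_P : ∀ ε k, ∀ w ∈ U, fderiv ℝ P w ((full ε k).field w) = P' w
  fderiv_H : ∀ w ∈ U, ∀ v, pe v = pb w → pz v = ψ w → fderiv ℝ H w v = σ w
  P_symm : ∀ w ∈ U, ∀ x y, ⟪P w x, y⟫ = ⟪x, P w y⟫
  P_pos : ∀ w ∈ U, ∀ x, x ≠ 0 → 0 < ⟪x, P w x⟫
  PK_pos : ∀ w ∈ U, ∀ x, x ≠ 0 → 0 < ⟪x, P w (K w x)⟫
  mem_full_flowSet : ∀ ε k, ∀ w ∈ U, (w ∈ (full ε k).flowSet ↔ 0 ≤ H w ∧ ¬(H w = 0 ∧ σ w < 0))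
  mem_full_guard : ∀ ε k, ∀ w ∈ U, (w ∈ (full ε k).guard ↔ H w = 0 ∧ σ w < 0)
  full_reset : ∀ ε k, (full ε k).reset = Δ
  zero_field : ∀ z, ι z ∈ U → zero.field z = ψ (ι z)
  mem_zero_flowSet : ∀ z, ι z ∈ U →
    (z ∈ zero.flowSet ↔ 0 ≤ H (ι z) ∧ ¬(H (ι z) = 0 ∧ σ (ι z) < 0))
  mem_zero_guard : ∀ z, ι z ∈ U → (z ∈ zero.guard ↔ H (ι z) = 0 ∧ σ (ι z) < 0)
  zero_reset : ∀ z, zero.reset z = pz (Δ (ι z))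
  /-- the period of the orbit -/
  T : ℝ
  T_pos : 0 < T
  ζ : ℝ → Z
  ζ_mem : ∀ t ∈ Icc 0 T, ι (ζ t) ∈ U
  continuousOn_ζ : ContinuousOn ζ (Icc 0 T)
  deriv_ζ : ∀ t ∈ Ico 0 T, HasDerivWithinAt ζ (ψ (ι (ζ t))) (Ici t) t
  ζ_flow : ∀ t ∈ Ico 0 T, 0 ≤ H (ι (ζ t)) ∧ ¬(H (ι (ζ t)) = 0 ∧ σ (ι (ζ t)) < 0)
  ζ_transverse : ∀ t ∈ Icc 0 T, H (ι (ζ t)) = 0 → σ (ι (ζ t)) ≠ 0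
  ζ_guard : H (ι (ζ T)) = 0 ∧ σ (ι (ζ T)) < 0
  ζ_start : ζ 0 = pz (Δ (ι (ζ T)))
  reset_lipschitz : ∃ ρ > 0, ∃ L : NNReal,
    LipschitzOnWith L Δ (Metric.ball (ι (ζ T)) ρ ∩ {w | w ∈ U ∧ H w = 0 ∧ σ w < 0})
  reset_mem : ∀ᶠ w in 𝓝 (ι (ζ T)), w ∈ U → H w = 0 → σ w < 0 →
    0 ≤ H (Δ w) ∧ ¬(H (Δ w) = 0 ∧ σ (Δ w) < 0)
  reset_ι : ∀ z, ι z ∈ U → H (ι z) = 0 → σ (ι z) < 0 → pe (Δ (ι z)) = 0 ∧ pb (Δ (ι z)) = 0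

namespace HighGainSystem

variable {E Z W : Type*} [NormedAddCommGroup E] [InnerProductSpace ℝ E]
    [NormedAddCommGroup Z] [NormedSpace ℝ Z] [NormedAddCommGroup W] [NormedSpace ℝ W]
    (S : HighGainSystem E Z W)

theorem norm_ι (z : Z) : ‖S.ι z‖ = ‖z‖ := by
  refine le_antisymm ?_ ?_
  · simpa [S.pe_ι, S.pb_ι, S.pz_ι] using S.norm_le (S.ι z)
  · simpa [S.pz_ι] using S.norm_pz_le (S.ι z)

theorem ι_pz {w : W} (he : S.pe w = 0) (hb : S.pb w = 0) : S.ι (S.pz w) = w := by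
  have h := S.norm_le (S.ι (S.pz w) - w)
  simp only [map_sub, S.pe_ι, S.pb_ι, S.pz_ι, he, hb] at h
  simpa [sub_eq_zero] using h

theorem norm_sub_ι_le (w : W) (z : Z) :
    ‖w - S.ι z‖ ≤ ‖S.pe w‖ + ‖S.pb w‖ + ‖S.pz w - z‖ := by
  simpa [S.pe_ι, S.pb_ι, S.pz_ι] using S.norm_le (w - S.ι z)

theorem Δ_ι {z : Z} (h : S.ι z ∈ S.U) (hH : S.H (S.ι z) = 0) (hσ : S.σ (S.ι z) < 0) :
    S.Δ (S.ι z) = S.ι (S.zero.reset z) := by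
  rw [S.zero_reset, S.ι_pz (S.reset_ι z h hH hσ).1 (S.reset_ι z h hH hσ).2]

theorem reset_ζ : S.zero.reset (S.ζ S.T) = S.ζ 0 := by
  rw [S.zero_reset, ← S.ζ_start]

theorem Δ_ζ : S.Δ (S.ι (S.ζ S.T)) = S.ι (S.ζ 0) := by
  rw [S.Δ_ι (S.ζ_mem _ (right_mem_Icc.2 S.T_pos.le)) S.ζ_guard.1 S.ζ_guard.2, S.reset_ζ]

end HighGainSystem

/-! ### Cut-off functions -/

section Cutoff

variable {W G : Type*} [NormedAddCommGroup W] [NormedSpace ℝ W] [NormedAddCommGroup G]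
  [NormedSpace ℝ G]

/-- `χ` is a `C¹` function with compact support in `U` that equals `1` on the open set `V`. -/
structure IsCutoff (U V : Set W) (χ : W → ℝ) : Prop where
  isOpen : IsOpen V
  subset : V ⊆ U
  contDiff : ContDiff ℝ 1 χ
  hasCompactSupport : HasCompactSupport χ
  tsupport_subset : tsupport χ ⊆ U
  eq_one : ∀ w ∈ V, χ w = 1

theorem exists_isCutoff [FiniteDimensional ℝ W] {A U : Set W} (hA : IsCompact A) (hU : IsOpen U)
    (hAU : A ⊆ U) : ∃ V χ, A ⊆ V ∧ IsCutoff U V χ := by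
  have : ProperSpace W := FiniteDimensional.proper ℝ W
  obtain ⟨δ, hδ, hδU⟩ := hA.exists_cthickening_subset_open hU hAU
  have hint : A ⊆ interior (Metric.cthickening (δ / 2) A) :=
    (Metric.self_subset_thickening (by positivity) A).trans
      (interior_maximal (Metric.thickening_subset_cthickening _ _) Metric.isOpen_thickening)
  obtain ⟨χ, h1, h0, -⟩ := exists_contMDiffMap_one_nhds_of_subset_interior (n := 1)
    (modelWithCornersSelf ℝ W) hA.isClosed hint
  have hsupp : tsupport χ ⊆ Metric.cthickening (δ / 2) A := by
    refine closure_minimal (fun w hw => ?_) Metric.isClosed_cthickening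
    by_contra h
    exact hw (h0 w h)
  have hsub : Metric.cthickening (δ / 2) A ⊆ U :=
    (Metric.cthickening_mono (by linarith) A).trans hδU
  obtain ⟨V, hVo, hAV, hV⟩ := mem_nhdsSet_iff_exists.1 h1
  refine ⟨V ∩ U, χ, fun w hw => ⟨hAV hw, hAU hw⟩, hVo.inter hU, inter_subset_right, ?_, ?_,
    hsupp.trans hsub, fun w hw => hV hw.1⟩
  · simpa using χ.contMDiff.contDiff
  · exact (hA.cthickening (r := δ / 2)).of_isClosed_subset (isClosed_tsupport _) hsupp

namespace IsCutoff

variable {U V : Set W} {χ : W → ℝ}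

theorem contDiff_smul (h : IsCutoff U V χ) (hU : IsOpen U) {g : W → G} (hg : ContDiffOn ℝ 1 g U) :
    ContDiff ℝ 1 (fun w => χ w • g w) := by
  rw [contDiff_iff_contDiffAt]
  intro w
  by_cases hw : w ∈ tsupport χ
  · exact h.contDiff.contDiffAt.smul (hg.contDiffAt (hU.mem_nhds (h.tsupport_subset hw)))
  · have : (fun w => χ w • g w) =ᶠ[𝓝 w] fun _ => (0 : G) := by
      filter_upwards [(isClosed_tsupport χ).isOpen_compl.mem_nhds hw] with x hx
      rw [image_eq_zero_of_notMem_tsupport hx, zero_smul]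
    exact contDiffAt_const.congr_of_eventuallyEq this

theorem hasCompactSupport_smul (h : IsCutoff U V χ) (g : W → G) :
    HasCompactSupport (fun w => χ w • g w) :=
  h.hasCompactSupport.smul_right

theorem exists_lipschitzWith (h : IsCutoff U V χ) (hU : IsOpen U) {g : W → G}
    (hg : ContDiffOn ℝ 1 g U) : ∃ L, LipschitzWith L (fun w => χ w • g w) :=
  ContDiff.lipschitzWith_of_hasCompactSupport (h.hasCompactSupport_smul g)
    (h.contDiff_smul hU hg) one_ne_zero

theorem exists_bound (h : IsCutoff U V χ) (hU : IsOpen U) {g : W → G}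
    (hg : ContDiffOn ℝ 1 g U) : ∃ B, ∀ w, ‖χ w • g w‖ ≤ B :=
  (h.hasCompactSupport_smul g).exists_bound_of_continuous (h.contDiff_smul hU hg).continuous

theorem smul_eq (h : IsCutoff U V χ) (g : W → G) {w : W} (hw : w ∈ V) : χ w • g w = g w := by
  rw [h.eq_one w hw, one_smul]

end IsCutoff

end Cutoff

namespace HighGainSystem

variable {E Z W : Type*} [NormedAddCommGroup E] [InnerProductSpace ℝ E]
    [NormedAddCommGroup Z] [NormedSpace ℝ Z] [NormedAddCommGroup W] [NormedSpace ℝ W]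
    (S : HighGainSystem E Z W)

/-- A continuation `ξ` of the orbit beyond the guard, as a flow line of the cut-off zero dynamics,
with a compact neighbourhood `A` on which the cut-off is invisible. -/
structure Frame where
  V : Set W
  χ : W → ℝ
  isCutoff : IsCutoff S.U V χ
  ξ : ℝ → Z
  θ₀ : ℝ
  θ₀_pos : 0 < θ₀
  ξ_eq : ∀ t ∈ Icc 0 S.T, ξ t = S.ζ t
  deriv_ξ : ∀ t ∈ Icc 0 (S.T + θ₀), HasDerivAt ξ (χ (S.ι (ξ t)) • S.ψ (S.ι (ξ t))) t
  A : Set W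
  isCompact_A : IsCompact A
  A_subset : A ⊆ V
  δ₀ : ℝ
  δ₀_pos : 0 < δ₀
  closedBall_subset : ∀ t ∈ Icc 0 (S.T + θ₀), Metric.closedBall (S.ι (ξ t)) δ₀ ⊆ A

theorem lipschitzWith_ι : LipschitzWith 1 S.ι := by
  refine LipschitzWith.of_dist_le_mul fun x y => ?_
  rw [dist_eq_norm, dist_eq_norm, ← map_sub, S.norm_ι]
  simp

theorem exists_frame [FiniteDimensional ℝ W] [CompleteSpace Z] : Nonempty S.Frame := by
  have : ProperSpace W := FiniteDimensional.proper ℝ W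
  have hT := S.T_pos
  have hcomp : IsCompact ((fun t => S.ι (S.ζ t)) '' Icc 0 S.T) :=
    isCompact_Icc.image_of_continuousOn (S.ι.continuous.comp_continuousOn S.continuousOn_ζ)
  obtain ⟨V, χ, hV, hχ⟩ := exists_isCutoff hcomp S.isOpen_U
    (by rintro _ ⟨t, ht, rfl⟩; exact S.ζ_mem t ht)
  obtain ⟨L, hL⟩ := hχ.exists_lipschitzWith S.isOpen_U S.contDiffOn_ψ
  obtain ⟨B, hB⟩ := hχ.exists_bound S.isOpen_U S.contDiffOn_ψ
  have hL' : LipschitzWith (L * 1) (fun z => χ (S.ι z) • S.ψ (S.ι z)) :=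
    hL.comp S.lipschitzWith_ι
  obtain ⟨ξ, hξ0, hξ⟩ := exists_hasDerivAt_of_lipschitzWith_of_bounded hL' (fun z => hB (S.ι z))
    (S.ζ 0) (S.T + 1)
  have heq : EqOn ξ S.ζ (Icc 0 S.T) := by
    refine ODE_solution_unique (v := fun _ z => χ (S.ι z) • S.ψ (S.ι z)) (fun _ => hL')
      (fun t ht => (hξ t ⟨ht.1, by linarith [ht.2]⟩).continuousAt.continuousWithinAt)
      (fun t ht => (hξ t ⟨ht.1, by linarith [ht.2]⟩).hasDerivWithinAt) S.continuousOn_ζ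
      (fun t ht => ?_) hξ0
    have hmem : S.ι (S.ζ t) ∈ V := hV ⟨t, ⟨ht.1, ht.2.le⟩, rfl⟩
    simp only [hχ.smul_eq S.ψ hmem]
    exact S.deriv_ζ t ht
  have hcont : ContinuousAt (fun t => S.ι (ξ t)) S.T :=
    S.ι.continuous.continuousAt.comp (hξ S.T ⟨hT.le, by linarith⟩).continuousAt
  have hVT : S.ι (ξ S.T) ∈ V := by
    rw [heq (right_mem_Icc.2 hT.le)]
    exact hV ⟨S.T, right_mem_Icc.2 hT.le, rfl⟩
  obtain ⟨θ, hθ, hball⟩ := Metric.eventually_nhds_iff_ball.1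
    (hcont.eventually_mem (hχ.isOpen.mem_nhds hVT))
  have hθ₀ : 0 < min (θ / 2) 1 := lt_min (by linarith) one_pos
  have hle1 : min (θ / 2) 1 ≤ 1 := min_le_right _ _
  have hle2 : min (θ / 2) 1 ≤ θ / 2 := min_le_left _ _
  have hsub : (fun t => S.ι (ξ t)) '' Icc 0 (S.T + min (θ / 2) 1) ⊆ V := by
    rintro _ ⟨t, ht, rfl⟩
    rcases le_or_gt t S.T with h | h
    · simp only [heq ⟨ht.1, h⟩]
      exact hV ⟨t, ⟨ht.1, h⟩, rfl⟩
    · refine hball t ?_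
      rw [Metric.mem_ball, Real.dist_eq, abs_lt]
      constructor <;> linarith [ht.2]
  have hcomp' : IsCompact ((fun t => S.ι (ξ t)) '' Icc 0 (S.T + min (θ / 2) 1)) :=
    isCompact_Icc.image_of_continuousOn fun t ht => (S.ι.continuous.continuousAt.comp
      (hξ t ⟨ht.1, by linarith [ht.2]⟩).continuousAt).continuousWithinAt
  obtain ⟨δ, hδ, hδV⟩ := hcomp'.exists_cthickening_subset_open hχ.isOpen hsub
  exact ⟨{
    V := V
    χ := χ
    isCutoff := hχ
    ξ := ξ
    θ₀ := min (θ / 2) 1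
    θ₀_pos := hθ₀
    ξ_eq := heq
    deriv_ξ := fun t ht => hξ t ⟨ht.1, by linarith [ht.2]⟩
    A := Metric.cthickening δ ((fun t => S.ι (ξ t)) '' Icc 0 (S.T + min (θ / 2) 1))
    isCompact_A := hcomp'.cthickening
    A_subset := hδV
    δ₀ := δ
    δ₀_pos := hδ
    closedBall_subset := fun t ht =>
      Metric.closedBall_subset_cthickening (mem_image_of_mem (fun t => S.ι (ξ t)) ht) δ }⟩

end HighGainSystem

/-! ### Decay of the outputs -/

open scoped RealInnerProductSpace

theorem IsCompact.exists_pos_mul_sq_le_inner {E W : Type*} [NormedAddCommGroup E]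
    [InnerProductSpace ℝ E] [FiniteDimensional ℝ E] [TopologicalSpace W] {A : Set W}
    (hA : IsCompact A) {Q : W → E →L[ℝ] E} (hQ : ContinuousOn Q A)
    (hpos : ∀ w ∈ A, ∀ x, x ≠ 0 → 0 < ⟪x, Q w x⟫) :
    ∃ s > 0, ∀ w ∈ A, ∀ x, s * ‖x‖ ^ 2 ≤ ⟪x, Q w x⟫ := by
  have : ProperSpace E := FiniteDimensional.proper ℝ E
  have hc : ContinuousOn (fun y : W × E => ⟪y.2, Q y.1 y.2⟫) (A ×ˢ Metric.sphere 0 1) := by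
    refine continuousOn_snd.inner (ContinuousOn.clm_apply ?_ continuousOn_snd)
    exact hQ.comp continuousOn_fst fun y hy => hy.1
  obtain ⟨s, hs, h⟩ := (hA.prod (isCompact_sphere (0 : E) 1)).exists_forall_le' hc (a := 0)
    (fun y hy => hpos y.1 hy.1 y.2 (by
      intro h0
      have := hy.2
      rw [mem_sphere_zero_iff_norm, h0, norm_zero] at this
      exact zero_ne_one this))
  refine ⟨s, hs, fun w hw x => ?_⟩
  by_cases hx : x = 0
  · simp [hx]
  · have hn : ‖x‖ ≠ 0 := norm_ne_zero_iff.2 hx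
    have h1 := h (w, ‖x‖⁻¹ • x) ⟨hw, by
      rw [mem_sphere_zero_iff_norm, norm_smul, norm_inv, norm_norm, inv_mul_cancel₀ hn]⟩
    simp only [map_smul, real_inner_smul_left, real_inner_smul_right] at h1
    have h2 := mul_le_mul_of_nonneg_right h1 (sq_nonneg ‖x‖)
    have h3 : ‖x‖⁻¹ * (‖x‖⁻¹ * ⟪x, Q w x⟫) * ‖x‖ ^ 2 = ⟪x, Q w x⟫ := by
      field_simp
    rwa [h3] at h2

theorem IsCompact.exists_pos_bound {W G : Type*} [NormedAddCommGroup G] [TopologicalSpace W]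
    {A : Set W} (hA : IsCompact A) {g : W → G} (hg : ContinuousOn g A) :
    ∃ M > 0, ∀ w ∈ A, ‖g w‖ ≤ M := by
  obtain ⟨M, hM⟩ := hA.exists_bound_of_continuousOn hg
  exact ⟨max M 1, by positivity, fun w hw => (hM w hw).trans (le_max_left _ _)⟩

theorem Real.exp_neg_le_inv {x : ℝ} (hx : 0 < x) : Real.exp (-x) ≤ x⁻¹ := by
  rw [Real.exp_neg]
  exact inv_anti₀ hx (by linarith [Real.add_one_le_exp x])

namespace HighGainSystem

variable {E Z W : Type*} [NormedAddCommGroup E] [InnerProductSpace ℝ E]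
    [NormedAddCommGroup Z] [NormedSpace ℝ Z] [NormedAddCommGroup W] [NormedSpace ℝ W]
    {S : HighGainSystem E Z W}

/-- The quasi-steady state of the outputs is `g / ε ^ 2` with `K g = f`. -/
theorem exists_steady [FiniteDimensional ℝ E] (S : HighGainSystem E Z W) :
    ∃ g : W → E, ContDiffOn ℝ 1 g S.U ∧ ∀ w ∈ S.U, S.K w (g w) = S.f w := by
  have heq : ∀ w ∈ S.U, ∃ e : E ≃L[ℝ] E, (e : E →L[ℝ] E) = S.K w := by
    intro w hw
    have hinj : Function.Injective (S.K w : E →ₗ[ℝ] E) := by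
      rw [← LinearMap.ker_eq_bot, LinearMap.ker_eq_bot']
      intro x hx
      by_contra h
      have h1 := S.PK_pos w hw x h
      rw [show S.K w x = 0 from hx, map_zero, inner_zero_right] at h1
      exact lt_irrefl _ h1
    refine ⟨(LinearEquiv.ofInjectiveEndo _ hinj).toContinuousLinearEquiv, ?_⟩
    ext x
    rfl
  refine ⟨fun w => (S.K w).inverse (S.f w), fun w hw => ContDiffAt.contDiffWithinAt ?_,
    fun w hw => ?_⟩
  · obtain ⟨e, he⟩ := heq w hw
    have h1 : ContDiffAt ℝ 1 (fun w => (S.K w).inverse) w := by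
      refine ContDiffAt.comp (g := ContinuousLinearMap.inverse) w ?_ (S.contDiffOn_K.contDiffAt (S.isOpen_U.mem_nhds hw))
      rw [← he]
      exact contDiffAt_map_inverse e
    exact h1.clm_apply (S.contDiffOn_f.contDiffAt (S.isOpen_U.mem_nhds hw))
  · obtain ⟨e, he⟩ := heq w hw
    simp only [← he]
    rw [ContinuousLinearMap.inverse_equiv]
    simp

set_option maxHeartbeats 1000000 in
/-- The weighted size `ε * ‖pe‖ + ‖pb‖` of the outputs stays within a multiple of its initial
value plus `1 / ε`. If it starts below `1`, the outputs are `O (1 / ε ^ 2)` from half a period on: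
they then follow the quasi-steady state `g / ε ^ 2` of `exists_steady`. -/
theorem Frame.exists_output_bound [FiniteDimensional ℝ E] (F : S.Frame) :
    ∃ k₀ : ℝ, 1 < k₀ ∧ ∀ k, k₀ ≤ k → ∃ C > 0, ∃ ε₀ : ℝ, 1 ≤ ε₀ ∧ ∀ ε, ε₀ ≤ ε →
      ∀ (t₁ : ℝ) (w : ℝ → W),
      (∀ t ∈ Icc 0 t₁, w t ∈ F.A ∧ HasDerivAt w ((S.full ε k).field (w t)) t) →
      (∀ t ∈ Icc 0 t₁, ε * ‖S.pe (w t)‖ + ‖S.pb (w t)‖ ≤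
        C * (ε * ‖S.pe (w 0)‖ + ‖S.pb (w 0)‖ + 1 / ε)) ∧
      (ε * ‖S.pe (w 0)‖ + ‖S.pb (w 0)‖ ≤ 1 → ∀ t ∈ Icc 0 t₁, S.T / 2 ≤ t →
        ε * (‖S.pe (w t)‖ + ‖S.pb (w t)‖) ≤ C / ε) := by
  have hA := F.isCompact_A
  have hAU : F.A ⊆ S.U := F.A_subset.trans F.isCutoff.subset
  have hT := S.T_pos
  obtain ⟨g, hg, hKg⟩ := S.exists_steady
  have hPK : ContinuousOn (fun w => (S.P w).comp (S.K w)) F.A :=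
    (S.contDiffOn_P.continuousOn.mono hAU).clm_comp (S.contDiffOn_K.continuousOn.mono hAU)
  obtain ⟨s, hs, hsle⟩ := hA.exists_pos_mul_sq_le_inner hPK
    (fun w hw x hx => S.PK_pos w (hAU hw) x hx)
  obtain ⟨p₀, hp₀, hp₀le⟩ := hA.exists_pos_mul_sq_le_inner
    (S.contDiffOn_P.continuousOn.mono hAU) (fun w hw x hx => S.P_pos w (hAU hw) x hx)
  obtain ⟨p, hp, hple⟩ := hA.exists_pos_bound (S.contDiffOn_P.continuousOn.mono hAU)
  obtain ⟨p₁, -, hp₁le⟩ := hA.exists_pos_bound (S.continuousOn_P'.mono hAU)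
  obtain ⟨Mf, hMf, hMfle⟩ := hA.exists_pos_bound (S.contDiffOn_f.continuousOn.mono hAU)
  obtain ⟨MK, hMK, hMKle⟩ := hA.exists_pos_bound (S.contDiffOn_K.continuousOn.mono hAU)
  obtain ⟨Mψ, hMψ, hMψle⟩ := hA.exists_pos_bound (S.contDiffOn_ψ.continuousOn.mono hAU)
  obtain ⟨Mg, hMg, hMgle⟩ := hA.exists_pos_bound (hg.continuousOn.mono hAU)
  obtain ⟨Bg, hBg, hBgle⟩ := hA.exists_pos_bound
    ((hg.continuousOn_fderiv_of_isOpen S.isOpen_U le_rfl).mono hAU)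
  obtain ⟨k₀, hk₀, hmain⟩ := exists_highGain_bound (E := E) (p₁ := p₁) hs hp hp₀
  refine ⟨k₀, hk₀, fun k hk => ?_⟩
  obtain ⟨C₁, hC₁, lam, hlam, ε₀, hε₀, hmain⟩ := hmain k hk
  have hk1 : 1 < k := hk₀.trans_le hk
  have hk0 : 0 < k := by linarith
  have hkinv : k⁻¹ ≤ 1 := inv_le_one_of_one_le₀ hk1.le
  have hkinv0 : 0 < k⁻¹ := inv_pos.2 hk0
  set M₁ := 4 * C₁ * (4 / (lam * S.T) + Mf) with hM₁
  set M₂ := M₁ + Mf + MK * (k * M₁) + Mψ with hM₂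
  set C₃ := C₁ * (4 / (lam * S.T) * (2 * (M₁ + Mg)) + Bg * M₂) with hC₃
  have hM₁0 : 0 < M₁ := by positivity
  have hM₂0 : 0 < M₂ := by positivity
  have hC₃0 : 0 < C₃ := by positivity
  refine ⟨max (4 * C₁ * (1 + Mf)) (M₁ + C₃), lt_max_of_lt_right (by positivity), ε₀, hε₀,
    fun ε hε t₁ w hw => ?_⟩
  have hε1 : 1 ≤ ε := hε₀.trans hε
  have hε0 : 0 < ε := by linarith
  -- conversion between `(ε e, b)` and `(a, c) = (x, b + x / k)`
  have conv : ∀ x b : E, ‖x‖ + ‖b‖ ≤ 2 * (‖x‖ + ‖b + k⁻¹ • x‖) ∧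
      ‖x‖ + ‖b + k⁻¹ • x‖ ≤ 2 * (‖x‖ + ‖b‖) := by
    intro x b
    have h1 : ‖k⁻¹ • x‖ ≤ ‖x‖ := by
      rw [norm_smul, Real.norm_of_nonneg hkinv0.le]
      exact mul_le_of_le_one_left (norm_nonneg _) hkinv
    have h2 : ‖b‖ ≤ ‖b + k⁻¹ • x‖ + ‖k⁻¹ • x‖ := by
      simpa using norm_sub_le (b + k⁻¹ • x) (k⁻¹ • x)
    have h3 := norm_add_le b (k⁻¹ • x)
    constructor <;> linarith [norm_nonneg x, norm_nonneg b, norm_nonneg (b + k⁻¹ • x)]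
  have hderw : ∀ t ∈ Icc 0 t₁, HasDerivAt w ((S.full ε k).field (w t)) t := fun t ht => (hw t ht).2
  have hmem : ∀ t ∈ Icc 0 t₁, w t ∈ S.U := fun t ht => hAU (hw t ht).1
  have hpe : ∀ t ∈ Icc 0 t₁, HasDerivAt (fun t => S.pe (w t)) (S.pb (w t)) t := by
    intro t ht
    rw [← S.pe_field ε k _ (hmem t ht)]
    exact S.pe.hasFDerivAt.comp_hasDerivAt t (hderw t ht)
  have hpb : ∀ t ∈ Icc 0 t₁, HasDerivAt (fun t => S.pb (w t))
      (S.f (w t) - S.K (w t) (ε ^ 2 • S.pe (w t) + (k * ε) • S.pb (w t))) t := by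
    intro t ht
    rw [← S.pb_field ε k _ (hmem t ht)]
    exact S.pb.hasFDerivAt.comp_hasDerivAt t (hderw t ht)
  have hP : ∀ t ∈ Icc 0 t₁, HasDerivAt (fun t => S.P (w t)) (S.P' (w t)) t := by
    intro t ht
    rw [← S.fderiv_P ε k _ (hmem t ht)]
    exact ((S.contDiffOn_P.contDiffAt (S.isOpen_U.mem_nhds (hmem t ht))).differentiableAt
      one_ne_zero).hasFDerivAt.comp_hasDerivAt t (hderw t ht)
  have hform : ∀ t ∈ Icc 0 t₁, ∀ x, (∀ y, ⟪S.P (w t) x, y⟫ = ⟪x, S.P (w t) y⟫) ∧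
      p₀ * ‖x‖ ^ 2 ≤ ⟪x, S.P (w t) x⟫ ∧ s * ‖x‖ ^ 2 ≤ ⟪x, S.P (w t) (S.K (w t) x)⟫ :=
    fun t ht x => ⟨S.P_symm _ (hmem t ht) x, hp₀le _ (hw t ht).1 x, hsle _ (hw t ht).1 x⟩
  set N : ℝ → ℝ := fun t => ε * ‖S.pe (w t)‖ + ‖S.pb (w t)‖ with hN
  have hN' : ∀ t, ‖ε • S.pe (w t)‖ + ‖S.pb (w t)‖ = N t := fun t => by
    rw [norm_smul, Real.norm_of_nonneg hε0.le]
  have hN0 : ∀ t, 0 ≤ N t := fun t => by positivity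
  have first : ∀ t ∈ Icc 0 t₁, N t ≤ 4 * C₁ * (Real.exp (-lam * ε * t) * N 0 + Mf / ε) := by
    intro t ht
    have h := hmain ε hε 0 t₁ Mf (fun t => ε • S.pe (w t))
      (fun t => S.pb (w t) + k⁻¹ • ε • S.pe (w t)) (fun _ => 0) (fun t => S.f (w t))
      (fun t => S.P (w t)) (fun t => S.K (w t)) (fun t => S.P' (w t)) hMf.le ?_ ?_ hP ?_ hform t ht
    · rw [sub_zero] at h
      have h1 := (conv (ε • S.pe (w t)) (S.pb (w t))).1
      have h2 := (conv (ε • S.pe (w 0)) (S.pb (w 0))).2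
      rw [hN'] at h1 h2
      have hx := (Real.exp_pos (-lam * ε * t)).le
      have h3 := mul_le_mul_of_nonneg_left h2 hx
      have h4 := mul_le_mul_of_nonneg_left h3 hC₁.le
      have h5 : 0 ≤ C₁ * (Mf / ε) := by positivity
      linarith only [h, h1, h4, h5]
    · intro t ht
      refine ((hpe t ht).const_smul ε).congr_deriv ?_
      simp
    · intro t ht
      refine ((hpb t ht).add (((hpe t ht).const_smul ε).const_smul k⁻¹)).congr_deriv ?_
      simp only [map_add, map_smul, smul_add, smul_sub, smul_smul]
      match_scalars <;> field_simp <;> ring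
    · exact fun t ht => ⟨by simpa using hMf.le, hMfle _ (hw t ht).1, hple _ (hw t ht).1,
        hp₁le _ (hw t ht).1⟩
  constructor
  · intro t ht
    refine (first t ht).trans ?_
    have hexp : Real.exp (-lam * ε * t) ≤ 1 := Real.exp_le_one_iff.2 (by
      have : 0 ≤ lam * ε * t := mul_nonneg (by positivity) ht.1
      linarith)
    have h1 : Real.exp (-lam * ε * t) * N 0 ≤ N 0 := mul_le_of_le_one_left (hN0 0) hexp
    have h3 : 0 ≤ Mf * N 0 := mul_nonneg hMf.le (hN0 0)
    have h4 : 0 < 1 / ε := by positivity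
    have h2 : Real.exp (-lam * ε * t) * N 0 + Mf / ε ≤ (1 + Mf) * (N 0 + 1 / ε) := by
      have : Mf / ε = Mf * (1 / ε) := by ring
      rw [this]
      linarith only [h1, h3, h4]
    calc _ ≤ 4 * C₁ * ((1 + Mf) * (N 0 + 1 / ε)) := mul_le_mul_of_nonneg_left h2 (by positivity)
      _ = 4 * C₁ * (1 + Mf) * (N 0 + 1 / ε) := by ring
      _ ≤ _ := mul_le_mul_of_nonneg_right (le_max_left _ _) (add_nonneg (hN0 0) h4.le)
  · intro hstart t ht htT
    have decay : ∀ u, S.T / 4 ≤ u → Real.exp (-lam * ε * u) ≤ 4 / (lam * S.T) / ε := by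
      intro u hu
      have h1 : -lam * ε * u ≤ -(lam * ε * (S.T / 4)) := by
        have := mul_le_mul_of_nonneg_left hu (show 0 ≤ lam * ε by positivity)
        linarith
      refine (Real.exp_le_exp.2 h1).trans ((Real.exp_neg_le_inv (by positivity)).trans (le_of_eq ?_))
      field_simp
    have hsub : Icc (S.T / 4) t₁ ⊆ Icc 0 t₁ := Icc_subset_Icc_left (by linarith)
    have hN₁ : ∀ u ∈ Icc (S.T / 4) t₁, N u ≤ M₁ / ε := by
      intro u hu
      refine (first u (hsub hu)).trans ?_
      have h1 : Real.exp (-lam * ε * u) * N 0 ≤ 4 / (lam * S.T) / ε :=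
        (mul_le_of_le_one_right (Real.exp_pos _).le hstart).trans (decay u hu.1)
      calc _ ≤ 4 * C₁ * (4 / (lam * S.T) / ε + Mf / ε) :=
            mul_le_mul_of_nonneg_left (by linarith) (by positivity)
        _ = M₁ / ε := by rw [hM₁]; ring
    have hfield : ∀ u ∈ Icc (S.T / 4) t₁, ‖(S.full ε k).field (w u)‖ ≤ M₂ := by
      intro u hu
      have hu' := hsub hu
      have hAu := (hw u hu').1
      have h1 := S.norm_le ((S.full ε k).field (w u))
      rw [S.pe_field _ _ _ (hmem u hu'), S.pb_field _ _ _ (hmem u hu'),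
        S.pz_field _ _ _ (hmem u hu')] at h1
      have h2 : ‖ε ^ 2 • S.pe (w u) + (k * ε) • S.pb (w u)‖ ≤ k * ε * N u := by
        refine (norm_add_le _ _).trans ?_
        rw [norm_smul, norm_smul, Real.norm_of_nonneg (by positivity),
          Real.norm_of_nonneg (by positivity)]
        have : 0 ≤ (k - 1) * (ε ^ 2 * ‖S.pe (w u)‖) := mul_nonneg (by linarith) (by positivity)
        simp only [hN]
        linarith only [this]
      have h3 : k * ε * N u ≤ k * M₁ := by
        have := mul_le_mul_of_nonneg_left (hN₁ u hu) (show 0 ≤ k * ε by positivity)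
        refine this.trans (le_of_eq ?_)
        field_simp
      have h4 : ‖S.K (w u) (ε ^ 2 • S.pe (w u) + (k * ε) • S.pb (w u))‖ ≤ MK * (k * M₁) :=
        (S.K (w u)).le_of_opNorm_le_of_le (hMKle _ hAu) (h2.trans h3)
      have h5 := norm_sub_le (S.f (w u)) (S.K (w u) (ε ^ 2 • S.pe (w u) + (k * ε) • S.pb (w u)))
      have h6 : ‖S.pb (w u)‖ ≤ M₁ := by
        have e1 := hN₁ u hu
        have e2 : M₁ / ε ≤ M₁ := div_le_self hM₁0.le hε1
        have e3 : 0 ≤ ε * ‖S.pe (w u)‖ := by positivity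
        simp only [hN] at e1
        linarith
      have h7 := hMfle _ hAu
      have h8 := hMψle _ hAu
      linarith
    have hg' : ∀ u ∈ Icc (S.T / 4) t₁, HasDerivAt (fun t => g (w t))
        (fderiv ℝ g (w u) ((S.full ε k).field (w u))) u := fun u hu =>
      ((hg.contDiffAt (S.isOpen_U.mem_nhds (hmem u (hsub hu)))).differentiableAt
        one_ne_zero).hasFDerivAt.comp_hasDerivAt u (hderw u (hsub hu))
    have hgb : ∀ u ∈ Icc (S.T / 4) t₁,
        ‖fderiv ℝ g (w u) ((S.full ε k).field (w u))‖ ≤ Bg * M₂ := fun u hu =>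
      (fderiv ℝ g (w u)).le_of_opNorm_le_of_le (hBgle _ (hw u (hsub hu)).1) (hfield u hu)
    have htT' : t ∈ Icc (S.T / 4) t₁ := ⟨by linarith, ht.2⟩
    have hsteady : ∀ u ∈ Icc (S.T / 4) t₁, ‖ε • S.pe (w u) - ε⁻¹ • g (w u)‖ ≤
        ‖ε • S.pe (w u)‖ + Mg / ε := by
      intro u hu
      refine (norm_sub_le _ _).trans (add_le_add_right ?_ _)
      rw [norm_smul, norm_inv, Real.norm_of_nonneg hε0.le, inv_mul_eq_div]
      exact div_le_div_of_nonneg_right (hMgle _ (hw u (hsub hu)).1) hε0.le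
    have h := hmain ε hε (S.T / 4) t₁ (Bg * M₂ / ε) (fun t => ε • S.pe (w t) - ε⁻¹ • g (w t))
      (fun t => S.pb (w t) + k⁻¹ • (ε • S.pe (w t) - ε⁻¹ • g (w t)))
      (fun t => -(ε⁻¹ • fderiv ℝ g (w t) ((S.full ε k).field (w t))))
      (fun t => -((k⁻¹ * ε⁻¹) • fderiv ℝ g (w t) ((S.full ε k).field (w t))))
      (fun t => S.P (w t)) (fun t => S.K (w t)) (fun t => S.P' (w t)) (by positivity) ?_ ?_
      (fun u hu => hP u (hsub hu)) ?_ (fun u hu => hform u (hsub hu)) t htT'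
    · have h0 : S.T / 4 ∈ Icc (S.T / 4) t₁ := ⟨le_rfl, by linarith [ht.2]⟩
      have i1 := (conv (ε • S.pe (w (S.T / 4)) - ε⁻¹ • g (w (S.T / 4))) (S.pb (w (S.T / 4)))).2
      have i2 := hsteady _ h0
      have i3 := hN₁ _ h0
      rw [← hN'] at i3
      have i4 : ‖ε • S.pe (w (S.T / 4)) - ε⁻¹ • g (w (S.T / 4))‖ + ‖S.pb (w (S.T / 4)) +
          k⁻¹ • (ε • S.pe (w (S.T / 4)) - ε⁻¹ • g (w (S.T / 4)))‖ ≤ 2 * (M₁ + Mg) / ε := by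
        have : 2 * (M₁ + Mg) / ε = 2 * (M₁ / ε + Mg / ε) := by ring
        rw [this]
        linarith
      have i5 : Real.exp (-lam * ε * (t - S.T / 4)) ≤ 4 / (lam * S.T) / ε :=
        decay _ (by linarith)
      have i6 := mul_le_mul i5 i4 (by positivity) (by positivity)
      have i7 := (conv (ε • S.pe (w t) - ε⁻¹ • g (w t)) (S.pb (w t))).2
      have i8 : ‖S.pb (w t)‖ ≤ C₃ / ε ^ 2 := by
        have j1 : ‖S.pb (w t)‖ ≤ ‖ε • S.pe (w t) - ε⁻¹ • g (w t)‖ + ‖S.pb (w t) +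
            k⁻¹ • (ε • S.pe (w t) - ε⁻¹ • g (w t))‖ := by
          have j2 : ‖k⁻¹ • (ε • S.pe (w t) - ε⁻¹ • g (w t))‖ ≤
              ‖ε • S.pe (w t) - ε⁻¹ • g (w t)‖ := by
            rw [norm_smul, Real.norm_of_nonneg hkinv0.le]
            exact mul_le_of_le_one_left (norm_nonneg _) hkinv
          have j3 := norm_sub_le (S.pb (w t) + k⁻¹ • (ε • S.pe (w t) - ε⁻¹ • g (w t)))
            (k⁻¹ • (ε • S.pe (w t) - ε⁻¹ • g (w t)))
          rw [add_sub_cancel_right] at j3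
          linarith
        refine j1.trans (h.trans ?_)
        have : C₃ / ε ^ 2 = C₁ * (4 / (lam * S.T) / ε * (2 * (M₁ + Mg) / ε)
            + Bg * M₂ / ε / ε) := by
          rw [hC₃]; field_simp
        rw [this]
        exact mul_le_mul_of_nonneg_left (add_le_add_left i6 _) hC₁.le
      have i9 : ε * ‖S.pe (w t)‖ ≤ M₁ / ε := by
        have := hN₁ t htT'
        simp only [hN] at this
        linarith [norm_nonneg (S.pb (w t))]
      have i10 := mul_le_mul_of_nonneg_left i8 hε0.le
      have i11 : ε * (C₃ / ε ^ 2) = C₃ / ε := by field_simp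
      rw [i11] at i10
      calc _ = ε * ‖S.pe (w t)‖ + ε * ‖S.pb (w t)‖ := by ring
        _ ≤ (M₁ + C₃) / ε := by rw [add_div]; linarith
        _ ≤ _ := div_le_div_of_nonneg_right (le_max_right _ _) hε0.le
    · intro u hu
      refine (((hpe u (hsub hu)).const_smul ε).sub ((hg' u hu).const_smul ε⁻¹)).congr_deriv ?_
      match_scalars <;> field_simp <;> ring
    · intro u hu
      refine ((hpb u (hsub hu)).add ((((hpe u (hsub hu)).const_smul ε).sub
        ((hg' u hu).const_smul ε⁻¹)).const_smul k⁻¹)).congr_deriv ?_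
      simp only [map_add, map_sub, map_smul, hKg _ (hmem u (hsub hu)), smul_add, smul_sub, smul_smul]
      match_scalars <;> field_simp <;> ring
    · intro u hu
      have hAu := (hw u (hsub hu)).1
      have j1 : ε⁻¹ * ‖fderiv ℝ g (w u) ((S.full ε k).field (w u))‖ ≤ Bg * M₂ / ε := by
        rw [inv_mul_eq_div]
        exact div_le_div_of_nonneg_right (hgb u hu) hε0.le
      refine ⟨?_, ?_, hple _ hAu, hp₁le _ hAu⟩
      · rwa [norm_neg, norm_smul, norm_inv, Real.norm_of_nonneg hε0.le]
      · rw [norm_neg, norm_smul, norm_mul, norm_inv, norm_inv, Real.norm_of_nonneg hε0.le,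
          Real.norm_of_nonneg hk0.le, mul_assoc]
        exact (mul_le_of_le_one_left (by positivity) hkinv).trans j1

end HighGainSystem

/-! ### Tracking the orbit over one period -/

theorem gronwallBound_le {δ K ε x : ℝ} (hK : 0 ≤ K) (hε : 0 ≤ ε) :
    gronwallBound δ K ε x ≤ (δ + ε * x) * Real.exp (K * x) := by
  rcases hK.eq_or_lt with rfl | hK
  · simp [gronwallBound_K0]
  · rw [gronwallBound_of_K_ne_0 hK.ne']
    have h1 : Real.exp (K * x) - 1 ≤ K * x * Real.exp (K * x) := by
      have h2 := Real.add_one_le_exp (-(K * x))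
      have h3 := mul_le_mul_of_nonneg_right h2 (Real.exp_pos (K * x)).le
      rw [← Real.exp_add, neg_add_cancel, Real.exp_zero] at h3
      linarith
    have h4 := mul_le_mul_of_nonneg_left h1 (div_nonneg hε hK.le)
    have h5 : ε / K * (K * x * Real.exp (K * x)) = ε * x * Real.exp (K * x) := by
      field_simp
    linarith

/-- Continuous induction: a bound that implies itself strictly cannot be violated first. -/
theorem forall_lt_of_forall_le_imp_lt {g : ℝ → ℝ} {b δ : ℝ} (hg : ContinuousOn g (Icc 0 b))
    (h : ∀ t ∈ Icc 0 b, (∀ s ∈ Ico 0 t, g s ≤ δ) → g t ≤ δ → g t < δ) (h0 : g 0 < δ) :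
    ∀ t ∈ Icc 0 b, g t < δ := by
  by_contra! hcon
  obtain ⟨t, ht, hgt⟩ := hcon
  have hclosed : IsClosed {u ∈ Icc 0 b | δ ≤ g u} := isClosed_Icc.isClosed_le continuousOn_const hg
  have hcomp : IsCompact {u ∈ Icc 0 b | δ ≤ g u} :=
    isCompact_Icc.of_isClosed_subset hclosed fun u hu => hu.1
  obtain ⟨u, ⟨hu, hgu⟩, hmin⟩ := hcomp.exists_isLeast ⟨t, ht, hgt⟩
  have hlt : ∀ s ∈ Ico 0 u, g s < δ := by
    intro s hs
    by_contra! hs'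
    exact absurd (hmin ⟨⟨hs.1, hs.2.le.trans hu.2⟩, hs'⟩) (not_le.2 hs.2)
  have hle : g u ≤ δ := by
    obtain ⟨s, hs, hgs⟩ := intermediate_value_Icc hu.1 (hg.mono (Icc_subset_Icc_right hu.2))
      (show δ ∈ Icc (g 0) (g u) from ⟨h0.le, hgu⟩)
    rcases hs.2.eq_or_lt with rfl | hsu
    · exact hgs.le
    · exact absurd hgs (hlt s ⟨hs.1, hsu⟩).ne
  exact absurd (h u hu (fun s hs => (hlt s hs).le) hle) (not_lt.2 hgu)

namespace HighGainSystem

variable {E Z W : Type*} [NormedAddCommGroup E] [InnerProductSpace ℝ E]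
    [NormedAddCommGroup Z] [NormedSpace ℝ Z] [NormedAddCommGroup W] [NormedSpace ℝ W]
    {S : HighGainSystem E Z W}

namespace Frame

variable (F : S.Frame)

/-- The zero dynamics, cut off. -/
def zeroField (z : Z) : Z := F.χ (S.ι z) • S.ψ (S.ι z)

/-- A curve in `A` whose output and zero coordinates evolve as they should, whatever the output
acceleration. -/
def IsPath (γ : ℝ → W) (t₁ : ℝ) : Prop :=
  ∀ t ∈ Icc 0 t₁, γ t ∈ F.A ∧ ∃ v, HasDerivAt γ v t ∧ S.pe v = S.pb (γ t) ∧ S.pz v = S.ψ (γ t)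

variable {F}

theorem A_subset_U : F.A ⊆ S.U := F.A_subset.trans F.isCutoff.subset

theorem mem_A_of_norm_le {t : ℝ} (ht : t ∈ Icc 0 (S.T + F.θ₀)) {w : W}
    (h : ‖w - S.ι (F.ξ t)‖ ≤ F.δ₀) : w ∈ F.A :=
  F.closedBall_subset t ht (by rwa [Metric.mem_closedBall, dist_eq_norm])

theorem zeroField_eq {z : Z} (hz : S.ι z ∈ F.A) : F.zeroField z = S.ψ (S.ι z) :=
  F.isCutoff.smul_eq S.ψ (F.A_subset hz)

theorem isPath_ι {φ : ℝ → Z} {t₁ : ℝ} (hA : ∀ t ∈ Icc 0 t₁, S.ι (φ t) ∈ F.A)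
    (hφ : ∀ t ∈ Icc 0 t₁, HasDerivAt φ (F.zeroField (φ t)) t) :
    F.IsPath (fun t => S.ι (φ t)) t₁ := by
  intro t ht
  refine ⟨hA t ht, S.ι (F.zeroField (φ t)), S.ι.hasFDerivAt.comp_hasDerivAt t (hφ t ht), ?_, ?_⟩
  · rw [S.pe_ι, S.pb_ι]
  · rw [S.pz_ι, zeroField_eq (hA t ht)]

theorem isPath_of_field {ε k : ℝ} {w : ℝ → W} {t₁ : ℝ}
    (hw : ∀ t ∈ Icc 0 t₁, w t ∈ F.A ∧ HasDerivAt w ((S.full ε k).field (w t)) t) :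
    F.IsPath w t₁ := fun t ht =>
  ⟨(hw t ht).1, _, (hw t ht).2, S.pe_field _ _ _ (A_subset_U (hw t ht).1),
    S.pz_field _ _ _ (A_subset_U (hw t ht).1)⟩

theorem IsPath.mono {γ : ℝ → W} {t₁ t₂ : ℝ} (h : F.IsPath γ t₂) (hle : t₁ ≤ t₂) :
    F.IsPath γ t₁ := fun t ht => h t ⟨ht.1, ht.2.trans hle⟩

theorem isPath_ξ : F.IsPath (fun t => S.ι (F.ξ t)) (S.T + F.θ₀) :=
  isPath_ι (fun t ht => mem_A_of_norm_le ht (by simpa using F.δ₀_pos.le)) F.deriv_ξ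

theorem exists_lipschitzWith_zeroField (F : S.Frame) : ∃ L, LipschitzWith L F.zeroField := by
  obtain ⟨L, hL⟩ := F.isCutoff.exists_lipschitzWith S.isOpen_U S.contDiffOn_ψ
  exact ⟨L * 1, hL.comp S.lipschitzWith_ι⟩

/-- Two paths with small outputs stay close. -/
theorem exists_path_bound (F : S.Frame) :
    ∃ C : ℝ, 1 ≤ C ∧ ∀ η, 0 ≤ η → ∀ t₁ ≤ S.T + F.θ₀, ∀ γ₁ γ₂, F.IsPath γ₁ t₁ → F.IsPath γ₂ t₁ →
      (∀ t ∈ Icc 0 t₁, ‖S.pe (γ₁ t)‖ + ‖S.pb (γ₁ t)‖ ≤ η) →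
      (∀ t ∈ Icc 0 t₁, ‖S.pe (γ₂ t)‖ + ‖S.pb (γ₂ t)‖ ≤ η) →
      ∀ t ∈ Icc 0 t₁, ‖γ₁ t - γ₂ t‖ ≤ C * (‖S.pz (γ₁ 0) - S.pz (γ₂ 0)‖ + η) := by
  obtain ⟨L, hL⟩ := F.isCutoff.exists_lipschitzWith S.isOpen_U S.contDiffOn_ψ
  have hL' : LipschitzWith (L * 1) F.zeroField := hL.comp S.lipschitzWith_ι
  set T' := S.T + F.θ₀ with hT'
  have hT'0 : 0 < T' := add_pos S.T_pos F.θ₀_pos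
  set X := Real.exp (L * T') with hX
  have hX1 : 1 ≤ X := Real.one_le_exp (mul_nonneg L.2 hT'0.le)
  have hpos : 0 ≤ (1 + 2 * L * T') * X := by positivity
  refine ⟨2 + (1 + 2 * L * T') * X, by linarith, ?_⟩
  intro η hη t₁ ht₁ γ₁ γ₂ h₁ h₂ hη₁ hη₂ t ht
  have hder : ∀ γ, F.IsPath γ t₁ → ∀ t ∈ Icc 0 t₁,
      HasDerivAt (fun t => S.pz (γ t)) (S.ψ (γ t)) t := by
    intro γ hγ t ht
    obtain ⟨-, v, hv, -, hψ⟩ := hγ t ht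
    rw [← hψ]
    exact S.pz.hasFDerivAt.comp_hasDerivAt t hv
  have hoff : ∀ γ, F.IsPath γ t₁ → (∀ t ∈ Icc 0 t₁, ‖S.pe (γ t)‖ + ‖S.pb (γ t)‖ ≤ η) →
      ∀ t ∈ Icc 0 t₁, dist (S.ψ (γ t)) (F.zeroField (S.pz (γ t))) ≤ L * η := by
    intro γ hγ hηγ t ht
    have h := hL.dist_le_mul (γ t) (S.ι (S.pz (γ t)))
    rw [F.isCutoff.smul_eq S.ψ (F.A_subset (hγ t ht).1), dist_eq_norm (γ t)] at h
    refine h.trans (mul_le_mul_of_nonneg_left ((S.norm_sub_ι_le _ _).trans ?_) L.2)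
    simpa using hηγ t ht
  have hcont : ∀ γ, F.IsPath γ t₁ → ContinuousOn (fun t => S.pz (γ t)) (Icc 0 t₁) :=
    fun γ hγ t ht => (hder γ hγ t ht).continuousAt.continuousWithinAt
  have hgr := dist_le_of_approx_trajectories_ODE (v := fun _ => F.zeroField) (fun _ => hL')
    (hcont γ₁ h₁) (fun t ht => (hder γ₁ h₁ t ⟨ht.1, ht.2.le⟩).hasDerivWithinAt)
    (fun t ht => hoff γ₁ h₁ hη₁ t ⟨ht.1, ht.2.le⟩) (hcont γ₂ h₂)
    (fun t ht => (hder γ₂ h₂ t ⟨ht.1, ht.2.le⟩).hasDerivWithinAt)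
    (fun t ht => hoff γ₂ h₂ hη₂ t ⟨ht.1, ht.2.le⟩) le_rfl t ht
  simp only [dist_eq_norm, mul_one, sub_zero] at hgr
  set N := ‖S.pz (γ₁ 0) - S.pz (γ₂ 0)‖ with hN
  have hN0 : 0 ≤ N := norm_nonneg _
  have hbound : gronwallBound N L (L * η + L * η) t ≤ (N + 2 * L * T' * η) * X := by
    refine (gronwallBound_le L.2 (by positivity)).trans ?_
    have h1 : t ≤ T' := ht.2.trans ht₁
    have h2 : (L : ℝ) * t ≤ L * T' := mul_le_mul_of_nonneg_left h1 L.2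
    have h3 : (L * η + L * η) * t ≤ 2 * L * T' * η := by nlinarith
    exact mul_le_mul (by linarith) (Real.exp_le_exp.2 h2) (Real.exp_pos _).le (by positivity)
  have hfin := S.norm_le (γ₁ t - γ₂ t)
  simp only [map_sub] at hfin
  have h4 := norm_sub_le (S.pe (γ₁ t)) (S.pe (γ₂ t))
  have h5 := norm_sub_le (S.pb (γ₁ t)) (S.pb (γ₂ t))
  have h6 := hη₁ t ht
  have h7 := hη₂ t ht
  have h8 : 0 ≤ L * T' * N * X := by positivity
  have h9 : 0 ≤ η * X := by positivity
  calc ‖γ₁ t - γ₂ t‖ ≤ 2 * η + (N + 2 * L * T' * η) * X := by linarith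
    _ ≤ _ := by linarith

theorem exists_zero_path [CompleteSpace Z] (F : S.Frame) :
    ∃ ρ > 0, ∃ C > 0, ∀ z, ‖z - F.ξ 0‖ ≤ ρ → ∃ φ : ℝ → Z, φ 0 = z ∧
      (∀ t ∈ Icc 0 (S.T + F.θ₀), HasDerivAt φ (F.zeroField (φ t)) t) ∧
      F.IsPath (fun t => S.ι (φ t)) (S.T + F.θ₀) ∧
      ∀ t ∈ Icc 0 (S.T + F.θ₀), ‖S.ι (φ t) - S.ι (F.ξ t)‖ ≤ C * ‖z - F.ξ 0‖ := by
  obtain ⟨L, hL⟩ := F.exists_lipschitzWith_zeroField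
  obtain ⟨B, hB⟩ := F.isCutoff.exists_bound S.isOpen_U S.contDiffOn_ψ
  set T' := S.T + F.θ₀ with hT'
  have hT'0 : 0 < T' := add_pos S.T_pos F.θ₀_pos
  set X := Real.exp (L * T') with hX
  have hX0 : 0 < X := Real.exp_pos _
  refine ⟨F.δ₀ / X, div_pos F.δ₀_pos hX0, X, hX0, fun z hz => ?_⟩
  obtain ⟨φ, h0, hφ⟩ := exists_hasDerivAt_of_lipschitzWith_of_bounded hL
    (fun z => hB (S.ι z)) z T'
  have hclose : ∀ t ∈ Icc 0 T', ‖S.ι (φ t) - S.ι (F.ξ t)‖ ≤ X * ‖z - F.ξ 0‖ := by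
    intro t ht
    have := dist_le_of_trajectories_ODE (v := fun _ => F.zeroField) (fun _ => hL)
      (fun t ht => (hφ t ht).continuousAt.continuousWithinAt)
      (fun t ht => (hφ t ⟨ht.1, ht.2.le⟩).hasDerivWithinAt)
      (fun t ht => (F.deriv_ξ t ht).continuousAt.continuousWithinAt)
      (fun t ht => (F.deriv_ξ t ⟨ht.1, ht.2.le⟩).hasDerivWithinAt) le_rfl t ht
    rw [h0, dist_eq_norm, dist_eq_norm, sub_zero] at this
    rw [← map_sub, S.norm_ι, mul_comm]
    refine this.trans (mul_le_mul_of_nonneg_left (Real.exp_le_exp.2 ?_) (norm_nonneg _))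
    exact mul_le_mul_of_nonneg_left ht.2 L.2
  refine ⟨φ, h0, hφ, isPath_ι (fun t ht => mem_A_of_norm_le ht ((hclose t ht).trans ?_)) hφ, hclose⟩
  calc X * ‖z - F.ξ 0‖ ≤ X * (F.δ₀ / X) := mul_le_mul_of_nonneg_left hz hX0.le
    _ = F.δ₀ := by field_simp

/-- Full-order flow lines that start near the orbit stay near it over a period, with outputs that are
small throughout and of order `1 / ε ^ 2` at its end.  The bound `ν` on the initial distance does not
depend on the bound `η'` wanted for the outputs. -/
theorem exists_full_path [FiniteDimensional ℝ E] [CompleteSpace W] (F : S.Frame) :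
    ∃ k₀ : ℝ, 1 < k₀ ∧ ∀ k, k₀ ≤ k → ∀ η > 0, ∃ ν > 0, ∀ η' > 0, ∃ ν₁ > 0, ∀ ν' > 0,
      ∃ ε₀ : ℝ, 1 ≤ ε₀ ∧ ∀ ε, ε₀ ≤ ε →
      ∀ w₀ : W, ε * ‖S.pe w₀‖ + ‖S.pb w₀‖ ≤ ν₁ → ‖w₀ - S.ι (F.ξ 0)‖ ≤ ν →
        ∃ w : ℝ → W, w 0 = w₀ ∧
          (∀ t ∈ Icc 0 (S.T + F.θ₀),
            w t ∈ F.A ∧ HasDerivAt w ((S.full ε k).field (w t)) t) ∧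
          ∀ t ∈ Icc 0 (S.T + F.θ₀), ‖w t - S.ι (F.ξ t)‖ ≤ η ∧
            ‖S.pe (w t)‖ + ‖S.pb (w t)‖ ≤ η' ∧
            (S.T / 2 ≤ t → ε * (‖S.pe (w t)‖ + ‖S.pb (w t)‖) ≤ ν') := by
  obtain ⟨k₀, hk₀, hout⟩ := F.exists_output_bound
  obtain ⟨C', hC', hpath⟩ := F.exists_path_bound
  refine ⟨k₀, hk₀, fun k hk η hη => ?_⟩
  obtain ⟨C, hC, ε₀, hε₀, hout⟩ := hout k hk
  set T' := S.T + F.θ₀ with hT'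
  have hT'0 : 0 < T' := add_pos S.T_pos F.θ₀_pos
  set η₁ := min η F.δ₀ with hη₁
  have hη₁0 : 0 < η₁ := lt_min hη F.δ₀_pos
  set ν := min 1 (η₁ / (2 * (C' * (1 + 2 * C)))) with hν
  have hν0 : 0 < ν := lt_min one_pos (by positivity)
  have hν1 : ν ≤ 1 := min_le_left _ _
  have hνη : C' * (1 + 2 * C) * ν < η₁ := by
    have h := min_le_right 1 (η₁ / (2 * (C' * (1 + 2 * C))))
    rw [← hν, le_div_iff₀ (by positivity)] at h
    nlinarith
  refine ⟨ν, hν0, fun η' hη' => ?_⟩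
  set ν₁ := min ν (η' / (2 * C)) with hν₁
  have hν₁0 : 0 < ν₁ := lt_min hν0 (by positivity)
  have hν₁ν : ν₁ ≤ ν := min_le_left _ _
  have hν₁η : 2 * C * ν₁ ≤ η' := by
    have h := min_le_right ν (η' / (2 * C))
    rw [← hν₁, le_div_iff₀ (by positivity)] at h
    linarith
  refine ⟨ν₁, hν₁0, fun ν' hν' => ⟨max ε₀ (max (1 / ν₁) (C / ν')), hε₀.trans (le_max_left _ _),
    fun ε hε w₀ hw₀ hw₀ξ => ?_⟩⟩
  have hεε₀ : ε₀ ≤ ε := (le_max_left _ _).trans hε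
  have hε1 : 1 ≤ ε := hε₀.trans hεε₀
  have hε0 : 0 < ε := by linarith
  have hεν : 1 / ε ≤ ν₁ := by
    have h := (le_max_left _ _).trans ((le_max_right _ _).trans hε)
    rw [div_le_iff₀ hν₁0] at h
    rw [div_le_iff₀ hε0]
    linarith
  have hεν' : C / ε ≤ ν' := by
    have h := (le_max_right _ _).trans ((le_max_right _ _).trans hε)
    rw [div_le_iff₀ hν'] at h
    rw [div_le_iff₀ hε0]
    linarith
  obtain ⟨L, hL⟩ := F.isCutoff.exists_lipschitzWith S.isOpen_U (S.contDiffOn_field ε k)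
  obtain ⟨B, hB⟩ := F.isCutoff.exists_bound S.isOpen_U (S.contDiffOn_field ε k)
  obtain ⟨w, h0, hw⟩ := exists_hasDerivAt_of_lipschitzWith_of_bounded hL hB w₀ T'
  have hloc : ∀ t ∈ Icc 0 T', (∀ s ∈ Icc 0 t, ‖w s - S.ι (F.ξ s)‖ ≤ η₁) → ∀ s ∈ Icc 0 t,
      w s ∈ F.A ∧ HasDerivAt w ((S.full ε k).field (w s)) s := by
    intro t ht h s hs
    have hs' : s ∈ Icc 0 T' := ⟨hs.1, hs.2.trans ht.2⟩
    have hA : w s ∈ F.A := mem_A_of_norm_le hs' ((h s hs).trans (min_le_right _ _))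
    refine ⟨hA, ?_⟩
    have := hw s hs'
    rwa [F.isCutoff.smul_eq _ (F.A_subset hA)] at this
  have hsmall : ∀ t ∈ Icc 0 T', (∀ s ∈ Icc 0 t, ‖w s - S.ι (F.ξ s)‖ ≤ η₁) → ∀ s ∈ Icc 0 t,
      ‖S.pe (w s)‖ + ‖S.pb (w s)‖ ≤ 2 * C * ν₁ := by
    intro t ht h s hs
    have h1 := (hout ε hεε₀ t w (hloc t ht h)).1 s hs
    rw [h0] at h1
    have h2 : C * (ε * ‖S.pe w₀‖ + ‖S.pb w₀‖ + 1 / ε) ≤ C * (ν₁ + ν₁) :=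
      mul_le_mul_of_nonneg_left (add_le_add hw₀ hεν) hC.le
    have h3 : ‖S.pe (w s)‖ ≤ ε * ‖S.pe (w s)‖ := le_mul_of_one_le_left (norm_nonneg _) hε1
    linarith
  have hclose : ∀ t ∈ Icc 0 T', ‖w t - S.ι (F.ξ t)‖ < η₁ := by
    refine forall_lt_of_forall_le_imp_lt (g := fun t => ‖w t - S.ι (F.ξ t)‖) ?_ ?_ ?_
    · intro t ht
      exact ((hw t ht).continuousAt.sub (S.ι.continuous.continuousAt.comp
        (F.deriv_ξ t ht).continuousAt)).norm.continuousWithinAt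
    · intro t ht hlt hle
      have h : ∀ s ∈ Icc 0 t, ‖w s - S.ι (F.ξ s)‖ ≤ η₁ := by
        intro s hs
        rcases hs.2.eq_or_lt with rfl | h
        · exact hle
        · exact hlt s ⟨hs.1, h⟩
      have h1 := hpath (2 * C * ν₁) (by positivity) t ht.2 w (fun t => S.ι (F.ξ t))
        (isPath_of_field (hloc t ht h)) (isPath_ξ.mono ht.2) (hsmall t ht h)
        (fun s _ => by simp only [S.pe_ι, S.pb_ι, norm_zero, add_zero]; positivity)
        t ⟨ht.1, le_rfl⟩
      have h2 : ‖S.pz (w 0) - S.pz (S.ι (F.ξ 0))‖ ≤ ν := by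
        rw [← map_sub, h0]
        exact (S.norm_pz_le _).trans hw₀ξ
      calc _ ≤ C' * (ν + 2 * C * ν) :=
            h1.trans (mul_le_mul_of_nonneg_left
              (add_le_add h2 (mul_le_mul_of_nonneg_left hν₁ν (by linarith))) (by linarith))
        _ = C' * (1 + 2 * C) * ν := by ring
        _ < η₁ := hνη
    · simp only [h0]
      refine (hw₀ξ.trans ?_).trans_lt hνη
      have : 1 ≤ C' * (1 + 2 * C) := by nlinarith
      exact le_mul_of_one_le_left hν0.le this
  have hT'mem : T' ∈ Icc 0 T' := ⟨hT'0.le, le_rfl⟩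
  have hcl : ∀ s ∈ Icc 0 T', ‖w s - S.ι (F.ξ s)‖ ≤ η₁ := fun s hs => (hclose s hs).le
  refine ⟨w, h0, hloc T' hT'mem hcl, fun t ht => ⟨(hcl t ht).trans (min_le_left _ _), ?_, ?_⟩⟩
  · exact (hsmall T' hT'mem hcl t ht).trans hν₁η
  · intro hTt
    refine ((hout ε hεε₀ T' w (hloc T' hT'mem hcl)).2 ?_ t ht hTt).trans hεν'
    rw [h0]
    exact hw₀.trans (hν₁ν.trans hν1)

/-- Paths near the orbit reach the guard, transversally, near time `T`; those with nearby starts do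
so at nearby points. -/
theorem exists_crossing (F : S.Frame) : ∃ θ > 0, θ ≤ F.θ₀ ∧ θ ≤ S.T / 2 ∧ ∃ δ > 0, ∃ C > 0,
    (∀ γ, F.IsPath γ (S.T + θ) → (∀ t ∈ Icc 0 (S.T + θ), ‖γ t - S.ι (F.ξ t)‖ ≤ δ) →
      0 ≤ S.H (γ 0) → ∃ τ ∈ Ioo (S.T - θ) (S.T + θ), S.H (γ τ) = 0 ∧ S.σ (γ τ) < 0 ∧
        ∀ t ∈ Ioo 0 τ, 0 < S.H (γ t)) ∧
    ∀ (γ₁ : ℝ → W) (φ : ℝ → Z) (τ₁ τ₂ κ : ℝ), F.IsPath γ₁ (S.T + θ) → F.IsPath (fun t => S.ι (φ t)) (S.T + θ) →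
      (∀ t ∈ Icc 0 (S.T + θ), ‖S.ι (φ t) - S.ι (F.ξ t)‖ ≤ δ) → 0 ≤ S.H (S.ι (φ 0)) →
      τ₁ ∈ Ioo (S.T - θ) (S.T + θ) → τ₂ ∈ Ioo (S.T - θ) (S.T + θ) →
      S.H (γ₁ τ₁) = 0 → S.H (S.ι (φ τ₂)) = 0 →
      (∀ t ∈ Icc 0 (S.T + θ), ‖γ₁ t - S.ι (φ t)‖ ≤ κ) →
      ‖γ₁ τ₁ - S.ι (φ τ₂)‖ ≤ C * κ ∧ |τ₁ - τ₂| ≤ C * κ := by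
  have hT := S.T_pos
  obtain ⟨L, hL⟩ := F.isCutoff.exists_lipschitzWith S.isOpen_U S.contDiffOn_H
  obtain ⟨L', hL'⟩ := F.isCutoff.exists_lipschitzWith S.isOpen_U S.contDiffOn_σ
  have hHeq : ∀ w ∈ F.A, F.χ w • S.H w = S.H w := fun w hw =>
    F.isCutoff.smul_eq S.H (F.A_subset hw)
  have hσeq : ∀ w ∈ F.A, F.χ w • S.σ w = S.σ w := fun w hw =>
    F.isCutoff.smul_eq S.σ (F.A_subset hw)
  -- along every path the derivative of `H` is `σ`
  have hder : ∀ γ t₁, F.IsPath γ t₁ → ∀ t ∈ Icc 0 t₁,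
      HasDerivAt ((fun w => F.χ w • S.H w) ∘ γ) (F.χ (γ t) • S.σ (γ t)) t := by
    intro γ t₁ hγ t ht
    obtain ⟨hA, v, hv, he, hz⟩ := hγ t ht
    have hU := A_subset_U hA
    rw [hσeq _ hA, ← S.fderiv_H _ hU v he hz]
    have h1 := ((S.contDiffOn_H.contDiffAt (S.isOpen_U.mem_nhds hU)).differentiableAt
        one_ne_zero).hasFDerivAt
    have h2 : (fun w => F.χ w • S.H w) =ᶠ[𝓝 (γ t)] S.H := by
      filter_upwards [F.isCutoff.isOpen.mem_nhds (F.A_subset hA)] with w hw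
      exact F.isCutoff.smul_eq S.H hw
    exact (h1.congr_of_eventuallyEq h2).comp_hasDerivAt t hv
  have hξA : ∀ t ∈ Icc 0 (S.T + F.θ₀), S.ι (F.ξ t) ∈ F.A := fun t ht => (isPath_ξ t ht).1
  have hmem : ∀ t ∈ Icc 0 S.T, t ∈ Icc 0 (S.T + F.θ₀) := fun t ht =>
    ⟨ht.1, by linarith [ht.2, F.θ₀_pos]⟩
  have hξpos : ∀ t ∈ Ioo 0 S.T, 0 < F.χ (S.ι (F.ξ t)) • S.H (S.ι (F.ξ t)) := by
    intro t ht
    have htI : t ∈ Icc 0 S.T := ⟨ht.1.le, ht.2.le⟩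
    have hnn : ∀ u ∈ Ico 0 S.T, 0 ≤ F.χ (S.ι (F.ξ u)) • S.H (S.ι (F.ξ u)) := by
      intro u hu
      rw [hHeq _ (hξA u (hmem u ⟨hu.1, hu.2.le⟩)), F.ξ_eq u ⟨hu.1, hu.2.le⟩]
      exact (S.ζ_flow u hu).1
    refine lt_of_le_of_ne (hnn t ⟨ht.1.le, ht.2⟩) fun h0 => ?_
    -- at an interior zero `H` has a minimum along the orbit, so that its derivative vanishes
    have hmin : IsLocalMin ((fun w => F.χ w • S.H w) ∘ fun t => S.ι (F.ξ t)) t := by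
      filter_upwards [Ioo_mem_nhds ht.1 ht.2] with u hu
      simp only [Function.comp_apply, ← h0]
      exact hnn u ⟨hu.1.le, hu.2⟩
    have hd := hmin.hasDerivAt_eq_zero (hder _ _ isPath_ξ t (hmem t htI))
    rw [hσeq _ (hξA t (hmem t htI)), F.ξ_eq t htI] at hd
    rw [hHeq _ (hξA t (hmem t htI)), F.ξ_eq t htI] at h0
    exact S.ζ_transverse t htI h0.symm hd
  have h0I : (0 : ℝ) ∈ Icc 0 S.T := ⟨le_rfl, hT.le⟩
  have hTI : S.T ∈ Icc 0 S.T := ⟨hT.le, le_rfl⟩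
  have hξ0 : 0 < F.χ (S.ι (F.ξ 0)) • S.H (S.ι (F.ξ 0)) ∨
      0 < F.χ (S.ι (F.ξ 0)) • S.σ (S.ι (F.ξ 0)) := by
    rw [hHeq _ (hξA 0 (hmem 0 h0I)), hσeq _ (hξA 0 (hmem 0 h0I)), F.ξ_eq 0 h0I]
    obtain ⟨h1, h2⟩ := S.ζ_flow 0 ⟨le_rfl, hT⟩
    rcases h1.eq_or_lt with h | h
    · right
      have h3 := S.ζ_transverse 0 h0I h.symm
      by_contra h4
      exact h2 ⟨h.symm, lt_of_le_of_ne (not_lt.1 h4) h3⟩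
    · exact Or.inl h
  have hξc : ContinuousOn (fun t => S.ι (F.ξ t)) (Icc 0 (S.T + F.θ₀)) := fun t ht =>
    (S.ι.continuous.continuousAt.comp (F.deriv_ξ t ht).continuousAt).continuousWithinAt
  obtain ⟨θ, hθ, hθθ₀, hθT, a, ha, δ, hδ, hcross⟩ := exists_crossing_of_close hL hL' hT F.θ₀_pos
    hξc hξpos hξ0
    (by rw [hHeq _ (hξA _ (hmem _ hTI)), F.ξ_eq _ hTI]; exact S.ζ_guard.1)
    (by rw [hσeq _ (hξA _ (hmem _ hTI)), F.ξ_eq _ hTI]; exact S.ζ_guard.2)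
  obtain ⟨M, hM, hMle⟩ := F.isCompact_A.exists_pos_bound (S.contDiffOn_ψ.continuousOn.mono A_subset_U)
  have hpoint := fun (γ : ℝ → W) (hγ : F.IsPath γ (S.T + θ))
      (hcl : ∀ t ∈ Icc 0 (S.T + θ), ‖γ t - S.ι (F.ξ t)‖ ≤ δ) (h0 : 0 ≤ S.H (γ 0)) => hcross γ
        (fun t ht => ⟨hcl t ht, hder γ _ hγ t ht⟩)
        (by rw [hHeq _ (hγ 0 ⟨le_rfl, by linarith⟩).1]; exact h0)
  have hLa : 0 ≤ (L : ℝ) / a := div_nonneg L.2 ha.le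
  refine ⟨θ, hθ, hθθ₀, hθT, δ, hδ, 1 + (M + 1) * (L / a),
    by positivity, fun γ hγ hcl h0 => ?_, ?_⟩
  · obtain ⟨τ, hτ, hHτ, hpos, hσ⟩ := hpoint γ hγ hcl h0
    have hAτ : ∀ t ∈ Icc 0 τ, γ t ∈ F.A := fun t ht => (hγ t ⟨ht.1, by linarith [ht.2, hτ.2]⟩).1
    have hτ0 : 0 < τ := by linarith [hτ.1]
    refine ⟨τ, hτ, ?_, ?_, fun t ht => ?_⟩
    · rwa [hHeq _ (hAτ τ ⟨hτ0.le, le_rfl⟩)] at hHτ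
    · have := hσ τ ⟨hτ.1.le, hτ.2.le⟩
      rw [hσeq _ (hAτ τ ⟨hτ0.le, le_rfl⟩)] at this
      linarith
    · have := hpos t ht
      rwa [hHeq _ (hAτ t ⟨ht.1.le, ht.2.le⟩)] at this
  · intro γ₁ φ τ₁ τ₂ κ h₁ h₂ hcl h0 hτ₁ hτ₂ hH₁ hH₂ hκ
    obtain ⟨-, -, -, -, hσ⟩ := hpoint _ h₂ hcl h0
    have hin : ∀ t ∈ Icc (S.T - θ) (S.T + θ), t ∈ Icc 0 (S.T + θ) := fun t ht =>
      ⟨by linarith [ht.1], ht.2⟩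
    have hτ₁' := hin τ₁ ⟨hτ₁.1.le, hτ₁.2.le⟩
    have hτ₂' := hin τ₂ ⟨hτ₂.1.le, hτ₂.2.le⟩
    have hτ := abs_crossing_time_sub_le (σ := fun w => F.χ w • S.σ w) (γ₁ := γ₁) (γ₂ := fun t => S.ι (φ t)) (τ₁ := τ₁) (τ₂ := τ₂)
      hL ha (fun u hu => hder _ _ h₂ u (hin u hu)) hσ ⟨hτ₁.1.le, hτ₁.2.le⟩ ⟨hτ₂.1.le, hτ₂.2.le⟩
      (by rw [hHeq _ (h₁ τ₁ hτ₁').1]; exact hH₁) (by rw [hHeq _ (h₂ τ₂ hτ₂').1]; exact hH₂)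
      (hκ τ₁ hτ₁')
    have hκ0 : 0 ≤ κ := (norm_nonneg _).trans (hκ τ₁ hτ₁')
    have hspeed : ‖S.ι (φ τ₁) - S.ι (φ τ₂)‖ ≤ M * |τ₁ - τ₂| := by
      have hz : ∀ t ∈ Icc 0 (S.T + θ), HasDerivWithinAt φ (S.ψ (S.ι (φ t))) (Icc 0 (S.T + θ)) t := by
        intro t ht
        obtain ⟨-, v, hv, -, hψ⟩ := h₂ t ht
        have := S.pz.hasFDerivAt.comp_hasDerivAt t hv
        rw [hψ] at this
        have h3 : (S.pz ∘ fun t => S.ι (φ t)) = φ := by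
          funext u
          simp [S.pz_ι]
        rw [h3] at this
        exact this.hasDerivWithinAt
      have := (convex_Icc (0 : ℝ) (S.T + θ)).norm_image_sub_le_of_norm_hasDerivWithin_le hz
        (fun t ht => hMle _ (h₂ t ht).1) hτ₂' hτ₁'
      rwa [← map_sub, S.norm_ι, ← Real.norm_eq_abs]
    have e1 : L * κ / a = L / a * κ := by ring
    rw [e1] at hτ
    have hMτ := mul_le_mul_of_nonneg_left hτ hM.le
    have h3 : 0 ≤ L / a * κ := mul_nonneg hLa hκ0
    have h4 : 0 ≤ M * (L / a * κ) := mul_nonneg hM.le h3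
    constructor
    · calc ‖γ₁ τ₁ - S.ι (φ τ₂)‖ ≤ ‖γ₁ τ₁ - S.ι (φ τ₁)‖ + ‖S.ι (φ τ₁) - S.ι (φ τ₂)‖ :=
            norm_sub_le_norm_sub_add_norm_sub _ _ _
        _ ≤ κ + M * (L / a * κ) := add_le_add (hκ τ₁ hτ₁') (hspeed.trans hMτ)
        _ ≤ _ := by linarith
    · linarith

theorem isArc_full {ε k : ℝ} {γ : ℝ → W} {τ t₁ : ℝ} (hτ : 0 < τ) (hτ₁ : τ ≤ t₁)
    (hγ : ∀ t ∈ Icc 0 t₁, γ t ∈ F.A ∧ HasDerivAt γ ((S.full ε k).field (γ t)) t)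
    (h0 : 0 ≤ S.H (γ 0) ∧ ¬(S.H (γ 0) = 0 ∧ S.σ (γ 0) < 0)) (hHτ : S.H (γ τ) = 0)
    (hσ : S.σ (γ τ) < 0) (hpos : ∀ t ∈ Ioo 0 τ, 0 < S.H (γ t)) :
    (S.full ε k).IsArc (γ 0) τ γ (γ τ) := by
  obtain ⟨L, hL⟩ := F.isCutoff.exists_lipschitzWith S.isOpen_U (S.contDiffOn_field ε k)
  have hsub : ∀ t ∈ Icc 0 τ, t ∈ Icc 0 t₁ := fun t ht => ⟨ht.1, ht.2.trans hτ₁⟩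
  have hU : ∀ t ∈ Icc 0 τ, γ t ∈ S.U := fun t ht => A_subset_U (hγ t (hsub t ht)).1
  have hτI : τ ∈ Icc 0 τ := ⟨hτ.le, le_rfl⟩
  refine ⟨hτ, rfl, fun t ht => ?_, fun t ht => (hγ t (hsub t ⟨ht.1, ht.2.le⟩)).2,
    (hγ τ (hsub τ hτI)).2.continuousAt.tendsto.mono_left nhdsWithin_le_nhds,
    (S.mem_full_guard ε k _ (hU τ hτI)).2 ⟨hHτ, hσ⟩, fun w hw => ?_⟩
  · rw [S.mem_full_flowSet ε k _ (hU t ⟨ht.1, ht.2.le⟩)]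
    rcases ht.1.eq_or_lt with rfl | h
    · exact h0
    · exact ⟨(hpos t ⟨h, ht.2⟩).le, fun h' => (hpos t ⟨h, ht.2⟩).ne' h'.1⟩
  · refine hw.follows hL F.isCutoff.isOpen (fun w hw => (F.isCutoff.smul_eq _ hw).symm) hτ
      (fun t ht => ?_) (fun t ht => F.A_subset (hγ t (hsub t ht)).1) (fun t ht => ?_) ?_
    · rw [F.isCutoff.smul_eq _ (F.A_subset (hγ t (hsub t ht)).1)]
      exact (hγ t (hsub t ht)).2
    · rw [S.mem_full_guard ε k _ (hU t ⟨ht.1.le, ht.2.le⟩)]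
      exact fun h => (hpos t ht).ne' h.1
    · rw [S.mem_full_flowSet ε k _ (hU τ hτI)]
      exact fun h => h.2 ⟨hHτ, hσ⟩

theorem isArc_zero {φ : ℝ → Z} {τ t₁ : ℝ} (hτ : 0 < τ) (hτ₁ : τ ≤ t₁)
    (hA : ∀ t ∈ Icc 0 t₁, S.ι (φ t) ∈ F.A)
    (hφ : ∀ t ∈ Icc 0 t₁, HasDerivAt φ (F.zeroField (φ t)) t)
    (h0 : 0 ≤ S.H (S.ι (φ 0)) ∧ ¬(S.H (S.ι (φ 0)) = 0 ∧ S.σ (S.ι (φ 0)) < 0))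
    (hHτ : S.H (S.ι (φ τ)) = 0) (hσ : S.σ (S.ι (φ τ)) < 0)
    (hpos : ∀ t ∈ Ioo 0 τ, 0 < S.H (S.ι (φ t))) :
    S.zero.IsArc (φ 0) τ φ (φ τ) := by
  obtain ⟨L, hL⟩ := F.exists_lipschitzWith_zeroField
  have hsub : ∀ t ∈ Icc 0 τ, t ∈ Icc 0 t₁ := fun t ht => ⟨ht.1, ht.2.trans hτ₁⟩
  have hU : ∀ t ∈ Icc 0 τ, S.ι (φ t) ∈ S.U := fun t ht => A_subset_U (hA t (hsub t ht))
  have hτI : τ ∈ Icc 0 τ := ⟨hτ.le, le_rfl⟩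
  refine ⟨hτ, rfl, fun t ht => ?_, fun t ht => ?_,
    (hφ τ (hsub τ hτI)).continuousAt.tendsto.mono_left nhdsWithin_le_nhds,
    (S.mem_zero_guard _ (hU τ hτI)).2 ⟨hHτ, hσ⟩, fun w hw => ?_⟩
  · rw [S.mem_zero_flowSet _ (hU t ⟨ht.1, ht.2.le⟩)]
    rcases ht.1.eq_or_lt with rfl | h
    · exact h0
    · exact ⟨(hpos t ⟨h, ht.2⟩).le, fun h' => (hpos t ⟨h, ht.2⟩).ne' h'.1⟩
  · have h1 := hsub t ⟨ht.1, ht.2.le⟩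
    rw [S.zero_field _ (A_subset_U (hA t h1)), ← zeroField_eq (hA t h1)]
    exact hφ t h1
  · refine hw.follows hL (F.isCutoff.isOpen.preimage S.ι.continuous) (fun z hz => ?_) hτ
      (fun t ht => hφ t (hsub t ht)) (fun t ht => F.A_subset (hA t (hsub t ht))) (fun t ht => ?_) ?_
    · rw [S.zero_field _ (F.isCutoff.subset hz)]
      exact (F.isCutoff.smul_eq S.ψ hz).symm
    · rw [S.mem_zero_guard _ (hU t ⟨ht.1.le, ht.2.le⟩)]
      exact fun h => (hpos t ht).ne' h.1
    · rw [S.mem_zero_flowSet _ (hU τ hτI)]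
      exact fun h => h.2 ⟨hHτ, hσ⟩

end Frame

end HighGainSystem

/-! ### The return maps to the guard -/

namespace HighGainSystem

variable {E Z W : Type*} [NormedAddCommGroup E] [InnerProductSpace ℝ E]
    [NormedAddCommGroup Z] [NormedSpace ℝ Z] [NormedAddCommGroup W] [NormedSpace ℝ W]
    {S : HighGainSystem E Z W}

variable (S) in
/-- The part of the guard that lies in `U`. -/
def guardSet : Set W := {w | w ∈ S.U ∧ S.H w = 0 ∧ S.σ w < 0}

theorem ι_ζ_mem_guardSet : S.ι (S.ζ S.T) ∈ S.guardSet :=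
  ⟨S.ζ_mem _ (right_mem_Icc.2 S.T_pos.le), S.ζ_guard⟩

/-- Points of the guard near the orbit are close to points of the guard of the zero dynamics, up to
a multiple of their outputs: a point of `range ι` can be moved into the surface `{H = 0}` along the
direction of the flow, which is transverse to that surface. -/
theorem exists_guard_projection (S : HighGainSystem E Z W) :
    ∃ ρ > 0, ∃ C > 0, ∀ y ∈ S.guardSet, ‖y - S.ι (S.ζ S.T)‖ ≤ ρ →
      ∃ p, S.ι p ∈ S.guardSet ∧ ‖y - S.ι p‖ ≤ C * (‖S.pe y‖ + ‖S.pb y‖) := by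
  obtain ⟨hx₀, hH₀, hσ₀⟩ := S.ι_ζ_mem_guardSet
  set x₀ := S.ι (S.ζ S.T) with hx₀'
  set u := S.ψ x₀ with hu
  have hdir : fderiv ℝ S.H x₀ (S.ι u) = S.σ x₀ :=
    S.fderiv_H x₀ hx₀ _ (by rw [S.pe_ι, hx₀', S.pb_ι]) (S.pz_ι u)
  set a := -S.σ x₀ / 2 with ha
  have ha0 : 0 < a := by rw [ha]; linarith
  have hU := S.isOpen_U.mem_nhds hx₀
  have hstrict : HasStrictFDerivAt S.H (fderiv ℝ S.H x₀) x₀ :=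
    (S.contDiffOn_H.contDiffAt hU).hasStrictFDerivAt one_ne_zero
  have hc : 0 < a / (‖u‖ + 1) := div_pos ha0 (by positivity)
  have hev := hstrict.isLittleO.def hc
  rw [nhds_prod_eq] at hev
  obtain ⟨t, ht, hev⟩ := (eventually_prod_self_iff (r := fun x y =>
    ‖S.H x - S.H y - fderiv ℝ S.H x₀ (x - y)‖ ≤ a / (‖u‖ + 1) * ‖x - y‖)).1 hev
  have ht' : ∀ᶠ w in 𝓝 x₀, w ∈ t := ht
  have hσt : ∀ᶠ w in 𝓝 x₀, S.σ w < 0 :=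
    ((S.contDiffOn_σ.contDiffAt hU).continuousAt).eventually_lt_const hσ₀
  obtain ⟨R, hR, hball⟩ := Metric.eventually_nhds_iff_ball.1
    (ht'.and (hσt.and (S.isOpen_U.eventually_mem hx₀)))
  set L := a / (‖u‖ + 1) + ‖fderiv ℝ S.H x₀‖ with hL
  have hL0 : 0 < L := by positivity
  have hLip : ∀ x ∈ Metric.ball x₀ R, ∀ y ∈ Metric.ball x₀ R, |S.H x - S.H y| ≤ L * ‖x - y‖ := by
    intro x hx y hy
    have h1 := hev x (hball x hx).1 y (hball y hy).1
    have h2 := (fderiv ℝ S.H x₀).le_opNorm (x - y)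
    rw [Real.norm_eq_abs] at h1 h2
    have h3 := abs_sub_abs_le_abs_sub (S.H x - S.H y) (fderiv ℝ S.H x₀ (x - y))
    rw [hL, add_mul]
    linarith
  have hCpos : 0 < 1 + L * ‖u‖ / a := by positivity
  refine ⟨R / (2 * (2 + 2 * (L * ‖u‖ / a))), by positivity, 1 + L * ‖u‖ / a, hCpos, ?_⟩
  intro y ⟨hyU, hHy, hσy⟩ hyρ
  rw [le_div_iff₀ (by positivity)] at hyρ
  set e := ‖S.pe y‖ + ‖S.pb y‖ with he
  have he0 : 0 ≤ e := by positivity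
  have hD0 := norm_nonneg (y - x₀)
  have he2 : e ≤ 2 * ‖y - x₀‖ := by
    have h1 := S.norm_pe_le (y - x₀)
    have h2 := S.norm_pb_le (y - x₀)
    rw [map_sub, hx₀', S.pe_ι, sub_zero] at h1
    rw [map_sub, hx₀', S.pb_ι, sub_zero] at h2
    rw [he]; linarith
  have hLu : 0 ≤ L * ‖u‖ / a := by positivity
  have hyx : ‖S.ι (S.pz y) - x₀‖ ≤ ‖y - x₀‖ := by
    have := S.norm_pz_le (y - x₀)
    rwa [map_sub, hx₀', S.pz_ι, ← S.norm_ι, map_sub] at this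
  have hyp : ‖y - S.ι (S.pz y)‖ ≤ e := by simpa using S.norm_sub_ι_le y (S.pz y)
  set s₀ := L * e / a with hs₀
  have hs₀0 : 0 ≤ s₀ := by positivity
  have hs₀u : s₀ * ‖u‖ = L * ‖u‖ / a * e := by rw [hs₀]; ring
  have hline : ∀ s, |s| ≤ s₀ → ‖S.ι (S.pz y + s • u) - S.ι (S.pz y)‖ ≤ L * ‖u‖ / a * e := by
    intro s hs
    rw [← map_sub, S.norm_ι, add_sub_cancel_left, norm_smul, Real.norm_eq_abs, ← hs₀u]
    exact mul_le_mul_of_nonneg_right hs (norm_nonneg u)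
  have hmem : ∀ s, |s| ≤ s₀ → S.ι (S.pz y + s • u) ∈ Metric.ball x₀ R := by
    intro s hs
    rw [mem_ball_iff_norm]
    have h1 := norm_sub_le_norm_sub_add_norm_sub (S.ι (S.pz y + s • u)) (S.ι (S.pz y)) x₀
    have h2 := mul_le_mul_of_nonneg_left he2 hLu
    have h3 := hline s hs
    have h4 : ‖y - x₀‖ + L * ‖u‖ / a * (2 * ‖y - x₀‖) < R := by
      rcases hD0.eq_or_lt with h | h
      · rw [← h]; simpa using hR
      · nlinarith [mul_nonneg hLu hD0]
    linarith
  have hybase : S.ι (S.pz y) ∈ Metric.ball x₀ R := by simpa using hmem 0 (by simpa using hs₀0)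
  have hyR : y ∈ Metric.ball x₀ R := by
    rw [mem_ball_iff_norm]
    rcases hD0.eq_or_lt with h | h
    · rw [← h]; exact hR
    · nlinarith [mul_nonneg hLu hD0]
  have hbase : |S.H (S.ι (S.pz y))| ≤ L * e := by
    have := hLip _ hyR _ hybase
    rw [hHy, zero_sub, abs_neg] at this
    exact this.trans (mul_le_mul_of_nonneg_left hyp hL0.le)
  have hslope : ∀ s, |s| ≤ s₀ →
      |S.H (S.ι (S.pz y + s • u)) - S.H (S.ι (S.pz y)) + 2 * a * s| ≤ a * |s| := by
    intro s hs
    have h1 := hev _ (hball _ (hmem s hs)).1 _ (hball _ hybase).1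
    have h2 : S.ι (S.pz y + s • u) - S.ι (S.pz y) = s • S.ι u := by
      rw [← map_sub, add_sub_cancel_left, map_smul]
    rw [h2, map_smul, hdir, norm_smul, S.norm_ι, Real.norm_eq_abs, Real.norm_eq_abs,
      smul_eq_mul] at h1
    have h3 : a / (‖u‖ + 1) * (|s| * ‖u‖) ≤ a * |s| := by
      rw [div_mul_eq_mul_div, div_le_iff₀ (by positivity)]
      nlinarith [mul_nonneg ha0.le (abs_nonneg s)]
    have h4 : S.H (S.ι (S.pz y + s • u)) - S.H (S.ι (S.pz y)) + 2 * a * s =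
        S.H (S.ι (S.pz y + s • u)) - S.H (S.ι (S.pz y)) - s * S.σ x₀ := by
      rw [ha]; ring
    rw [h4]
    exact h1.trans h3
  have hcont : ContinuousOn (fun s : ℝ => S.H (S.ι (S.pz y + s • u))) (Icc (-s₀) s₀) := by
    intro s hs
    have hsU := (hball _ (hmem s (abs_le.2 hs))).2.2
    have h1 := (S.contDiffOn_H.contDiffAt (S.isOpen_U.mem_nhds hsU)).continuousAt
    have h2 : Continuous fun s : ℝ => S.ι (S.pz y + s • u) := by fun_prop
    exact (ContinuousAt.comp (f := fun s : ℝ => S.ι (S.pz y + s • u)) h1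
      h2.continuousAt).continuousWithinAt
  have hs₀a : a * s₀ = L * e := by rw [hs₀]; field_simp
  have hb := abs_le.1 hbase
  have hs₁ := abs_le.1 (hslope s₀ (abs_of_nonneg hs₀0).le)
  have hs₂ := abs_le.1 (hslope (-s₀) (by rw [abs_neg, abs_of_nonneg hs₀0]))
  rw [abs_of_nonneg hs₀0] at hs₁
  rw [abs_neg, abs_of_nonneg hs₀0] at hs₂
  obtain ⟨s, hs, hHs⟩ := intermediate_value_Icc' (by linarith) hcont
    (show (0 : ℝ) ∈ Icc _ _ from ⟨by linarith [hs₁.2], by linarith [hs₂.1]⟩)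
  have hs' := abs_le.2 hs
  obtain ⟨-, hσs, hUs⟩ := hball _ (hmem s hs')
  refine ⟨S.pz y + s • u, ⟨hUs, hHs, hσs⟩, ?_⟩
  have h1 := norm_sub_le_norm_sub_add_norm_sub y (S.ι (S.pz y)) (S.ι (S.pz y + s • u))
  rw [norm_sub_rev (S.ι (S.pz y))] at h1
  have h2 := hline s hs'
  rw [add_mul, one_mul]
  linarith

theorem exists_reset_bound (S : HighGainSystem E Z W) : ∃ ρ > 0, ∃ L : ℝ, 1 ≤ L ∧
    ∀ x ∈ S.guardSet, ∀ y ∈ S.guardSet, ‖x - S.ι (S.ζ S.T)‖ ≤ ρ → ‖y - S.ι (S.ζ S.T)‖ ≤ ρ →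
      ‖S.Δ x - S.Δ y‖ ≤ L * ‖x - y‖ := by
  obtain ⟨ρ, hρ, L, hL⟩ := S.reset_lipschitz
  refine ⟨ρ / 2, by positivity, max 1 L, le_max_left _ _, fun x hx y hy hxρ hyρ => ?_⟩
  have h := hL.dist_le_mul x ⟨mem_ball_iff_norm.2 (by linarith), hx⟩
    y ⟨mem_ball_iff_norm.2 (by linarith), hy⟩
  rw [dist_eq_norm, dist_eq_norm] at h
  exact h.trans (mul_le_mul_of_nonneg_right (le_max_right _ _) (norm_nonneg _))

/-- The reset map does not enlarge the outputs by more than a factor. -/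
theorem exists_reset_output_bound (S : HighGainSystem E Z W) : ∃ ρ > 0, ∃ C > 0,
    ∀ y ∈ S.guardSet, ‖y - S.ι (S.ζ S.T)‖ ≤ ρ →
      ‖S.pe (S.Δ y)‖ + ‖S.pb (S.Δ y)‖ ≤ C * (‖S.pe y‖ + ‖S.pb y‖) := by
  obtain ⟨ρ₂, hρ₂, L, hL, hreset⟩ := S.exists_reset_bound
  obtain ⟨ρ₃, hρ₃, C, hC, hproj⟩ := S.exists_guard_projection
  refine ⟨min (ρ₂ / (1 + 2 * C)) ρ₃, lt_min (by positivity) hρ₃, 2 * (L * C), by positivity,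
    fun y hy hyρ => ?_⟩
  have h1 := hyρ.trans (min_le_left _ _)
  rw [le_div_iff₀' (by positivity)] at h1
  have hD0 := norm_nonneg (y - S.ι (S.ζ S.T))
  have hyρ₂ : ‖y - S.ι (S.ζ S.T)‖ ≤ ρ₂ := by nlinarith [mul_nonneg hC.le hD0]
  obtain ⟨p, hp, hyp⟩ := hproj y hy (hyρ.trans (min_le_right _ _))
  have h2 := S.norm_pe_le (y - S.ι (S.ζ S.T))
  have h3 := S.norm_pb_le (y - S.ι (S.ζ S.T))
  rw [map_sub, S.pe_ι, sub_zero] at h2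
  rw [map_sub, S.pb_ι, sub_zero] at h3
  have h4 : C * (‖S.pe y‖ + ‖S.pb y‖) ≤ C * (2 * ‖y - S.ι (S.ζ S.T)‖) :=
    mul_le_mul_of_nonneg_left (by linarith) hC.le
  have hpρ₂ : ‖S.ι p - S.ι (S.ζ S.T)‖ ≤ ρ₂ := by
    have := norm_sub_le_norm_sub_add_norm_sub (S.ι p) y (S.ι (S.ζ S.T))
    rw [norm_sub_rev (S.ι p) y] at this
    linarith
  have h5 := hreset y hy _ hp hyρ₂ hpρ₂
  obtain ⟨h6, h7⟩ := S.reset_ι p hp.1 hp.2.1 hp.2.2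
  have h8 := S.norm_pe_le (S.Δ y - S.Δ (S.ι p))
  have h9 := S.norm_pb_le (S.Δ y - S.Δ (S.ι p))
  rw [map_sub, h6, sub_zero] at h8
  rw [map_sub, h7, sub_zero] at h9
  have h10 := mul_le_mul_of_nonneg_left hyp (by linarith : 0 ≤ L)
  linarith

theorem infDist_orbit_le (w : W) {t : ℝ} (ht : t ∈ Icc 0 S.T) :
    Metric.infDist w (S.ι '' (S.ζ '' Ico 0 S.T)) ≤ ‖w - S.ι (S.ζ t)‖ := by
  have hcl : S.ι (S.ζ t) ∈ closure (S.ι '' (S.ζ '' Ico 0 S.T)) := by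
    have hc : ContinuousWithinAt (fun t => S.ι (S.ζ t)) (Ico 0 S.T) t :=
      (S.ι.continuous.comp_continuousOn S.continuousOn_ζ t ht).mono Ico_subset_Icc_self
    have htcl : t ∈ closure (Ico 0 S.T) := by rwa [closure_Ico S.T_pos.ne]
    rw [image_image]
    exact hc.mem_closure_image htcl
  rw [← Metric.infDist_closure, ← dist_eq_norm]
  exact Metric.infDist_le_dist_of_mem hcl

/-- The return map `R` of the zero dynamics, and the return of full-order solutions to the guard.
The outputs `ε * (‖pe‖ + ‖pb‖)` at the guard do not grow, and the returns stay close to those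
of the zero dynamics. -/
theorem Frame.exists_return_map [FiniteDimensional ℝ E] [CompleteSpace Z] [CompleteSpace W]
    (F : S.Frame) : ∃ ρ > 0, ∃ C : ℝ, 1 ≤ C ∧ ∃ R : Z → Z,
      (∀ p, S.ι p ∈ S.guardSet → ‖p - S.ζ S.T‖ ≤ ρ → S.ι (R p) ∈ S.guardSet ∧
        ∃ τ φ, S.T / 2 ≤ τ ∧ S.zero.IsArc (S.zero.reset p) τ φ (R p)) ∧
      ∃ k₀ : ℝ, 1 < k₀ ∧ ∀ k, k₀ ≤ k → ∀ η > 0, ∃ ν > 0, ∀ η' > 0, ∃ ν₁ > 0,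
        ∃ ε₀ : ℝ, 1 ≤ ε₀ ∧ ∀ ε, ε₀ ≤ ε → ∀ y ∈ S.guardSet,
          ε * (‖S.pe y‖ + ‖S.pb y‖) ≤ ν₁ → ‖y - S.ι (S.ζ S.T)‖ ≤ ν → ∃ τ γ, S.T / 2 ≤ τ ∧
            (S.full ε k).IsArc (S.Δ y) τ γ (γ τ) ∧ γ τ ∈ S.guardSet ∧
            ε * (‖S.pe (γ τ)‖ + ‖S.pb (γ τ)‖) ≤ ν₁ ∧
            (∀ t ∈ Ico 0 τ, Metric.infDist (γ t) (S.ι '' (S.ζ '' Ico 0 S.T)) ≤ η) ∧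
            ∀ p, S.ι p ∈ S.guardSet → ‖p - S.ζ S.T‖ ≤ ρ →
              ‖γ τ - S.ι (R p)‖ ≤ C * (‖y - S.ι p‖ + η') := by
  have hT := S.T_pos
  obtain ⟨θ, hθ, hθθ₀, hθT, δ, hδ, C₁, hC₁, hcross, hclose⟩ := F.exists_crossing
  obtain ⟨ρ₁, hρ₁, C₂, hC₂, hzero⟩ := F.exists_zero_path
  obtain ⟨ρ₂, hρ₂, L, hL, hreset⟩ := S.exists_reset_bound
  obtain ⟨ρ₃, hρ₃, C₃, hC₃, hproj⟩ := S.exists_reset_output_bound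
  obtain ⟨ρ₄, hρ₄, hmem⟩ := Metric.eventually_nhds_iff_ball.1 S.reset_mem
  obtain ⟨C₄, hC₄, hpath⟩ := F.exists_path_bound
  obtain ⟨k₀, hk₀, hfull⟩ := F.exists_full_path
  have hL0 : 0 < L := by linarith
  have hξ0 : F.ξ 0 = S.ζ 0 := F.ξ_eq 0 ⟨le_rfl, hT.le⟩
  have hξT : F.ξ S.T = S.ζ S.T := F.ξ_eq _ ⟨hT.le, le_rfl⟩
  have hθ' : S.T + θ ≤ S.T + F.θ₀ := by linarith
  have hsub : ∀ t ∈ Icc 0 (S.T + θ), t ∈ Icc 0 (S.T + F.θ₀) := fun t ht => ⟨ht.1, ht.2.trans hθ'⟩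
  have h0I : (0 : ℝ) ∈ Icc 0 (S.T + F.θ₀) := ⟨le_rfl, by linarith [F.θ₀_pos]⟩
  -- the start of the next arc
  have hΔ : ∀ y ∈ S.guardSet, ‖y - S.ι (S.ζ S.T)‖ ≤ ρ₂ →
      ‖S.Δ y - S.ι (F.ξ 0)‖ ≤ L * ‖y - S.ι (S.ζ S.T)‖ := by
    intro y hy hyρ
    rw [hξ0, ← S.Δ_ζ]
    exact hreset y hy _ S.ι_ζ_mem_guardSet hyρ (by simpa using hρ₂.le)
  have hstart : ∀ y ∈ S.guardSet, ‖y - S.ι (S.ζ S.T)‖ ≤ ρ₄ / 2 →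
      0 ≤ S.H (S.Δ y) ∧ ¬(S.H (S.Δ y) = 0 ∧ S.σ (S.Δ y) < 0) := fun y hy h =>
    hmem y (mem_ball_iff_norm.2 (by linarith)) hy.1 hy.2.1 hy.2.2
  set ρ := min ρ₂ (min (ρ₁ / L) (min (δ / (C₂ * L)) (ρ₄ / 2))) with hρ
  have hρ0 : 0 < ρ := by
    refine lt_min hρ₂ (lt_min (by positivity) (lt_min ?_ ?_)) <;> positivity
  have hρρ₂ : ρ ≤ ρ₂ := min_le_left _ _
  have hρρ₁ : L * ρ ≤ ρ₁ := by
    have h : ρ ≤ ρ₁ / L := (min_le_right _ _).trans (min_le_left _ _)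
    rwa [le_div_iff₀' hL0] at h
  have hρδ : C₂ * (L * ρ) ≤ δ := by
    have h : ρ ≤ δ / (C₂ * L) :=
      (min_le_right _ _).trans ((min_le_right _ _).trans (min_le_left _ _))
    rw [le_div_iff₀' (by positivity)] at h
    linarith
  have hρρ₄ : ρ ≤ ρ₄ / 2 :=
    (min_le_right _ _).trans ((min_le_right _ _).trans (min_le_right _ _))
  have hz : ∀ p, S.ι p ∈ S.guardSet → ‖p - S.ζ S.T‖ ≤ ρ → ∃ (φ : ℝ → Z) (τ : ℝ),
      S.ι (φ 0) = S.Δ (S.ι p) ∧ F.IsPath (fun t => S.ι (φ t)) (S.T + θ) ∧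
      (∀ t ∈ Icc 0 (S.T + θ), ‖S.ι (φ t) - S.ι (F.ξ t)‖ ≤ δ) ∧ 0 ≤ S.H (S.ι (φ 0)) ∧
      τ ∈ Ioo (S.T - θ) (S.T + θ) ∧ S.ι (φ τ) ∈ S.guardSet ∧
      S.zero.IsArc (S.zero.reset p) τ φ (φ τ) := by
    intro p hp hpρ
    have hΔι : S.Δ (S.ι p) = S.ι (S.zero.reset p) := S.Δ_ι hp.1 hp.2.1 hp.2.2
    have hpρ' : ‖S.ι p - S.ι (S.ζ S.T)‖ ≤ ρ := by rwa [← map_sub, S.norm_ι]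
    have h1 := hΔ _ hp (hpρ'.trans hρρ₂)
    have h2 : ‖S.Δ (S.ι p) - S.ι (F.ξ 0)‖ ≤ L * ρ :=
      h1.trans (mul_le_mul_of_nonneg_left hpρ' hL0.le)
    have hs := hstart _ hp (hpρ'.trans hρρ₄)
    have h3 : ‖S.zero.reset p - F.ξ 0‖ ≤ L * ρ := by
      rwa [hΔι, ← map_sub, S.norm_ι] at h2
    obtain ⟨φ, hφ0, hφ, hφp, hφξ⟩ := hzero _ (h3.trans hρρ₁)
    rw [hΔι, ← hφ0] at hs
    have hcl : ∀ t ∈ Icc 0 (S.T + θ), ‖S.ι (φ t) - S.ι (F.ξ t)‖ ≤ δ := fun t ht =>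
      (hφξ t (hsub t ht)).trans ((mul_le_mul_of_nonneg_left h3 hC₂.le).trans hρδ)
    have hφp' := hφp.mono hθ'
    obtain ⟨τ, hτ, hHτ, hστ, hpos⟩ := hcross _ hφp' hcl hs.1
    have hτ0 : 0 < τ := by linarith [hτ.1]
    refine ⟨φ, τ, by rw [hφ0, hΔι], hφp', hcl, hs.1, hτ,
      ⟨A_subset_U (hφp' τ ⟨hτ0.le, hτ.2.le⟩).1, hHτ, hστ⟩, ?_⟩
    rw [← hφ0]
    exact isArc_zero hτ0 hτ.2.le (fun t ht => (hφp' t ht).1)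
      (fun t ht => hφ t (hsub t ht)) hs hHτ hστ hpos
  choose! φ τ hφ0 hφp hφδ hφH hτ hφG hφarc using hz
  refine ⟨ρ, hρ0, C₁ * (C₄ * L) + 1, by nlinarith [mul_pos hC₁ (mul_pos (by linarith : 0 < C₄) hL0)],
    fun p => φ p (τ p), fun p hp hpρ => ⟨hφG p hp hpρ, τ p, φ p, ?_, hφarc p hp hpρ⟩,
    k₀, hk₀, fun k hk η hη => ?_⟩
  · linarith [(hτ p hp hpρ).1]
  -- the orbit moves little near time `T`
  have hξc : ContinuousAt (fun t => S.ι (F.ξ t)) S.T :=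
    S.ι.continuous.continuousAt.comp
      (F.deriv_ξ S.T ⟨hT.le, by linarith [F.θ₀_pos]⟩).continuousAt
  obtain ⟨θ₁, hθ₁, hξθ₁⟩ := Metric.continuousAt_iff.1 hξc (η / 2) (by positivity)
  set η₁ := min (η / 2) (min δ (θ₁ / (2 * C₁))) with hη₁
  have hη₁0 : 0 < η₁ := lt_min (by positivity) (lt_min hδ (by positivity))
  have hη₁η : η₁ ≤ η / 2 := min_le_left _ _
  have hη₁δ : η₁ ≤ δ := (min_le_right _ _).trans (min_le_left _ _)
  have hη₁θ : C₁ * η₁ < θ₁ := by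
    have h : η₁ ≤ θ₁ / (2 * C₁) := (min_le_right _ _).trans (min_le_right _ _)
    rw [le_div_iff₀' (by positivity)] at h
    linarith
  obtain ⟨ν, hν, hfull⟩ := hfull k hk η₁ hη₁0
  refine ⟨min (ν / L) (min ρ₂ (min ρ₃ (ρ₄ / 2))), ?_, fun η' hη' => ?_⟩
  · exact lt_min (by positivity) (lt_min hρ₂ (lt_min hρ₃ (by positivity)))
  obtain ⟨ν₁, hν₁, hfull⟩ := hfull (η' / C₁ / C₄) (by positivity)
  have hν₂ : 0 < ν₁ / C₃ := by positivity
  obtain ⟨ε₀, hε₀, hfull⟩ := hfull _ hν₂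
  refine ⟨ν₁ / C₃, hν₂, ε₀, hε₀, fun ε hε y hy hyfast hyν => ?_⟩
  have hε1 : 1 ≤ ε := hε₀.trans hε
  have hyν' : L * ‖y - S.ι (S.ζ S.T)‖ ≤ ν := by
    have h := hyν.trans (min_le_left _ _)
    rwa [le_div_iff₀' hL0] at h
  have hyρ₂ : ‖y - S.ι (S.ζ S.T)‖ ≤ ρ₂ := hyν.trans ((min_le_right _ _).trans (min_le_left _ _))
  have hyρ₃ : ‖y - S.ι (S.ζ S.T)‖ ≤ ρ₃ :=
    hyν.trans ((min_le_right _ _).trans ((min_le_right _ _).trans (min_le_left _ _)))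
  have hyρ₄ : ‖y - S.ι (S.ζ S.T)‖ ≤ ρ₄ / 2 :=
    hyν.trans ((min_le_right _ _).trans ((min_le_right _ _).trans (min_le_right _ _)))
  have hΔy := hΔ y hy hyρ₂
  have hs := hstart y hy hyρ₄
  have hΔfast : ε * ‖S.pe (S.Δ y)‖ + ‖S.pb (S.Δ y)‖ ≤ ν₁ := by
    rw [le_div_iff₀' hC₃] at hyfast
    have h1 := mul_le_mul_of_nonneg_left (hproj y hy hyρ₃) (by linarith : 0 ≤ ε)
    have h2 := le_mul_of_one_le_left (norm_nonneg (S.pb (S.Δ y))) hε1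
    linarith
  obtain ⟨γ, hγ0, hγ, hγb⟩ := hfull ε hε (S.Δ y) hΔfast (hΔy.trans hyν')
  have hγp : F.IsPath γ (S.T + θ) :=
    (isPath_of_field (t₁ := S.T + F.θ₀) hγ).mono hθ'
  rw [← hγ0] at hs
  obtain ⟨t, ht, hHt, hσt, hpos⟩ := hcross γ hγp
    (fun t ht => (hγb t (hsub t ht)).1.trans hη₁δ) hs.1
  have ht0 : 0 < t := by linarith [ht.1]
  have htI : t ∈ Icc 0 (S.T + θ) := ⟨ht0.le, ht.2.le⟩
  refine ⟨t, γ, by linarith [ht.1], ?_, ⟨A_subset_U (hγp t htI).1, hHt, hσt⟩,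
    (hγb t (hsub t htI)).2.2 (by linarith [ht.1]), fun s hs' => ?_, fun p hp hpρ => ?_⟩
  · rw [← hγ0]
    exact isArc_full ht0 ht.2.le (fun s hs => hγ s (hsub s hs)) hs hHt hσt hpos
  · have h1 := (hγb s (hsub s ⟨hs'.1, by linarith [hs'.2, ht.2]⟩)).1
    rcases le_or_gt s S.T with h | h
    · refine (infDist_orbit_le (γ s) ⟨hs'.1, h⟩).trans ?_
      rw [← F.ξ_eq s ⟨hs'.1, h⟩]
      linarith
    · -- past the period the solution is still near the end of the orbit
      have hab := (hclose γ F.ξ t S.T η₁ hγp (isPath_ξ.mono hθ')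
        (fun t _ => by simpa using hδ.le)
        (by rw [F.ξ_eq 0 ⟨le_rfl, hT.le⟩]; exact (S.ζ_flow 0 ⟨le_rfl, hT⟩).1) ht
        ⟨by linarith, by linarith⟩ hHt (by rw [hξT]; exact S.ζ_guard.1)
        (fun t ht => (hγb t (hsub t ht)).1)).2
      have h2 : |s - S.T| ≤ |t - S.T| := by
        rw [abs_of_pos (by linarith), abs_of_pos (by linarith [hs'.2])]
        linarith [hs'.2]
      have h3 := hξθ₁ (x := s) (by rw [Real.dist_eq]; linarith)
      rw [dist_eq_norm, hξT] at h3
      refine (infDist_orbit_le (γ s) ⟨hT.le, le_rfl⟩).trans ?_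
      have h4 := norm_sub_le_norm_sub_add_norm_sub (γ s) (S.ι (F.ξ s)) (S.ι (S.ζ S.T))
      linarith
  · have hκ : ∀ s ∈ Icc 0 (S.T + θ), ‖γ s - S.ι (φ p s)‖ ≤
        C₄ * (L * ‖y - S.ι p‖ + η' / C₁ / C₄) := by
      intro s hs''
      refine (hpath (η' / C₁ / C₄) (by positivity) (S.T + θ) hθ' γ _ hγp (hφp p hp hpρ)
        (fun s hs => (hγb s (hsub s hs)).2.1)
        (fun s _ => by simp only [S.pe_ι, S.pb_ι, norm_zero, add_zero]; positivity) s hs'').trans ?_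
      refine mul_le_mul_of_nonneg_left (add_le_add ?_ le_rfl) (by linarith)
      rw [← map_sub, hγ0, hφ0 p hp hpρ]
      have hpρ' : ‖S.ι p - S.ι (S.ζ S.T)‖ ≤ ρ₂ := by
        rw [← map_sub, S.norm_ι]
        exact hpρ.trans hρρ₂
      exact (S.norm_pz_le _).trans (hreset y hy _ hp hyρ₂ hpρ')
    have h1 := (hclose γ (φ p) t (τ p) _ hγp (hφp p hp hpρ) (hφδ p hp hpρ) (hφH p hp hpρ) ht
      (hτ p hp hpρ) hHt (hφG p hp hpρ).2.1 hκ).1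
    refine h1.trans ?_
    have h2 : C₁ * (C₄ * (L * ‖y - S.ι p‖ + η' / C₁ / C₄)) =
        C₁ * (C₄ * L) * ‖y - S.ι p‖ + η' := by
      have : C₄ ≠ 0 := by linarith
      field_simp
    have h3 : 0 ≤ C₁ * (C₄ * L) * η' := by positivity
    rw [h2]
    linarith [norm_nonneg (y - S.ι p)]

end HighGainSystem

/-! ### Exponential stability of the zero dynamics and its return map -/

namespace HighGainSystem

variable {E Z W : Type*} [NormedAddCommGroup E] [InnerProductSpace ℝ E]
    [NormedAddCommGroup Z] [NormedSpace ℝ Z] [NormedAddCommGroup W] [NormedSpace ℝ W]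
    {S : HighGainSystem E Z W}

/-- A point of the guard that is close to the orbit is close to its end point: elsewhere the orbit
stays away from the closure of the guard, by transversality. -/
theorem exists_near_end (S : HighGainSystem E Z W) {δ : ℝ} (hδ : 0 < δ) : ∃ δ' > 0, ∀ p,
    S.ι p ∈ S.guardSet → Metric.infDist p (S.ζ '' Ico 0 S.T) < δ' → ‖p - S.ζ S.T‖ < δ := by
  have hT := S.T_pos
  set Q := S.ζ '' Icc 0 S.T ∩ (Metric.ball (S.ζ S.T) (δ / 2))ᶜ with hQ
  have hQc : IsCompact Q :=
    (isCompact_Icc.image_of_continuousOn S.continuousOn_ζ).inter_right Metric.isOpen_ball.isClosed_compl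
  have hdisj : Disjoint Q (closure {p | S.ι p ∈ S.guardSet}) := by
    rw [disjoint_left]
    rintro x ⟨⟨t, ht, rfl⟩, hx⟩ hcl
    have hU := S.ζ_mem t ht
    have htT : t < S.T := by
      refine lt_of_le_of_ne ht.2 fun h => hx ?_
      rw [h]
      exact Metric.mem_ball_self (by positivity)
    have hιc : ContinuousAt S.ι (S.ζ t) := S.ι.continuous.continuousAt
    have hH := ((S.contDiffOn_H.contDiffAt (S.isOpen_U.mem_nhds hU)).continuousAt.comp hιc).tendsto
    have hσ := ((S.contDiffOn_σ.contDiffAt (S.isOpen_U.mem_nhds hU)).continuousAt.comp hιc).tendsto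
    have hfr := mem_closure_iff_frequently.1 hcl
    have h1 : S.H (S.ι (S.ζ t)) = 0 := by
      by_contra h
      obtain ⟨p, hp, hp'⟩ := (hfr.and_eventually (hH.eventually_ne h)).exists
      exact hp' hp.2.1
    have h2 : S.σ (S.ι (S.ζ t)) ≤ 0 := by
      by_contra! h
      obtain ⟨p, hp, hp'⟩ := (hfr.and_eventually (hσ.eventually_const_lt h)).exists
      exact absurd hp' (not_lt.2 hp.2.2.le)
    exact (S.ζ_flow t ⟨ht.1, htT⟩).2 ⟨h1, lt_of_le_of_ne h2 (S.ζ_transverse t ht h1)⟩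
  obtain ⟨δ₁, hδ₁, hthick⟩ := hdisj.exists_thickenings hQc isClosed_closure
  refine ⟨min δ₁ (δ / 2), lt_min hδ₁ (by positivity), fun p hp hpO => ?_⟩
  have hne : (S.ζ '' Ico 0 S.T).Nonempty := ⟨_, mem_image_of_mem _ ⟨le_rfl, hT⟩⟩
  obtain ⟨x, hx, hpx⟩ := (Metric.infDist_lt_iff hne).1 hpO
  by_cases h : x ∈ Metric.ball (S.ζ S.T) (δ / 2)
  · rw [← dist_eq_norm]
    have h1 := dist_triangle p x (S.ζ S.T)
    have h2 := hpx.trans_le (min_le_right _ _)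
    rw [Metric.mem_ball] at h
    linarith
  · exfalso
    refine disjoint_left.1 hthick (Metric.mem_thickening_iff.2
      ⟨x, ⟨image_mono Ico_subset_Icc_self hx, h⟩, hpx.trans_le (min_le_left _ _)⟩)
      (Metric.self_subset_thickening hδ₁ _ (subset_closure hp))

/-- Exponential stability of the orbit of the zero dynamics, seen at the guard: the iterates of the
return map stay near the end point of the orbit, and come closer after finitely many steps. -/
theorem exists_return_chain {R : Z → Z} {ρ : ℝ} (hρ : 0 < ρ)
    (hR : ∀ p, S.ι p ∈ S.guardSet → ‖p - S.ζ S.T‖ ≤ ρ → S.ι (R p) ∈ S.guardSet ∧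
      ∃ τ φ, S.T / 2 ≤ τ ∧ S.zero.IsArc (S.zero.reset p) τ φ (R p))
    (hLES : S.zero.IsLES (S.ζ '' Ico 0 S.T) (S.ζ S.T)) {δ : ℝ} (hδ : 0 < δ) :
    ∃ δ₁ > 0, δ₁ ≤ δ ∧ ∃ N : ℕ, 0 < N ∧ ∀ p, S.ι p ∈ S.guardSet → ‖p - S.ζ S.T‖ < δ₁ →
      (∀ j, S.ι (R^[j] p) ∈ S.guardSet ∧ ‖R^[j] p - S.ζ S.T‖ < δ) ∧
      ‖R^[N] p - S.ζ S.T‖ < δ₁ / 2 := by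
  have hT := S.T_pos
  obtain ⟨M, r, lam, hM, hr, hlam, hLES⟩ := hLES
  obtain ⟨ρ₂, hρ₂, L, hL, hreset⟩ := S.exists_reset_bound
  have hL0 : 0 < L := by linarith
  obtain ⟨δ', hδ', hnear⟩ := S.exists_near_end (lt_min hδ hρ)
  set δ₁ := min (min r ρ₂) (min (min δ ρ) (δ' / (2 * (M * L)))) with hδ₁
  have hδ₁0 : 0 < δ₁ := lt_min (lt_min hr hρ₂) (lt_min (lt_min hδ hρ) (by positivity))
  have hδ₁r : δ₁ ≤ r := (min_le_left _ _).trans (min_le_left _ _)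
  have hδ₁ρ₂ : δ₁ ≤ ρ₂ := (min_le_left _ _).trans (min_le_right _ _)
  have hδ₁δ : δ₁ ≤ min δ ρ := (min_le_right _ _).trans (min_le_left _ _)
  have hδ₁δ' : M * (L * δ₁) < δ' := by
    have h : δ₁ ≤ δ' / (2 * (M * L)) := (min_le_right _ _).trans (min_le_right _ _)
    rw [le_div_iff₀' (by positivity)] at h
    nlinarith
  obtain ⟨δ'', hδ'', hnear'⟩ := S.exists_near_end (half_pos hδ₁0)
  obtain ⟨N, hN, hNδ⟩ : ∃ N : ℕ, 0 < N ∧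
      M * Real.exp (-lam * (N * (S.T / 2))) * (L * δ₁) < δ'' := by
    have h1 : Tendsto (fun n : ℕ => lam * (S.T / 2) * (n : ℝ)) atTop atTop :=
      tendsto_natCast_atTop_atTop.const_mul_atTop (by positivity)
    have h2 := (Real.tendsto_exp_neg_atTop_nhds_zero.comp h1).const_mul (M * (L * δ₁))
    rw [mul_zero] at h2
    obtain ⟨N, h3, h4⟩ := ((h2.eventually_lt_const hδ'').and (eventually_gt_atTop 0)).exists
    refine ⟨N, h4, ?_⟩
    have h5 : -lam * (N * (S.T / 2)) = -(lam * (S.T / 2) * N) := by ring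
    rw [h5, mul_right_comm]
    exact h3
  refine ⟨δ₁, hδ₁0, hδ₁δ.trans (min_le_left _ _), N, hN, fun p hp hpδ => ?_⟩
  have hpz : p ∈ S.zero.guard := (S.mem_zero_guard p hp.1).2 hp.2
  obtain ⟨⟨w, hw⟩, hdecay⟩ := hLES p ⟨mem_ball_iff_norm.2 (hpδ.trans_le hδ₁r), hpz⟩
  have hdecay := hdecay w hw
  have hD : Metric.infDist (S.zero.reset p) (S.ζ '' Ico 0 S.T) ≤ L * δ₁ := by
    have h0 : S.ζ 0 ∈ S.ζ '' Ico 0 S.T := mem_image_of_mem _ ⟨le_rfl, hT⟩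
    refine (Metric.infDist_le_dist_of_mem h0).trans ?_
    rw [dist_eq_norm, S.ζ_start, S.zero_reset, ← map_sub]
    have hpδ' : ‖S.ι p - S.ι (S.ζ S.T)‖ ≤ δ₁ := by
      rw [← map_sub, S.norm_ι]
      exact hpδ.le
    exact (S.norm_pz_le _).trans ((hreset _ hp _ S.ι_ζ_mem_guardSet (hpδ'.trans hδ₁ρ₂)
      (by simpa using hρ₂.le)).trans (mul_le_mul_of_nonneg_left hpδ' hL0.le))
  -- the solution from `p` runs through the iterates of the return map
  have hbound : ∀ j : ℕ, Metric.infDist (R^[j + 1] p) (S.ζ '' Ico 0 S.T) ≤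
      M * Real.exp (-lam * ((j + 1 : ℕ) * (S.T / 2))) * (L * δ₁) → ‖R^[j + 1] p - S.ζ S.T‖ < min δ ρ ∨
        S.ι (R^[j + 1] p) ∉ S.guardSet := by
    intro j hj
    by_cases hg : S.ι (R^[j + 1] p) ∈ S.guardSet
    · refine Or.inl (hnear _ hg (hj.trans_lt (lt_of_le_of_lt ?_ hδ₁δ')))
      have : Real.exp (-lam * ((j + 1 : ℕ) * (S.T / 2))) ≤ 1 := by
        rw [Real.exp_le_one_iff]
        have : 0 ≤ lam * ((j + 1 : ℕ) * (S.T / 2)) := by positivity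
        linarith
      rw [mul_assoc]
      refine mul_le_mul_of_nonneg_left ?_ hM.le
      exact mul_le_of_le_one_left (by positivity) this
    · exact Or.inr hg
  have key : ∀ j : ℕ, S.ι (R^[j] p) ∈ S.guardSet ∧ ‖R^[j] p - S.ζ S.T‖ < min δ ρ ∧
      (0 < j → Metric.infDist (R^[j] p) (S.ζ '' Ico 0 S.T) ≤
        M * Real.exp (-lam * (j * (S.T / 2))) * (L * δ₁)) ∧
      ∃ s, j * (S.T / 2) ≤ s ∧ S.zero.IsSolution (S.zero.reset (R^[j] p)) fun t => w (s + t) := by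
    intro j
    induction j with
    | zero => exact ⟨hp, hpδ.trans_le hδ₁δ, fun h => absurd h (lt_irrefl _), 0, by simp, by simpa using hw⟩
    | succ j ih =>
      obtain ⟨hg, hn, -, s, hs, hsol⟩ := ih
      obtain ⟨hg', τ, φ, hτ, harc⟩ := hR _ hg (hn.le.trans (min_le_right _ _))
      rw [← Function.iterate_succ_apply' R j p] at hg' harc
      have hs0 : 0 ≤ s := le_trans (by positivity) hs
      have hjs : ((j + 1 : ℕ) : ℝ) * (S.T / 2) ≤ s + τ := by
        push_cast
        linarith
      have hdist : Metric.infDist (R^[j + 1] p) (S.ζ '' Ico 0 S.T) ≤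
          M * Real.exp (-lam * ((j + 1 : ℕ) * (S.T / 2))) * (L * δ₁) := by
        have h1 : Tendsto (fun t => Metric.infDist (φ t) (S.ζ '' Ico 0 S.T)) (𝓝[<] τ)
            (𝓝 (Metric.infDist (R^[j + 1] p) (S.ζ '' Ico 0 S.T))) :=
          ((Metric.continuous_infDist_pt _).tendsto _).comp harc.tendsto
        have h2 : Tendsto (fun t => M * Real.exp (-lam * (s + t)) * (L * δ₁)) (𝓝[<] τ)
            (𝓝 (M * Real.exp (-lam * (s + τ)) * (L * δ₁))) := by
          refine Tendsto.mono_left ?_ nhdsWithin_le_nhds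
          exact Continuous.tendsto (by fun_prop) _
        have h3 : M * Real.exp (-lam * (s + τ)) * (L * δ₁) ≤
            M * Real.exp (-lam * ((j + 1 : ℕ) * (S.T / 2))) * (L * δ₁) := by
          have : -lam * (s + τ) ≤ -lam * ((j + 1 : ℕ) * (S.T / 2)) := by nlinarith
          gcongr
        refine (le_of_tendsto_of_tendsto h1 h2 ?_).trans h3
        filter_upwards [Ioo_mem_nhdsLT harc.pos] with t ht
        rw [← (harc.unique _ hsol).1 t ⟨ht.1.le, ht.2⟩]
        refine (hdecay (s + t) (by linarith [ht.1])).trans ?_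
        exact mul_le_mul_of_nonneg_left hD (by positivity)
      refine ⟨hg', (hbound j hdist).resolve_right (not_not.2 hg'), fun _ => hdist, s + τ, hjs, ?_⟩
      have := harc.isSolution_shift hsol
      simpa only [add_assoc] using this
  refine ⟨fun j => ⟨(key j).1, (key j).2.1.trans_le (min_le_left _ _)⟩, ?_⟩
  exact hnear' _ (key N).1 (((key N).2.2.1 hN).trans_lt hNδ)

/-! ### Practical stability of the full-order system -/

theorem isLEUB_full [FiniteDimensional ℝ E] [FiniteDimensional ℝ W] [CompleteSpace Z]
    (S : HighGainSystem E Z W) (hLES : S.zero.IsLES (S.ζ '' Ico 0 S.T) (S.ζ S.T)) :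
    ∃ k₀ : ℝ, 1 < k₀ ∧ ∀ k, k₀ ≤ k → ∀ d : ℝ, 0 < d → ∃ ε₀ : ℝ, 1 < ε₀ ∧ ∀ ε, ε₀ ≤ ε →
      (S.full ε k).IsLEUB (S.ι '' (S.ζ '' Ico 0 S.T)) (S.ι (S.ζ S.T)) d := by
  have : CompleteSpace W := FiniteDimensional.complete ℝ W
  have hT := S.T_pos
  obtain ⟨F⟩ := S.exists_frame
  obtain ⟨ρ, hρ, C, hC, R, hR, k₀, hk₀, hfull⟩ := F.exists_return_map
  obtain ⟨ρ₃, hρ₃, C₃, hC₃, hproj⟩ := S.exists_guard_projection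
  refine ⟨k₀, hk₀, fun k hk d hd => ?_⟩
  obtain ⟨ν, hν, hfull⟩ := hfull k hk d hd
  obtain ⟨δ₁, hδ₁, hδ₁ρ, N, hN, hchain⟩ := exists_return_chain hρ hR hLES
    (lt_min (lt_min hρ (half_pos hν)) hρ₃)
  set D := max C C₃ with hD
  have hDC : C ≤ D := le_max_left _ _
  have hDC₃ : C₃ ≤ D := le_max_right _ _
  have hD1 : 1 ≤ D := hC.trans hDC
  -- the error of the shadowing orbit after `N` steps is at most `μ`
  set μ := min (δ₁ / 4) (ν / 2) with hμ
  have hμ0 : 0 < μ := lt_min (by positivity) (by positivity)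
  have hμδ : μ ≤ δ₁ / 4 := min_le_left _ _
  have hμν : μ ≤ ν / 2 := min_le_right _ _
  set η := μ / (2 * D) ^ (N + 1) with hη
  have hη0 : 0 < η := by positivity
  have hημ : ∀ j ≤ N, (2 * D) ^ (j + 1) * η ≤ μ := by
    intro j hj
    rw [hη, mul_div_assoc', div_le_iff₀ (by positivity), mul_comm]
    exact mul_le_mul_of_nonneg_left (pow_le_pow_right₀ (by linarith) (by omega)) hμ0.le
  obtain ⟨ν₁, hν₁, ε₀, hε₀, hfull⟩ := hfull η hη0
  refine ⟨max (ε₀ + 1) (ν₁ / η), (by linarith : 1 < ε₀ + 1).trans_le (le_max_left _ _),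
    fun ε hε => ?_⟩
  have hεε₀ : ε₀ ≤ ε := by linarith [(le_max_left _ _).trans hε]
  have hε1 : 1 ≤ ε := hε₀.trans hεε₀
  have hε0 : 0 < ε := by linarith
  have hεη : ν₁ / ε ≤ η := by
    have h := (le_max_right _ _).trans hε
    rw [div_le_iff₀ hη0] at h
    rw [div_le_iff₀ hε0]
    linarith
  have hfull := hfull ε hεε₀
  choose! τ γ hτ harc hguard hfast hinf hshadow using hfull
  set P : W → W := fun y => γ y (τ y) with hP
  -- a set of initial points that `P^[N]` maps to itself
  set Good : W → Prop := fun y => y ∈ S.guardSet ∧ ‖y - S.ι (S.ζ S.T)‖ < 3 / 4 * δ₁ ∧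
    ε * (‖S.pe y‖ + ‖S.pb y‖) ≤ ν₁ with hGood
  set Adm : W → Prop := fun y => y ∈ S.guardSet ∧ ε * (‖S.pe y‖ + ‖S.pb y‖) ≤ ν₁ ∧
    ‖y - S.ι (S.ζ S.T)‖ ≤ ν with hAdm
  have hblock : ∀ y, Good y → (∀ j ≤ N, Adm (P^[j] y)) ∧ Good (P^[N] y) := by
    rintro y ⟨hy, hyδ, hyfast⟩
    have hyρ₃ : ‖y - S.ι (S.ζ S.T)‖ ≤ ρ₃ := by linarith [hδ₁ρ.trans (min_le_right _ _)]
    obtain ⟨p, hp, hyp⟩ := hproj y hy hyρ₃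
    have hyp' : ‖y - S.ι p‖ ≤ D * η := by
      have h1 : ‖S.pe y‖ + ‖S.pb y‖ ≤ η := by
        refine le_trans ?_ hεη
        rwa [le_div_iff₀' hε0]
      exact hyp.trans (mul_le_mul hDC₃ h1 (by positivity) (by linarith))
    have hDη : (2 * D) ^ (0 + 1) * η ≤ μ := hημ 0 (Nat.zero_le _)
    rw [zero_add, pow_one] at hDη
    have hpδ : ‖p - S.ζ S.T‖ < δ₁ := by
      rw [← S.norm_ι, map_sub]
      have h1 := norm_sub_le_norm_sub_add_norm_sub (S.ι p) y (S.ι (S.ζ S.T))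
      rw [norm_sub_rev (S.ι p) y] at h1
      have : 0 ≤ D * η := by positivity
      linarith
    obtain ⟨hall, hlast⟩ := hchain p hp hpδ
    have hj : ∀ j ≤ N, P^[j] y ∈ S.guardSet ∧ ε * (‖S.pe (P^[j] y)‖ + ‖S.pb (P^[j] y)‖) ≤ ν₁ ∧
        ‖P^[j] y - S.ι (R^[j] p)‖ ≤ (2 * D) ^ (j + 1) * η := by
      intro j
      induction j with
      | zero =>
        intro _
        refine ⟨hy, hyfast, hyp'.trans ?_⟩
        rw [zero_add, pow_one]
        have : 0 ≤ D * η := by positivity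
        linarith
      | succ j ih =>
        intro hjN
        obtain ⟨h1, h2, h3⟩ := ih (by omega)
        have h4 : ‖P^[j] y - S.ι (S.ζ S.T)‖ ≤ ν := by
          have h5 := norm_sub_le_norm_sub_add_norm_sub (P^[j] y) (S.ι (R^[j] p)) (S.ι (S.ζ S.T))
          rw [← map_sub S.ι, S.norm_ι] at h5
          have h6 := (hall j).2.trans_le ((min_le_left _ _).trans (min_le_right _ _))
          linarith [hημ j (by omega)]
        have h5 := hshadow _ h1 h2 h4 (R^[j] p) (hall j).1
          ((hall j).2.le.trans ((min_le_left _ _).trans (min_le_left _ _)))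
        simp only [Function.iterate_succ_apply']
        refine ⟨hguard _ h1 h2 h4, hfast _ h1 h2 h4, h5.trans ?_⟩
        have h6 : (1 : ℝ) ≤ (2 * D) ^ (j + 1) := one_le_pow₀ (by linarith)
        have h7 : η ≤ (2 * D) ^ (j + 1) * η := le_mul_of_one_le_left hη0.le h6
        calc C * (‖P^[j] y - S.ι (R^[j] p)‖ + η) ≤ D * ((2 * D) ^ (j + 1) * η +
              (2 * D) ^ (j + 1) * η) :=
              mul_le_mul hDC (add_le_add h3 h7) (by positivity) (by linarith)
          _ = _ := by ring
    refine ⟨fun j hjN => ?_, ?_⟩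
    · obtain ⟨h1, h2, h3⟩ := hj j hjN
      refine ⟨h1, h2, ?_⟩
      have h5 := norm_sub_le_norm_sub_add_norm_sub (P^[j] y) (S.ι (R^[j] p)) (S.ι (S.ζ S.T))
      rw [← map_sub S.ι, S.norm_ι] at h5
      have h6 := (hall j).2.trans_le ((min_le_left _ _).trans (min_le_right _ _))
      linarith [hημ j hjN]
    · obtain ⟨h1, h2, h3⟩ := hj N le_rfl
      refine ⟨h1, ?_, h2⟩
      have h5 := norm_sub_le_norm_sub_add_norm_sub (P^[N] y) (S.ι (R^[N] p)) (S.ι (S.ζ S.T))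
      rw [← map_sub S.ι, S.norm_ι] at h5
      linarith [hημ N le_rfl]
  have hadm : ∀ y, Good y → ∀ j, Adm (P^[j] y) := by
    intro y hy j
    have hmul : ∀ q, Good (P^[N * q] y) := by
      intro q
      induction q with
      | zero => simpa using hy
      | succ q ih =>
        rw [Nat.mul_succ, add_comm, Function.iterate_add_apply]
        exact (hblock _ ih).2
    have h1 := (hblock _ (hmul (j / N))).1 (j % N) (Nat.mod_lt j hN).le
    rwa [← Function.iterate_add_apply, Nat.mod_add_div] at h1
  obtain ⟨ρU, hρU, hballU⟩ := Metric.isOpen_iff.1 S.isOpen_U _ S.ι_ζ_mem_guardSet.1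
  refine ⟨1, min ρU (min (3 / 4 * δ₁) (ν₁ / (2 * ε))), 1, one_pos,
    lt_min hρU (lt_min (by positivity) (by positivity)), one_pos, fun y ⟨hyball, hyguard⟩ => ?_⟩
  have hyU : y ∈ S.U := hballU (Metric.ball_subset_ball (min_le_left _ _) hyball)
  rw [mem_ball_iff_norm] at hyball
  have hy : Good y := by
    refine ⟨⟨hyU, (S.mem_full_guard ε k y hyU).1 hyguard⟩,
      hyball.trans_le ((min_le_right _ _).trans (min_le_left _ _)), ?_⟩
    have h1 := S.norm_pe_le (y - S.ι (S.ζ S.T))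
    have h2 := S.norm_pb_le (y - S.ι (S.ζ S.T))
    rw [map_sub, S.pe_ι, sub_zero] at h1
    rw [map_sub, S.pb_ι, sub_zero] at h2
    have h3 := hyball.trans_le ((min_le_right _ _).trans (min_le_right _ _))
    rw [lt_div_iff₀ (by positivity)] at h3
    nlinarith
  have harcs : ∀ j, (S.full ε k).IsArc ((S.full ε k).reset (P^[j] y)) (τ (P^[j] y)) (γ (P^[j] y))
      (P^[j + 1] y) := by
    intro j
    obtain ⟨h1, h2, h3⟩ := hadm y hy j
    rw [Function.iterate_succ_apply', S.full_reset]
    exact harc _ h1 h2 h3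
  have hτj : ∀ j, S.T / 2 ≤ τ (P^[j] y) := fun j =>
    hτ _ (hadm y hy j).1 (hadm y hy j).2.1 (hadm y hy j).2.2
  refine ⟨HybridSystem.exists_isSolution_of_isArc (y := fun j => P^[j] y) (half_pos hT) hτj harcs,
    fun w hw t ht => ?_⟩
  obtain ⟨j, s, hs, hws⟩ :=
    hw.exists_arc (y := fun j => P^[j] y) (half_pos hT) hτj harcs ht
  have h1 := hinf _ (hadm y hy j).1 (hadm y hy j).2.1 (hadm y hy j).2.2 s hs
  rw [hws]
  have h2 : 0 ≤ 1 * Real.exp (-1 * t) *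
      Metric.infDist ((S.full ε k).reset y) (S.ι '' (S.ζ '' Ico 0 S.T)) :=
    mul_nonneg (by positivity) Metric.infDist_nonneg
  linarith

end HighGainSystem

/-! ### Matrix identities for the output dynamics -/

theorem actB_mul_transpose_add (l m : ℕ) :
    actB l m * (actB l m)ᵀ + actBc l m * (actBc l m)ᵀ = 1 := by
  ext (i | i) (j | j) <;>
    simp [actB, actBc, Matrix.mul_apply, Matrix.one_apply, eq_comm]

theorem transpose_actB_mul_actBc (l m : ℕ) : (actB l m)ᵀ * actBc l m = 0 := by
  simp [actB, actBc, Matrix.transpose_fromRows, Matrix.fromCols_mul_fromRows]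

theorem transpose_actBc_mul_actB (l m : ℕ) : (actBc l m)ᵀ * actB l m = 0 := by
  simp [actB, actBc, Matrix.transpose_fromRows, Matrix.fromCols_mul_fromRows]

theorem transpose_actB_mul_actB (l m : ℕ) : (actB l m)ᵀ * actB l m = 1 := by
  simp [actB, Matrix.transpose_fromRows, Matrix.fromCols_mul_fromRows]

theorem transpose_actBc_mul_actBc (l m : ℕ) : (actBc l m)ᵀ * actBc l m = 1 := by
  simp [actBc, Matrix.transpose_fromRows, Matrix.fromCols_mul_fromRows]

namespace WalkingRobot

variable {l m : ℕ} (S : WalkingRobot l m)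

/-- `(∂e/∂q) D⁻¹ (∂e/∂q)ᵀ`. -/
noncomputable def matM (q : Config l m) : Matrix (Fin m) (Fin m) ℝ :=
  S.outJac q * (S.inertia q)⁻¹ * (S.outJac q)ᵀ

/-- `(∂e/∂q) D⁻¹ B Jᵀ`, through which the PD terms act on the output acceleration. -/
noncomputable def matK (q : Config l m) : Matrix (Fin m) (Fin m) ℝ :=
  S.outJac q * (S.inertia q)⁻¹ * actB l m * (S.outJacA q)ᵀ

theorem outJac_eq (q : Config l m) :
    S.outJac q = Matrix.fromCols (S.outJacU q) (S.outJacA q) :=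
  (Matrix.fromCols_toCols _).symm

theorem outJac_mul_actB (q : Config l m) : S.outJac q * actB l m = S.outJacA q := by
  simp [outJac_eq, actB, Matrix.fromCols_mul_fromRows]

theorem outJac_mul_actBc (q : Config l m) : S.outJac q * actBc l m = S.outJacU q := by
  simp [outJac_eq, actBc, Matrix.fromCols_mul_fromRows]

theorem transpose_actB_mul_jacE (q : Config l m) : (actB l m)ᵀ * S.jacE q = S.outJac q := by
  rw [outJac_eq, actB, jacE, Matrix.transpose_fromRows, Matrix.fromCols_mul_fromBlocks]
  simp

theorem transpose_actBc_mul_jacE (q : Config l m) : (actBc l m)ᵀ * S.jacE q = (actBc l m)ᵀ := by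
  rw [actBc, jacE, Matrix.transpose_fromRows, Matrix.fromCols_mul_fromBlocks]
  simp

variable {S}

theorem isUnit_jacE {q : Config l m} (hJ : IsUnit (S.outJacA q)) : IsUnit (S.jacE q) := by
  rw [Matrix.isUnit_iff_isUnit_det] at hJ ⊢
  rwa [jacE, Matrix.det_fromBlocks_zero₁₂, Matrix.det_one, one_mul]

theorem posDef_matM {q : Config l m} (hq : q ∈ S.configs) (hJ : IsUnit (S.outJacA q)) :
    (S.matM q).PosDef := by
  refine Matrix.PosDef.mul_mul_conjTranspose_same (S.inertia_posDef q hq).inv ?_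
  intro x y hxy
  have h : x ᵥ* S.outJacA q = y ᵥ* S.outJacA q := by
    rw [← S.outJac_mul_actB, ← Matrix.vecMul_vecMul, ← Matrix.vecMul_vecMul]
    exact congrArg (· ᵥ* actB l m) hxy
  exact Matrix.vecMul_injective_of_isUnit hJ h

theorem posDef_inertiaE {q : Config l m} (hq : q ∈ S.configs) (hJ : IsUnit (S.outJacA q)) :
    (S.inertiaE q).PosDef :=
  Matrix.PosDef.conjTranspose_mul_mul_same (S.inertia_posDef q hq)
    (Matrix.mulVec_injective_of_isUnit ((Matrix.isUnit_nonsing_inv_iff (A := S.jacE q)).2 (isUnit_jacE hJ)))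

theorem posDef_transpose_actBc_mul {A : Matrix (Fin l ⊕ Fin m) (Fin l ⊕ Fin m) ℝ} (hA : A.PosDef) :
    ((actBc l m)ᵀ * A * actBc l m).PosDef := by
  refine hA.conjTranspose_mul_mul_same fun x y hxy => ?_
  have : (actBc l m)ᵀ *ᵥ (actBc l m *ᵥ x) = (actBc l m)ᵀ *ᵥ (actBc l m *ᵥ y) :=
    congrArg ((actBc l m)ᵀ *ᵥ ·) hxy
  rwa [Matrix.mulVec_mulVec, Matrix.mulVec_mulVec, transpose_actBc_mul_actBc, Matrix.one_mulVec,
    Matrix.one_mulVec] at this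

/-- The matrix `B_e` is what the control looks like after the output dynamics have been multiplied
with the inertia matrix `matM⁻¹` seen by the outputs. -/
theorem matM_mul_matBe {q : Config l m} (hq : q ∈ S.configs) (hJ : IsUnit (S.outJacA q)) :
    S.matM q * S.matBe q = S.matK q := by
  set D := S.inertia q with hD
  set Je := S.jacE q with hJe
  have hDu : IsUnit D.det := (Matrix.isUnit_iff_isUnit_det _).1 (S.inertia_posDef q hq).isUnit
  have hJu : IsUnit Je.det := (Matrix.isUnit_iff_isUnit_det _).1 (isUnit_jacE hJ)
  set De := S.inertiaE q with hDe
  have hDe' : De = (Je⁻¹)ᵀ * D * Je⁻¹ := rfl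
  set Q := Je * D⁻¹ * Jeᵀ with hQ
  have hQDe : Q * De = 1 := by
    have h1 : Jeᵀ * (Je⁻¹)ᵀ = 1 := by
      rw [← Matrix.transpose_mul, Matrix.nonsing_inv_mul _ hJu, Matrix.transpose_one]
    calc Q * De = Je * D⁻¹ * (Jeᵀ * (Je⁻¹)ᵀ) * D * Je⁻¹ := by
          rw [hQ, hDe']; simp only [Matrix.mul_assoc]
      _ = Je * (D⁻¹ * D) * Je⁻¹ := by rw [h1]; simp only [Matrix.mul_assoc, Matrix.one_mul]
      _ = 1 := by rw [Matrix.nonsing_inv_mul _ hDu, Matrix.mul_one, Matrix.mul_nonsing_inv _ hJu]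
  set B := actB l m with hB
  set Bc := actBc l m with hBc
  set X := Bᵀ * De * Bc with hX
  set Y := Bcᵀ * De * Bc with hY
  have hYu : IsUnit Y.det := (Matrix.isUnit_iff_isUnit_det _).1
    (posDef_transpose_actBc_mul (posDef_inertiaE hq hJ)).isUnit
  have hM : S.matM q = Bᵀ * Q * B := by
    rw [matM, ← S.transpose_actB_mul_jacE, Matrix.transpose_mul, Matrix.transpose_transpose, hQ]
    simp only [Matrix.mul_assoc, hD, hJe, hB]
  -- the lower left block of `Q * De = 1`
  have hMX : S.matM q * X = -(Bᵀ * Q * Bc) * Y := by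
    have h1 : Bᵀ * Q * (B * Bᵀ + Bc * Bcᵀ) * De * Bc = 0 := by
      rw [actB_mul_transpose_add, Matrix.mul_one, Matrix.mul_assoc _ Q, hQDe, Matrix.mul_one,
        transpose_actB_mul_actBc]
    rw [hM, Matrix.neg_mul, ← add_eq_zero_iff_eq_neg, ← h1, hX, hY]
    simp only [Matrix.mul_add, Matrix.add_mul, Matrix.mul_assoc]
  have hMXY : S.matM q * (X * Y⁻¹) = -(Bᵀ * Q * Bc) := by
    rw [← Matrix.mul_assoc, hMX, Matrix.mul_assoc, Matrix.mul_nonsing_inv _ hYu, Matrix.mul_one]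
  have hBJ : B * (S.outJacA q)ᵀ = Jeᵀ * B - Jeᵀ * Bc * (S.outJacU q)ᵀ := by
    have h1 : Jeᵀ * Bc = Bc := by
      have := congrArg Matrix.transpose (S.transpose_actBc_mul_jacE q)
      rwa [Matrix.transpose_mul, Matrix.transpose_transpose] at this
    have h2 : Jeᵀ * B = (S.outJac q)ᵀ := by
      have := congrArg Matrix.transpose (S.transpose_actB_mul_jacE q)
      rwa [Matrix.transpose_mul, Matrix.transpose_transpose] at this
    rw [h1, h2, ← S.outJac_mul_actB, ← S.outJac_mul_actBc, Matrix.transpose_mul,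
      Matrix.transpose_mul, ← Matrix.mul_assoc, ← Matrix.mul_assoc, ← hB, ← hBc, eq_sub_iff_add_eq,
      ← Matrix.add_mul, actB_mul_transpose_add, Matrix.one_mul]
  have hK : S.matK q = Bᵀ * Q * B - Bᵀ * Q * Bc * (S.outJacU q)ᵀ := by
    rw [matK, Matrix.mul_assoc, ← hB, hBJ, ← S.transpose_actB_mul_jacE, hQ]
    simp only [Matrix.mul_sub, Matrix.mul_assoc, hB, hJe, hD]
  have hBe : S.matBe q = 1 + X * Y⁻¹ * (S.outJacU q)ᵀ := rfl
  rw [hBe, Matrix.mul_add, Matrix.mul_one, ← Matrix.mul_assoc (S.matM q), hMXY, hK, hM,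
    Matrix.neg_mul, sub_eq_add_neg]

theorem dotProduct_matBe_pos {q : Config l m} (hΛ : (S.matLambda q).PosDef) {x : Fin m → ℝ}
    (hx : x ≠ 0) : 0 < x ⬝ᵥ S.matBe q *ᵥ x := by
  have h1 : (S.matBe q + (S.matBe q)ᵀ).PosDef := by
    have := hΛ.submatrix (e := (Sum.inl : Fin m → Fin m ⊕ Fin m)) Sum.inl_injective
    exact this
  have h2 := h1.dotProduct_mulVec_pos hx
  rw [star_trivial, Matrix.add_mulVec, dotProduct_add, Matrix.mulVec_transpose,
    dotProduct_comm x (x ᵥ* _), ← Matrix.dotProduct_mulVec] at h2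
  linarith

/-- The matrix `B_e'` is invertible only if `(e, B_cᵀ D q̇)` determines the velocities. -/
theorem eq_zero_of_outJac_mulVec_eq_zero {q : Config l m} (hq : q ∈ S.configs)
    (hJ : IsUnit (S.outJacA q)) (hB : IsUnit (S.matBe' q)) {v : Fin l ⊕ Fin m → ℝ}
    (h1 : S.outJac q *ᵥ v = 0) (h2 : ((actBc l m)ᵀ * S.inertia q) *ᵥ v = 0) : v = 0 := by
  set D := S.inertia q with hD
  have hJu : IsUnit (S.outJacA q).det := (Matrix.isUnit_iff_isUnit_det _).1 hJ
  set Y := (actBc l m)ᵀ * D * actBc l m with hY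
  have hYu : IsUnit Y.det := (Matrix.isUnit_iff_isUnit_det _).1
    (posDef_transpose_actBc_mul (S.inertia_posDef q hq)).isUnit
  obtain ⟨a, b, hv⟩ : ∃ a b, v = actB l m *ᵥ b + actBc l m *ᵥ a := by
    refine ⟨(actBc l m)ᵀ *ᵥ v, (actB l m)ᵀ *ᵥ v, ?_⟩
    rw [Matrix.mulVec_mulVec, Matrix.mulVec_mulVec, ← Matrix.add_mulVec,
      actB_mul_transpose_add, Matrix.one_mulVec]
  have hb' : b = -((S.outJacA q)⁻¹ * S.outJacU q) *ᵥ a := by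
    rw [hv, Matrix.mulVec_add, Matrix.mulVec_mulVec, Matrix.mulVec_mulVec, S.outJac_mul_actB,
      S.outJac_mul_actBc] at h1
    have h3 := congrArg ((S.outJacA q)⁻¹ *ᵥ ·) h1
    simp only [Matrix.mulVec_add, Matrix.mulVec_mulVec, Matrix.nonsing_inv_mul _ hJu,
      Matrix.one_mulVec, Matrix.mulVec_zero] at h3
    rw [Matrix.neg_mulVec]
    exact eq_neg_of_add_eq_zero_left h3
  have ha0 : a = 0 := by
    have h3 : S.matBe' q *ᵥ a = 0 := by
      rw [hv, Matrix.mulVec_add, Matrix.mulVec_mulVec, Matrix.mulVec_mulVec] at h2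
      have h4 := congrArg (Y⁻¹ *ᵥ ·) h2
      simp only [Matrix.mulVec_add, Matrix.mulVec_zero] at h4
      rw [Matrix.mulVec_mulVec (M := Y⁻¹) (N := (actBc l m)ᵀ * D * actBc l m), ← hY,
        Matrix.nonsing_inv_mul _ hYu, Matrix.one_mulVec, hb'] at h4
      rw [matBe', ← hD, ← hY, Matrix.sub_mulVec, Matrix.one_mulVec, ← h4]
      simp only [Matrix.neg_mulVec, Matrix.mulVec_neg, Matrix.mulVec_mulVec, Matrix.mul_assoc]
      abel
    exact Matrix.mulVec_injective_of_isUnit hB (by rw [h3, Matrix.mulVec_zero])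
  rw [hv, hb', ha0]
  simp

end WalkingRobot

/-! ### Smoothness of the model -/

/-- The action of matrices on Euclidean vectors, as a continuous bilinear map. -/
noncomputable def actL (ι κ : Type*) [Fintype ι] [Fintype κ] [DecidableEq κ] :
    Matrix ι κ ℝ →L[ℝ] EuclideanSpace ℝ κ →L[ℝ] EuclideanSpace ℝ ι :=
  (LinearMap.mk₂ ℝ (fun (A : Matrix ι κ ℝ) (v : EuclideanSpace ℝ κ) => act A v)
    (fun A B v => by simp [act, Matrix.add_mulVec])
    (fun c A v => by simp [act, Matrix.smul_mulVec])
    (fun A v w => by simp [act, Matrix.mulVec_add])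
    (fun c A v => by simp [act, Matrix.mulVec_smul])).toContinuousBilinearMap

section Matrix

variable {ι κ μ : Type*} [Fintype ι] [Fintype κ] [DecidableEq κ] [Fintype μ] [DecidableEq μ]

theorem actL_apply (A : Matrix ι κ ℝ) (v : EuclideanSpace ℝ κ) : actL ι κ A v = act A v := rfl

theorem act_mul (A : Matrix ι κ ℝ) (B : Matrix κ μ ℝ) (v : EuclideanSpace ℝ μ) :
    act (A * B) v = act A (act B v) := by
  simp [act, Matrix.mulVec_mulVec]

theorem act_zero (A : Matrix ι κ ℝ) : act A 0 = 0 := by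
  simp [act]

theorem act_sub (A : Matrix ι κ ℝ) (v w : EuclideanSpace ℝ κ) :
    act A (v - w) = act A v - act A w := by
  simp [act, Matrix.mulVec_sub]

theorem act_neg (A : Matrix ι κ ℝ) (v : EuclideanSpace ℝ κ) : act A (-v) = -act A v := by
  simp [act, Matrix.mulVec_neg]

variable {X : Type*} [NormedAddCommGroup X] [NormedSpace ℝ X] {s : Set X} {n : WithTop ℕ∞}

theorem ContDiffOn.act {A : X → Matrix ι κ ℝ} {v : X → EuclideanSpace ℝ κ}
    (hA : ContDiffOn ℝ n A s) (hv : ContDiffOn ℝ n v s) :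
    ContDiffOn ℝ n (fun x => _root_.act (A x) (v x)) s :=
  ((actL ι κ).contDiff.comp_contDiffOn hA).clm_apply hv

theorem ContDiffOn.matrix_mul {A : X → Matrix ι κ ℝ} {B : X → Matrix κ μ ℝ}
    (hA : ContDiffOn ℝ n A s) (hB : ContDiffOn ℝ n B s) :
    ContDiffOn ℝ n (fun x => A x * B x) s := by
  let b : Matrix ι κ ℝ →L[ℝ] Matrix κ μ ℝ →L[ℝ] Matrix ι μ ℝ :=
    (LinearMap.mk₂ ℝ (fun (A : Matrix ι κ ℝ) (B : Matrix κ μ ℝ) => A * B)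
      Matrix.add_mul Matrix.smul_mul Matrix.mul_add
      (fun c A B => Matrix.mul_smul A c B)).toContinuousBilinearMap
  exact (b.contDiff.comp_contDiffOn hA).clm_apply hB

theorem ContDiffOn.toLp_prodMk {G G' : Type*} [NormedAddCommGroup G] [NormedSpace ℝ G]
    [NormedAddCommGroup G'] [NormedSpace ℝ G'] {f : X → G} {g : X → G'} (hf : ContDiffOn ℝ n f s)
    (hg : ContDiffOn ℝ n g s) : ContDiffOn ℝ n (fun x => WithLp.toLp 2 (f x, g x)) s := by
  let e : (G × G') →L[ℝ] WithLp 2 (G × G') := (WithLp.prodContinuousLinearEquiv 2 ℝ G G').symm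
  exact e.contDiff.comp_contDiffOn (hf.prodMk hg)

theorem ContDiffOn.matrix_transpose [DecidableEq ι] {A : X → Matrix ι κ ℝ}
    (hA : ContDiffOn ℝ n A s) : ContDiffOn ℝ n (fun x => (A x)ᵀ) s :=
  (LinearMap.toContinuousLinearMap
    (Matrix.transposeLinearEquiv ι κ ℝ ℝ).toLinearMap).contDiff.comp_contDiffOn hA

theorem ContDiffOn.matrix_inv {A : X → Matrix κ κ ℝ} (hA : ContDiffOn ℝ n A s)
    (h : ∀ x ∈ s, IsUnit (A x)) : ContDiffOn ℝ n (fun x => (A x)⁻¹) s := by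
  intro x hx
  obtain ⟨u, hu⟩ := h x hx
  simp only [Matrix.nonsing_inv_eq_ringInverse]
  have := contDiffAt_ringInverse (n := n) ℝ u
  rw [hu] at this
  exact this.comp_contDiffWithinAt x (hA x hx)

end Matrix

/-- `unactPart` as a continuous linear map. -/
noncomputable def unactL (l m : ℕ) : Config l m →L[ℝ] EuclideanSpace ℝ (Fin l) :=
  actL _ _ (actBc l m)ᵀ

/-- `actPart` as a continuous linear map. -/
noncomputable def actPartL (l m : ℕ) : Config l m →L[ℝ] EuclideanSpace ℝ (Fin m) :=
  actL _ _ (actB l m)ᵀ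

theorem unactL_apply {l m : ℕ} (q : Config l m) : unactL l m q = unactPart q := by
  ext i
  simp [unactL, actL_apply, act, actBc, unactPart, Matrix.transpose_fromRows, Matrix.mulVec,
    dotProduct, Matrix.one_apply]

theorem actPartL_apply {l m : ℕ} (q : Config l m) : actPartL l m q = actPart q := by
  ext i
  simp [actPartL, actL_apply, act, actB, actPart, Matrix.transpose_fromRows, Matrix.mulVec,
    dotProduct, Matrix.one_apply]

namespace WalkingRobot

variable {l m : ℕ} (S : WalkingRobot l m)

theorem isOpen_states : IsOpen (S.configs ×ˢ (univ : Set (Config l m))) :=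
  S.isOpen_configs.prod isOpen_univ

theorem mapsTo_fst_states : MapsTo Prod.fst (S.configs ×ˢ (univ : Set (Config l m))) S.configs :=
  fun _ hx => hx.1

/-- The map `(q, v) ↦ DF(q) v` has one derivative less than `F`. -/
theorem contDiffOn_fderiv_apply {G : Type*} [NormedAddCommGroup G] [NormedSpace ℝ G]
    {F : Config l m → G} {n k : WithTop ℕ∞} (hF : ContDiffOn ℝ n F S.configs) (hk : k + 1 ≤ n) :
    ContDiffOn ℝ k (fun x : State l m => fderiv ℝ F x.1 x.2) (S.configs ×ˢ univ) :=
  ((hF.fderiv_of_isOpen S.isOpen_configs hk).comp contDiffOn_fst S.mapsTo_fst_states).clm_apply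
    contDiffOn_snd

theorem contDiffOn_out : ContDiffOn ℝ 3 S.out S.configs := by
  have h : S.out = fun q => actPartL l m q - S.desired (S.phase q) := by
    funext q
    rw [actPartL_apply, out]
  rw [h]
  exact (actPartL l m).contDiff.contDiffOn.sub (S.contDiff_desired.comp_contDiffOn S.contDiffOn_phase)

theorem differentiableAt_out {q : Config l m} (hq : q ∈ S.configs) :
    DifferentiableAt ℝ S.out q :=
  (S.contDiffOn_out.contDiffAt (S.isOpen_configs.mem_nhds hq)).differentiableAt (by norm_num)

theorem contDiffOn_outVel : ContDiffOn ℝ 2 S.outVel (S.configs ×ˢ univ) :=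
  S.contDiffOn_fderiv_apply S.contDiffOn_out (by norm_num)

theorem act_outJac (q v : Config l m) : act (S.outJac q) v = fderiv ℝ S.out q v := by
  have hv : v = ∑ j, v j • EuclideanSpace.single j (1 : ℝ) := by
    ext (i | i) <;> simp [Finset.sum_apply, Pi.single_apply]
  conv_rhs => rw [hv]
  ext i
  simp [act, outJac, Matrix.mulVec, dotProduct, mul_comm]

theorem contDiffOn_outJac : ContDiffOn ℝ 2 S.outJac S.configs :=
  (LinearMap.toContinuousLinearMap (
    { toFun := fun A => Matrix.of fun i j => A (EuclideanSpace.single j (1 : ℝ)) i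
      map_add' := fun A B => by ext; simp
      map_smul' := fun c A => by ext; simp } :
      (Config l m →L[ℝ] EuclideanSpace ℝ (Fin m)) →ₗ[ℝ]
        Matrix (Fin m) (Fin l ⊕ Fin m) ℝ)).contDiff.comp_contDiffOn
    (S.contDiffOn_out.fderiv_of_isOpen S.isOpen_configs (by norm_num))

theorem contDiffOn_outJacA : ContDiffOn ℝ 2 S.outJacA S.configs := by
  have h : S.outJacA = fun q => S.outJac q * actB l m := by
    funext q
    rw [S.outJac_mul_actB]
  rw [h]
  exact S.contDiffOn_outJac.matrix_mul contDiffOn_const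

theorem contDiffOn_inertia_inv : ContDiffOn ℝ 2 (fun q => (S.inertia q)⁻¹) S.configs :=
  S.contDiffOn_inertia.matrix_inv fun q hq => (S.inertia_posDef q hq).isUnit

theorem contDiffOn_drift : ContDiffOn ℝ 1 S.drift (S.configs ×ˢ univ) :=
  contDiffOn_snd.prodMk (((S.contDiffOn_inertia_inv.of_le (by norm_num)).comp contDiffOn_fst
    S.mapsTo_fst_states).act (((S.contDiffOn_coriolis.act contDiffOn_snd).neg).sub
      (S.contDiffOn_gravity.comp contDiffOn_fst S.mapsTo_fst_states)))

theorem contDiffOn_pdControl (kp kd : ℝ) :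
    ContDiffOn ℝ 1 (S.pdControl kp kd) (S.configs ×ˢ univ) := by
  have hJ : ContDiffOn ℝ 1 (fun x : State l m => (S.outJacA x.1)ᵀ) (S.configs ×ˢ univ) :=
    ((S.contDiffOn_outJacA.of_le (by norm_num)).comp contDiffOn_fst
      S.mapsTo_fst_states).matrix_transpose
  exact (hJ.act (((S.contDiffOn_out.of_le (by norm_num)).comp contDiffOn_fst
    S.mapsTo_fst_states).const_smul kp)).neg.sub
    (hJ.act ((S.contDiffOn_outVel.of_le (by norm_num)).const_smul kd))

theorem contDiffOn_closedField (kp kd : ℝ) :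
    ContDiffOn ℝ 1 (S.closedField kp kd) (S.configs ×ˢ univ) :=
  S.contDiffOn_drift.add (contDiffOn_const.prodMk
    (((S.contDiffOn_inertia_inv.of_le (by norm_num)).comp contDiffOn_fst
      S.mapsTo_fst_states).act (contDiffOn_const.act (S.contDiffOn_pdControl kp kd))))

theorem contDiffOn_zeroCoord : ContDiffOn ℝ 2 S.zeroCoord (S.configs ×ˢ univ) := by
  have h : S.zeroCoord = fun x => WithLp.toLp 2 (unactL l m x.1,
      act ((actBc l m)ᵀ * S.inertia x.1) x.2) := by
    funext x
    rw [unactL_apply, zeroCoord]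
  rw [h]
  exact ContDiffOn.toLp_prodMk ((unactL l m).contDiff.comp_contDiffOn contDiffOn_fst)
      ((contDiffOn_const.matrix_mul (S.contDiffOn_inertia.comp contDiffOn_fst
        S.mapsTo_fst_states)).act contDiffOn_snd)

theorem contDiffOn_passiveField : ContDiffOn ℝ 1 S.passiveField (S.configs ×ˢ univ) := by
  have h : S.passiveField = fun x => WithLp.toLp 2 (unactL l m x.2,
      act (actBc l m)ᵀ (act (fderiv ℝ S.inertia x.1 x.2) x.2 - act (S.coriolis x.1 x.2) x.2 -
        S.gravity x.1)) := by
    funext x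
    rw [unactL_apply, passiveField]
  rw [h]
  exact ContDiffOn.toLp_prodMk ((unactL l m).contDiff.comp_contDiffOn contDiffOn_snd)
      (contDiffOn_const.act ((((S.contDiffOn_fderiv_apply S.contDiffOn_inertia
        (by norm_num)).act contDiffOn_snd).sub (S.contDiffOn_coriolis.act contDiffOn_snd)).sub
        (S.contDiffOn_gravity.comp contDiffOn_fst S.mapsTo_fst_states)))

theorem contDiffOn_trans : ContDiffOn ℝ 2 S.trans (S.configs ×ˢ univ) :=
  ((((S.contDiffOn_out.of_le (by norm_num)).comp contDiffOn_fst
    S.mapsTo_fst_states).toLp_prodMk S.contDiffOn_outVel).toLp_prodMk S.contDiffOn_zeroCoord)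

end WalkingRobot

/-! ### The coordinate change -/

/-- The output coordinate `e` of `(e, ė, z)`. -/
noncomputable def transOut (l m : ℕ) : TransSpace l m →L[ℝ] EuclideanSpace ℝ (Fin m) :=
  (WithLp.fstL 2 ℝ (EuclideanSpace ℝ (Fin m)) (EuclideanSpace ℝ (Fin m))).comp
    (WithLp.fstL 2 ℝ (OutSpace m) (ZeroSpace l))

/-- The output velocity coordinate `ė` of `(e, ė, z)`. -/
noncomputable def transVel (l m : ℕ) : TransSpace l m →L[ℝ] EuclideanSpace ℝ (Fin m) :=
  (WithLp.sndL 2 ℝ (EuclideanSpace ℝ (Fin m)) (EuclideanSpace ℝ (Fin m))).comp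
    (WithLp.fstL 2 ℝ (OutSpace m) (ZeroSpace l))

/-- The zero coordinates `z` of `(e, ė, z)`. -/
noncomputable def transZero (l m : ℕ) : TransSpace l m →L[ℝ] ZeroSpace l :=
  WithLp.sndL 2 ℝ (OutSpace m) (ZeroSpace l)

/-- The first half of the zero coordinates. -/
noncomputable def zeroFst (l : ℕ) : ZeroSpace l →L[ℝ] EuclideanSpace ℝ (Fin l) :=
  WithLp.fstL 2 ℝ (EuclideanSpace ℝ (Fin l)) (EuclideanSpace ℝ (Fin l))

/-- The second half of the zero coordinates. -/
noncomputable def zeroSnd (l : ℕ) : ZeroSpace l →L[ℝ] EuclideanSpace ℝ (Fin l) :=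
  WithLp.sndL 2 ℝ (EuclideanSpace ℝ (Fin l)) (EuclideanSpace ℝ (Fin l))

theorem TransSpace.ext {l m : ℕ} {w w' : TransSpace l m} (h1 : transOut l m w = transOut l m w')
    (h2 : transVel l m w = transVel l m w')
    (h3 : zeroFst l (transZero l m w) = zeroFst l (transZero l m w'))
    (h4 : zeroSnd l (transZero l m w) = zeroSnd l (transZero l m w')) : w = w' := by
  obtain ⟨⟨⟨a, b⟩⟩, ⟨⟨c, d⟩⟩⟩ := w
  obtain ⟨⟨⟨a', b'⟩⟩, ⟨⟨c', d'⟩⟩⟩ := w'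
  have e1 : a = a' := h1
  have e2 : b = b' := h2
  have e3 : c = c' := h3
  have e4 : d = d' := h4
  rw [e1, e2, e3, e4]

theorem Config.ext_parts {l m : ℕ} {q q' : Config l m} (h1 : unactL l m q = unactL l m q')
    (h2 : actPartL l m q = actPartL l m q') : q = q' := by
  rw [unactL_apply, unactL_apply] at h1
  rw [actPartL_apply, actPartL_apply] at h2
  ext (i | i)
  · exact congrArg (fun v => v.ofLp i) h1
  · exact congrArg (fun v => v.ofLp i) h2

namespace WalkingRobot

variable {l m : ℕ} {S : WalkingRobot l m} {N : Set (Config l m)}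

theorem transZero_trans (x : State l m) : transZero l m (S.trans x) = S.zeroCoord x := rfl

theorem zeroFst_zeroCoord (x : State l m) : zeroFst l (S.zeroCoord x) = unactL l m x.1 := by
  rw [unactL_apply]
  rfl

theorem unactL_outChart (q : Config l m) : unactL l m (S.outChart q) = unactL l m q := by
  rw [unactL_apply, unactL_apply]
  rfl

theorem actPartL_outChart (q : Config l m) : actPartL l m (S.outChart q) = S.out q := by
  rw [actPartL_apply]
  rfl

/-- `J_e` is injective where `(qᵘ, e)` is a local diffeomorphism. -/
theorem eq_zero_of_fderiv_out_eq_zero (hdiffeo : S.OutputsDiffeo N) {q : Config l m} (hq : q ∈ N)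
    (hqS : q ∈ S.configs) {v : Config l m} (h1 : unactL l m v = 0) (h2 : fderiv ℝ S.out q v = 0) :
    v = 0 := by
  have hloc := hdiffeo.2 ⟨q, hq⟩
  have hd : HasFDerivAt S.outChart (fderiv ℝ S.outChart q) q :=
    (hloc.mdifferentiableAt (by norm_num)).differentiableAt.hasFDerivAt
  have hinj : Function.Injective (fderiv ℝ S.outChart q) := by
    have h := (hloc.mfderivToContinuousLinearEquiv (by norm_num)).injective
    intro x y hxy
    refine h ?_
    have hcoe := hloc.mfderivToContinuousLinearEquiv_coe (by norm_num)
    rw [mfderiv_eq_fderiv] at hcoe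
    have hx : ∀ x, hloc.mfderivToContinuousLinearEquiv (by norm_num) x = fderiv ℝ S.outChart q x :=
      fun x => congrArg (fun L : Config l m →L[ℝ] Config l m => L x) hcoe
    exact (hx x).trans (hxy.trans (hx y).symm)
  have e1 : unactL l m (fderiv ℝ S.outChart q v) = unactL l m v := by
    have h3 := (unactL l m).hasFDerivAt.comp q hd
    have h4 : (unactL l m : Config l m → _) ∘ S.outChart = unactL l m :=
      funext fun q => unactL_outChart q
    rw [h4] at h3
    exact congrArg (fun L => L v) (h3.unique (unactL l m).hasFDerivAt)
  have e2 : actPartL l m (fderiv ℝ S.outChart q v) = fderiv ℝ S.out q v := by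
    have h3 := (actPartL l m).hasFDerivAt.comp q hd
    have h4 : (actPartL l m : Config l m → _) ∘ S.outChart = S.out :=
      funext fun q => actPartL_outChart q
    rw [h4] at h3
    exact congrArg (fun L => L v) (h3.unique (S.differentiableAt_out hqS).hasFDerivAt)
  refine hinj ?_
  rw [map_zero]
  refine Config.ext_parts ?_ ?_
  · rw [e1, h1, map_zero]
  · rw [e2, h2, map_zero]

theorem isUnit_outJacA (hdiffeo : S.OutputsDiffeo N) {q : Config l m} (hq : q ∈ N)
    (hqS : q ∈ S.configs) : IsUnit (S.outJacA q) := by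
  rw [← Matrix.mulVec_injective_iff_isUnit]
  rw [← Matrix.coe_mulVecLin, injective_iff_map_eq_zero]
  intro a ha
  rw [Matrix.coe_mulVecLin] at ha
  have h : act (actB l m) (WithLp.toLp 2 a) = 0 := by
    refine eq_zero_of_fderiv_out_eq_zero hdiffeo hq hqS ?_ ?_
    · rw [unactL, actL_apply, ← act_mul, transpose_actBc_mul_actB]
      simp [act]
    · rw [← S.act_outJac, ← act_mul, S.outJac_mul_actB]
      simp [act, ha]
  have h2 := congrArg (act (actB l m)ᵀ) h
  rw [← act_mul, transpose_actB_mul_actB, act_zero] at h2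
  simpa [act] using h2

theorem eq_zero_of_act_eq_zero (hdiffeo : S.OutputsDiffeo N) (hsmall : S.OutputsSmallVariation N)
    {q : Config l m} (hq : q ∈ N) (hqS : q ∈ S.configs) {v : Config l m}
    (h1 : fderiv ℝ S.out q v = 0) (h2 : act ((actBc l m)ᵀ * S.inertia q) v = 0) : v = 0 := by
  rw [← S.act_outJac] at h1
  have h := eq_zero_of_outJac_mulVec_eq_zero hqS (isUnit_outJacA hdiffeo hq hqS) (hsmall q hq).1
    (v := v.ofLp) (congrArg WithLp.ofLp h1) (congrArg WithLp.ofLp h2)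
  exact WithLp.ofLp_injective 2 h

theorem injOn_trans (hNS : N ⊆ S.configs) (hdiffeo : S.OutputsDiffeo N)
    (hsmall : S.OutputsSmallVariation N) : InjOn S.trans (N ×ˢ univ) := by
  rintro ⟨q, v⟩ ⟨hq, -⟩ ⟨q', v'⟩ ⟨hq', -⟩ h
  have h1 : S.out q = S.out q' := congrArg (transOut l m) h
  have h2 : unactL l m q = unactL l m q' := by
    rw [← S.zeroFst_zeroCoord (q, v), ← S.zeroFst_zeroCoord (q', v')]
    exact congrArg (fun w => zeroFst l (transZero l m w)) h
  obtain rfl : q = q' := by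
    refine hdiffeo.1 hq hq' (Config.ext_parts ?_ ?_)
    · rw [unactL_outChart, unactL_outChart, h2]
    · rw [actPartL_outChart, actPartL_outChart, h1]
  have h3 : fderiv ℝ S.out q v = fderiv ℝ S.out q v' := congrArg (transVel l m) h
  have h4 : act ((actBc l m)ᵀ * S.inertia q) v = act ((actBc l m)ᵀ * S.inertia q) v' :=
    congrArg (fun w => zeroSnd l (transZero l m w)) h
  have h5 : v - v' = 0 := by
    refine eq_zero_of_act_eq_zero hdiffeo hsmall hq (hNS hq) ?_ ?_
    · rw [map_sub, h3, sub_self]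
    · rw [act_sub, h4, sub_self]
  rw [sub_eq_zero.1 h5]

theorem contDiffAt_trans {x : State l m} (hx : x.1 ∈ S.configs) : ContDiffAt ℝ 2 S.trans x :=
  S.contDiffOn_trans.contDiffAt (S.isOpen_states.mem_nhds ⟨hx, mem_univ _⟩)

theorem fderiv_trans_injective (hNS : N ⊆ S.configs) (hdiffeo : S.OutputsDiffeo N)
    (hsmall : S.OutputsSmallVariation N) {x : State l m} (hx : x.1 ∈ N) :
    Function.Injective (fderiv ℝ S.trans x) := by
  have hd : HasFDerivAt S.trans (fderiv ℝ S.trans x) x :=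
    ((contDiffAt_trans (hNS hx)).differentiableAt (by norm_num)).hasFDerivAt
  rw [injective_iff_map_eq_zero]
  rintro ⟨δ, ν⟩ h
  have h1 : fderiv ℝ S.out x.1 δ = 0 := by
    have h3 := (transOut l m).hasFDerivAt.comp x hd
    have h4 := (S.differentiableAt_out (hNS hx)).hasFDerivAt.comp x hasFDerivAt_fst
    have h5 := congrArg (fun L => L (δ, ν)) (h4.unique h3)
    simpa [h] using h5
  have h2 : unactL l m δ = 0 := by
    have h3 := ((zeroFst l).comp (transZero l m)).hasFDerivAt.comp x hd
    have h4 : HasFDerivAt (fun x : State l m => unactL l m x.1) _ x :=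
      (unactL l m).hasFDerivAt.comp x hasFDerivAt_fst
    have h6 : (((zeroFst l).comp (transZero l m) : _ →L[ℝ] _) : TransSpace l m → _) ∘ S.trans =
        fun x : State l m => unactL l m x.1 := funext fun x => S.zeroFst_zeroCoord x
    rw [h6] at h3
    have h5 := congrArg (fun L => L (δ, ν)) (h4.unique h3)
    simpa [h] using h5
  obtain rfl : δ = 0 := eq_zero_of_fderiv_out_eq_zero hdiffeo hx (hNS hx) h2 h1
  -- the coordinate change is linear in the velocities
  have hv : HasFDerivAt (fun v : Config l m => (x.1, v)) _ x.2 := hasFDerivAt_prodMk_right (𝕜 := ℝ) x.1 x.2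
  have h3 : fderiv ℝ S.out x.1 ν = 0 := by
    have h4 := ((transVel l m).hasFDerivAt.comp x hd).comp x.2 hv
    have h5 : ((transVel l m : TransSpace l m → _) ∘ S.trans) ∘ (fun v : Config l m => (x.1, v)) =
        fderiv ℝ S.out x.1 := rfl
    rw [h5] at h4
    have h6 := congrArg (fun L => L ν) ((fderiv ℝ S.out x.1).hasFDerivAt.unique h4)
    simpa [h] using h6
  have h4 : act ((actBc l m)ᵀ * S.inertia x.1) ν = 0 := by
    have h4 := (((zeroSnd l).comp (transZero l m)).hasFDerivAt.comp x hd).comp x.2 hv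
    have h5 : ((((zeroSnd l).comp (transZero l m) : _ →L[ℝ] _) : TransSpace l m → _) ∘ S.trans) ∘
        (fun v : Config l m => (x.1, v)) = actL _ _ ((actBc l m)ᵀ * S.inertia x.1) := rfl
    rw [h5] at h4
    have h6 := congrArg (fun L => L ν)
      ((actL _ _ ((actBc l m)ᵀ * S.inertia x.1)).hasFDerivAt.unique h4)
    simpa [h, actL_apply] using h6
  rw [eq_zero_of_act_eq_zero hdiffeo hsmall hx (hNS hx) h3 h4]
  rfl

theorem finrank_state (l m : ℕ) :
    Module.finrank ℝ (State l m) = Module.finrank ℝ (TransSpace l m) := by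
  have h1 : ∀ k, Module.finrank ℝ (WithLp 2 (EuclideanSpace ℝ (Fin k) × EuclideanSpace ℝ (Fin k))) =
      k + k := by
    intro k
    rw [(WithLp.linearEquiv 2 ℝ (EuclideanSpace ℝ (Fin k) × EuclideanSpace ℝ (Fin k))).finrank_eq]
    simp
  rw [(WithLp.linearEquiv 2 ℝ (OutSpace m × ZeroSpace l)).finrank_eq, Module.finrank_prod,
    Module.finrank_prod, h1 m, h1 l, finrank_euclideanSpace, Fintype.card_sum, Fintype.card_fin,
    Fintype.card_fin]
  ring

theorem exists_hasFDerivAt_trans (hNS : N ⊆ S.configs) (hdiffeo : S.OutputsDiffeo N)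
    (hsmall : S.OutputsSmallVariation N) {x : State l m} (hx : x.1 ∈ N) :
    ∃ L : State l m ≃L[ℝ] TransSpace l m, HasFDerivAt S.trans (L : State l m →L[ℝ] _) x := by
  have hd : HasFDerivAt S.trans (fderiv ℝ S.trans x) x :=
    ((contDiffAt_trans (hNS hx)).differentiableAt (by norm_num)).hasFDerivAt
  have hinj := fderiv_trans_injective hNS hdiffeo hsmall hx
  have hsurj : Function.Surjective (fderiv ℝ S.trans x) :=
    (LinearMap.injective_iff_surjective_of_finrank_eq_finrank (finrank_state l m)
      (f := (fderiv ℝ S.trans x).toLinearMap)).1 hinj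
  refine ⟨ContinuousLinearEquiv.ofBijective (fderiv ℝ S.trans x)
    (LinearMap.ker_eq_bot.2 hinj) (LinearMap.range_eq_top.2 hsurj), ?_⟩
  rwa [ContinuousLinearEquiv.coe_ofBijective]

theorem transInv_trans (hinj : InjOn S.trans (N ×ˢ univ)) {x : State l m} (hx : x.1 ∈ N) :
    S.transInv N (S.trans x) = x :=
  hinj.leftInvOn_invFunOn ⟨hx, mem_univ _⟩

variable {O : Set (Config l m)}

theorem isOpen_image_trans (hNS : N ⊆ S.configs) (hdiffeo : S.OutputsDiffeo N)
    (hsmall : S.OutputsSmallVariation N) (hO : IsOpen O) (hON : O ⊆ N) :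
    IsOpen (S.trans '' (O ×ˢ univ)) := by
  rw [isOpen_iff_mem_nhds]
  rintro _ ⟨x, hx, rfl⟩
  obtain ⟨L, hL⟩ := exists_hasFDerivAt_trans hNS hdiffeo hsmall (hON hx.1)
  have h := ((contDiffAt_trans (hNS (hON hx.1))).hasStrictFDerivAt' hL
    (by norm_num)).map_nhds_eq_of_equiv
  rw [← h]
  exact image_mem_map ((hO.prod isOpen_univ).mem_nhds hx)

theorem contDiffOn_transInv (hNS : N ⊆ S.configs) (hdiffeo : S.OutputsDiffeo N)
    (hsmall : S.OutputsSmallVariation N) (hO : IsOpen O) (hON : O ⊆ N) :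
    ContDiffOn ℝ 2 (S.transInv N) (S.trans '' (O ×ˢ univ)) := by
  rintro _ ⟨x, hx, rfl⟩
  obtain ⟨L, hL⟩ := exists_hasFDerivAt_trans hNS hdiffeo hsmall (hON hx.1)
  have hC := contDiffAt_trans (hNS (hON hx.1))
  have h2 : (2 : WithTop ℕ∞) ≠ 0 := by norm_num
  have hg := hC.to_localInverse hL h2
  have hcont : ContinuousAt (hC.localInverse hL h2) (S.trans x) := hg.continuousAt
  have hgx : hC.localInverse hL h2 (S.trans x) = x := hC.localInverse_apply_image hL h2
  have hright : ∀ᶠ w in 𝓝 (S.trans x), S.trans (hC.localInverse hL h2 w) = w :=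
    (hC.hasStrictFDerivAt' hL h2).eventually_right_inverse
  have hmem : ∀ᶠ w in 𝓝 (S.trans x), hC.localInverse hL h2 w ∈ O ×ˢ (univ : Set (Config l m)) := by
    refine hcont.eventually_mem ?_
    rw [hgx]
    exact (hO.prod isOpen_univ).mem_nhds hx
  refine (hg.congr_of_eventuallyEq ?_).contDiffWithinAt
  filter_upwards [hright, hmem] with w h3 h4
  conv_lhs => rw [← h3]
  exact transInv_trans (injOn_trans hNS hdiffeo hsmall) (hON h4.1)

end WalkingRobot

/-! ### The robot in normal form -/

/-- The embedding `zeroEmbed` as a continuous linear map. -/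
noncomputable def zeroEmbedL (l m : ℕ) : ZeroSpace l →L[ℝ] TransSpace l m :=
  ((WithLp.prodContinuousLinearEquiv 2 ℝ (OutSpace m) (ZeroSpace l)).symm :
    OutSpace m × ZeroSpace l →L[ℝ] TransSpace l m).comp
    (ContinuousLinearMap.inr ℝ (OutSpace m) (ZeroSpace l))

theorem zeroEmbedL_apply {l m : ℕ} (z : ZeroSpace l) : zeroEmbedL l m z = zeroEmbed l m z := rfl

theorem norm_le_norm_fst_add_norm_snd {G G' : Type*} [NormedAddCommGroup G]
    [NormedAddCommGroup G'] (x : WithLp 2 (G × G')) : ‖x‖ ≤ ‖x.fst‖ + ‖x.snd‖ := by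
  rw [WithLp.prod_norm_eq_of_L2]
  refine Real.sqrt_le_iff.2 ⟨by positivity, ?_⟩
  nlinarith [mul_nonneg (norm_nonneg x.fst) (norm_nonneg x.snd)]

section Chain

variable {X Y G : Type*} [NormedAddCommGroup X] [NormedSpace ℝ X] [NormedAddCommGroup Y]
  [NormedSpace ℝ Y] [NormedAddCommGroup G] [NormedSpace ℝ G] {f : X → Y} {f' : X →L[ℝ] Y} {x : X}
  {g : Y → G} {g' : Y →L[ℝ] G}

theorem HasFDerivAt.fderiv_comp_apply (hg : HasFDerivAt g g' (f x)) (hf : HasFDerivAt f f' x)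
    (η : X) : fderiv ℝ (fun x => g (f x)) x η = g' (f' η) :=
  congrArg (fun L => L η) (hg.comp x hf).fderiv

theorem HasFDerivAt.apply_eq_of_eventuallyEq_comp
    (hg : HasFDerivAt g g' (f x)) (hf : HasFDerivAt f f' x) {Λ : X →L[ℝ] G}
    (h : (Λ : X → G) =ᶠ[𝓝 x] g ∘ f) (η : X) : g' (f' η) = Λ η :=
  congrArg (fun L => L η) (((hg.comp x hf).congr_of_eventuallyEq h).unique Λ.hasFDerivAt)

end Chain

namespace WalkingRobot

variable {l m : ℕ} {S : WalkingRobot l m} {N O : Set (Config l m)} {T : ℝ} {xs : ℝ → State l m}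

variable (S N O T xs) in
/-- A transversal periodic trajectory in an open set `O` of configurations, where `O` lies in a set
`N` on which the outputs are admissible. -/
structure IsRegularOrbit : Prop where
  isOpen : IsOpen O
  subset : O ⊆ N
  subset_configs : N ⊆ S.configs
  diffeo : S.OutputsDiffeo N
  small : S.OutputsSmallVariation N
  invariant : S.HybridInvariant
  periodic : S.IsPeriodicTrajectory N T xs
  transverse : S.IsTransverse T xs
  mem : ∀ t ∈ Icc 0 T, (xs t).1 ∈ O

/-- The derivative of `ė` in the direction of a velocity. -/
theorem fderiv_outVel_zero {x : State l m} (hx : x.1 ∈ S.configs) (ν : Config l m) :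
    fderiv ℝ S.outVel x (0, ν) = fderiv ℝ S.out x.1 ν := by
  have hd : HasFDerivAt S.outVel (fderiv ℝ S.outVel x) x :=
    ((S.contDiffOn_outVel.contDiffAt (S.isOpen_states.mem_nhds ⟨hx, mem_univ _⟩)).differentiableAt
      (by norm_num)).hasFDerivAt
  have h1 := hd.comp x.2 (hasFDerivAt_prodMk_right (𝕜 := ℝ) x.1 x.2)
  have h2 : S.outVel ∘ (fun v : Config l m => (x.1, v)) = fderiv ℝ S.out x.1 := rfl
  rw [h2] at h1
  simpa using (congrArg (fun L => L ν) ((fderiv ℝ S.out x.1).hasFDerivAt.unique h1)).symm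

/-- The output acceleration under PD control. -/
theorem fderiv_outVel_closedField (kp kd : ℝ) {x : State l m} (hx : x.1 ∈ S.configs) :
    fderiv ℝ S.outVel x (S.closedField kp kd x) = fderiv ℝ S.outVel x (S.drift x) -
      actL _ _ (S.matK x.1) (kp • S.out x.1 + kd • S.outVel x) := by
  have h : S.inputTerm x (S.pdControl kp kd x) = (0, -act ((S.inertia x.1)⁻¹ * actB l m *
      (S.outJacA x.1)ᵀ) (kp • S.out x.1 + kd • S.outVel x)) := by
    rw [inputTerm, pdControl, ← neg_add', ← actL_apply (S.outJacA x.1)ᵀ,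
      ← actL_apply (S.outJacA x.1)ᵀ, ← map_add, actL_apply, act_neg, act_neg, ← act_mul, ← act_mul,
      Matrix.mul_assoc]
  rw [closedField, map_add, h, fderiv_outVel_zero hx, map_neg, ← S.act_outJac, ← act_mul,
    sub_eq_add_neg, actL_apply, matK]
  simp only [Matrix.mul_assoc]

theorem contDiffOn_matM : ContDiffOn ℝ 2 S.matM S.configs :=
  (S.contDiffOn_outJac.matrix_mul S.contDiffOn_inertia_inv).matrix_mul
    S.contDiffOn_outJac.matrix_transpose

theorem contDiffOn_matK : ContDiffOn ℝ 2 S.matK S.configs :=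
  ((S.contDiffOn_outJac.matrix_mul S.contDiffOn_inertia_inv).matrix_mul
    contDiffOn_const).matrix_mul S.contDiffOn_outJacA.matrix_transpose

/-- The inertia seen by the outputs. -/
noncomputable def outInertia (S : WalkingRobot l m) (q : Config l m) :
    EuclideanSpace ℝ (Fin m) →L[ℝ] EuclideanSpace ℝ (Fin m) :=
  actL _ _ (S.matM q)⁻¹

namespace IsRegularOrbit

variable (h : S.IsRegularOrbit N O T xs)

include h

theorem injOn : InjOn S.trans (N ×ˢ univ) := injOn_trans h.subset_configs h.diffeo h.small

theorem transInv_trans {x : State l m} (hx : x.1 ∈ N) : S.transInv N (S.trans x) = x :=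
  WalkingRobot.transInv_trans h.injOn hx

theorem transInv_mem {w : TransSpace l m} (hw : w ∈ S.trans '' (O ×ˢ univ)) :
    (S.transInv N w).1 ∈ O := by
  obtain ⟨x, hx, rfl⟩ := hw
  rw [h.transInv_trans (h.subset hx.1)]
  exact hx.1

theorem transInv_mem_configs {w : TransSpace l m} (hw : w ∈ S.trans '' (O ×ˢ univ)) :
    (S.transInv N w).1 ∈ S.configs :=
  h.subset_configs (h.subset (h.transInv_mem hw))

theorem trans_transInv {w : TransSpace l m} (hw : w ∈ S.trans '' (O ×ˢ univ)) :
    S.trans (S.transInv N w) = w := by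
  obtain ⟨x, hx, rfl⟩ := hw
  rw [h.transInv_trans (h.subset hx.1)]

theorem isOpen_image : IsOpen (S.trans '' (O ×ˢ univ)) :=
  isOpen_image_trans h.subset_configs h.diffeo h.small h.isOpen h.subset

theorem contDiffOn_transInv : ContDiffOn ℝ 1 (S.transInv N) (S.trans '' (O ×ˢ univ)) :=
  (WalkingRobot.contDiffOn_transInv h.subset_configs h.diffeo h.small h.isOpen
    h.subset).of_le (by norm_num)

theorem mem_image_iff {w : TransSpace l m} (hw : w ∈ S.trans '' (O ×ˢ univ)) {A : Set (State l m)} :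
    w ∈ S.trans '' (A ∩ N ×ˢ univ) ↔ S.transInv N w ∈ A := by
  constructor
  · rintro ⟨x, hx, rfl⟩
    rw [h.transInv_trans hx.2.1]
    exact hx.1
  · intro hA
    exact ⟨_, ⟨hA, h.subset (h.transInv_mem hw), mem_univ _⟩, h.trans_transInv hw⟩

theorem transOut_eq {w : TransSpace l m} (hw : w ∈ S.trans '' (O ×ˢ univ)) :
    transOut l m w = S.out (S.transInv N w).1 := by
  conv_lhs => rw [← h.trans_transInv hw]
  rfl

theorem transVel_eq {w : TransSpace l m} (hw : w ∈ S.trans '' (O ×ˢ univ)) :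
    transVel l m w = S.outVel (S.transInv N w) := by
  conv_lhs => rw [← h.trans_transInv hw]
  rfl

theorem comp_transInv {G : Type*} [NormedAddCommGroup G] [NormedSpace ℝ G] {F : State l m → G}
    (hF : ContDiffOn ℝ 1 F (S.configs ×ˢ univ)) :
    ContDiffOn ℝ 1 (fun w => F (S.transInv N w)) (S.trans '' (O ×ˢ univ)) :=
  hF.comp h.contDiffOn_transInv fun _ hw => ⟨h.transInv_mem_configs hw, mem_univ _⟩

theorem comp_transInv_fst {G : Type*} [NormedAddCommGroup G] [NormedSpace ℝ G]
    {F : Config l m → G} (hF : ContDiffOn ℝ 1 F O) :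
    ContDiffOn ℝ 1 (fun w => F (S.transInv N w).1) (S.trans '' (O ×ˢ univ)) :=
  hF.comp h.contDiffOn_transInv.fst fun _ hw => h.transInv_mem hw

/-- In every direction in which `(e, z)` moves as prescribed, whatever `ė` does, the configuration
moves with its velocity. -/
theorem fderiv_comp_transInv {G : Type*} [NormedAddCommGroup G] [NormedSpace ℝ G]
    {F : Config l m → G} (hF : ContDiffOn ℝ 1 F O) {w η : TransSpace l m}
    (hw : w ∈ S.trans '' (O ×ˢ univ)) (h1 : transOut l m η = transVel l m w)
    (h2 : transZero l m η = S.passiveField (S.transInv N w)) :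
    fderiv ℝ (fun w => F (S.transInv N w).1) w η =
      fderiv ℝ F (S.transInv N w).1 (S.transInv N w).2 := by
  have hU := h.isOpen_image.mem_nhds hw
  have hq := h.transInv_mem hw
  have hqS := h.transInv_mem_configs hw
  obtain ⟨X, hX⟩ : ∃ X, HasFDerivAt (fun w => (S.transInv N w).1) X w :=
    (h.contDiffOn_transInv.fst.contDiffAt hU).differentiableAt one_ne_zero
  set δ := X η with hδ
  have e1 : fderiv ℝ S.out (S.transInv N w).1 δ = transOut l m η := by
    refine (S.differentiableAt_out hqS).hasFDerivAt.apply_eq_of_eventuallyEq_comp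
      (f := fun w => (S.transInv N w).1) hX ?_ η
    filter_upwards [hU] with w hw
    exact h.transOut_eq hw
  have e2 : unactL l m δ = zeroFst l (transZero l m η) := by
    obtain ⟨Λ, hΛ⟩ : ∃ Λ : TransSpace l m →L[ℝ] EuclideanSpace ℝ (Fin l),
        ∀ w, Λ w = zeroFst l (transZero l m w) := ⟨(zeroFst l).comp (transZero l m), fun _ => rfl⟩
    rw [← hΛ]
    refine (unactL l m).hasFDerivAt.apply_eq_of_eventuallyEq_comp
      (f := fun w => (S.transInv N w).1) hX ?_ η
    filter_upwards [hU] with w hw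
    rw [hΛ, Function.comp_apply, ← S.zeroFst_zeroCoord (S.transInv N w), ← S.transZero_trans,
      h.trans_transInv hw]
  have e3 : zeroFst l (S.passiveField (S.transInv N w)) = unactL l m (S.transInv N w).2 := by
    rw [unactL_apply]
    rfl
  have hδv : δ - (S.transInv N w).2 = 0 := by
    refine eq_zero_of_fderiv_out_eq_zero h.diffeo (h.subset hq) hqS ?_ ?_
    · rw [map_sub, e2, h2, e3, sub_self]
    · rw [map_sub, e1, h1, h.transVel_eq hw, outVel, sub_self]
  have hFd := ((hF.contDiffAt (h.isOpen.mem_nhds hq)).differentiableAt one_ne_zero).hasFDerivAt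
  rw [hFd.fderiv_comp_apply (f := fun w => (S.transInv N w).1) hX η, ← hδ, sub_eq_zero.1 hδv]

theorem isUnit_matM {q : Config l m} (hq : q ∈ O) : IsUnit (S.matM q) :=
  (posDef_matM (h.subset_configs (h.subset hq)) (isUnit_outJacA h.diffeo (h.subset hq)
    (h.subset_configs (h.subset hq)))).isUnit

theorem contDiffOn_outInertia : ContDiffOn ℝ 2 S.outInertia O :=
  (actL (Fin m) (Fin m)).contDiff.comp_contDiffOn
    ((S.contDiffOn_matM.mono (h.subset.trans h.subset_configs)).matrix_inv
      fun _ hq => h.isUnit_matM hq)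

end IsRegularOrbit

end WalkingRobot

/-! ### The orbit and the reset in the output coordinates -/

theorem TransSpace.norm_le_add {l m : ℕ} (w : TransSpace l m) :
    ‖w‖ ≤ ‖transOut l m w‖ + ‖transVel l m w‖ + ‖transZero l m w‖ :=
  (norm_le_norm_fst_add_norm_snd w).trans
    (add_le_add (norm_le_norm_fst_add_norm_snd w.fst) le_rfl)

theorem TransSpace.norm_transOut_le {l m : ℕ} (w : TransSpace l m) : ‖transOut l m w‖ ≤ ‖w‖ :=
  (WithLp.norm_fst_le _ w.fst).trans (WithLp.norm_fst_le _ w)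

theorem TransSpace.norm_transVel_le {l m : ℕ} (w : TransSpace l m) : ‖transVel l m w‖ ≤ ‖w‖ :=
  (WithLp.norm_snd_le _ w.fst).trans (WithLp.norm_fst_le _ w)

namespace WalkingRobot

namespace IsRegularOrbit

variable {l m : ℕ} {S : WalkingRobot l m} {N O : Set (Config l m)} {T : ℝ} {xs : ℝ → State l m}
  (h : S.IsRegularOrbit N O T xs)

include h

theorem trans_xs {t : ℝ} (ht : t ∈ Icc 0 T) :
    S.trans (xs t) = zeroEmbed l m (S.zeroCoord (xs t)) := by
  obtain ⟨-, h1, h2⟩ := h.periodic.2.2.1 t ht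
  exact TransSpace.ext h1 h2 rfl rfl

theorem trans_xs_mem {t : ℝ} (ht : t ∈ Icc 0 T) : S.trans (xs t) ∈ S.trans '' (O ×ˢ univ) :=
  mem_image_of_mem _ ⟨h.mem t ht, mem_univ _⟩

theorem zeroEmbed_mem {t : ℝ} (ht : t ∈ Icc 0 T) :
    zeroEmbed l m (S.zeroCoord (xs t)) ∈ S.trans '' (O ×ˢ univ) := by
  rw [← h.trans_xs ht]
  exact h.trans_xs_mem ht

theorem transInv_zeroEmbed {t : ℝ} (ht : t ∈ Icc 0 T) :
    S.transInv N (zeroEmbed l m (S.zeroCoord (xs t))) = xs t := by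
  rw [← h.trans_xs ht, h.transInv_trans (h.subset (h.mem t ht))]

theorem right_mem : T ∈ Icc 0 T := ⟨h.periodic.1.le, le_rfl⟩

theorem left_mem : (0 : ℝ) ∈ Icc 0 T := ⟨le_rfl, h.periodic.1.le⟩

theorem mem_zeroSurface_iff {z : ZeroSpace l} (hz : zeroEmbed l m z ∈ S.trans '' (O ×ˢ univ)) :
    S.transInv N (zeroEmbed l m z) ∈ S.zeroSurface ↔
      0 ≤ S.height (S.transInv N (zeroEmbed l m z)).1 := by
  have h1 : S.out (S.transInv N (zeroEmbed l m z)).1 = 0 := (h.transOut_eq hz).symm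
  have h2 : S.outVel (S.transInv N (zeroEmbed l m z)) = 0 := (h.transVel_eq hz).symm
  exact ⟨fun hx => hx.1.2, fun hx => ⟨⟨h.transInv_mem_configs hz, hx⟩, h1, h2⟩⟩

theorem mem_guard_iff {w : TransSpace l m} (hw : w ∈ S.trans '' (O ×ˢ univ)) :
    S.transInv N w ∈ S.guard ↔ S.height (S.transInv N w).1 = 0 ∧
      fderiv ℝ S.height (S.transInv N w).1 (S.transInv N w).2 < 0 :=
  ⟨fun hx => hx.2, fun hx => ⟨h.transInv_mem_configs hw, hx⟩⟩

theorem mem_closedLoop_flowSet {kp kd : ℝ} {w : TransSpace l m}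
    (hw : w ∈ S.trans '' (O ×ˢ univ)) :
    w ∈ (S.closedLoop N kp kd).flowSet ↔ 0 ≤ S.height (S.transInv N w).1 ∧
      ¬(S.height (S.transInv N w).1 = 0 ∧
        fderiv ℝ S.height (S.transInv N w).1 (S.transInv N w).2 < 0) := by
  rw [← h.mem_guard_iff hw]
  exact (h.mem_image_iff hw).trans ⟨fun hx => ⟨hx.1.2, hx.2⟩,
    fun hx => ⟨⟨h.transInv_mem_configs hw, hx.1⟩, hx.2⟩⟩

theorem mem_closedLoop_guard {kp kd : ℝ} {w : TransSpace l m}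
    (hw : w ∈ S.trans '' (O ×ˢ univ)) :
    w ∈ (S.closedLoop N kp kd).guard ↔ S.height (S.transInv N w).1 = 0 ∧
        fderiv ℝ S.height (S.transInv N w).1 (S.transInv N w).2 < 0 :=
  (h.mem_image_iff hw).trans (h.mem_guard_iff hw)

theorem mem_zeroDynamics_guard {z : ZeroSpace l}
    (hz : zeroEmbed l m z ∈ S.trans '' (O ×ˢ univ)) :
    z ∈ (S.zeroDynamics N).guard ↔ S.height (S.transInv N (zeroEmbed l m z)).1 = 0 ∧
      fderiv ℝ S.height (S.transInv N (zeroEmbed l m z)).1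
        (S.transInv N (zeroEmbed l m z)).2 < 0 := by
  rw [← h.mem_guard_iff hz]
  exact (h.mem_image_iff hz).trans ⟨fun hx => hx.2,
    fun hx => ⟨(h.mem_zeroSurface_iff hz).2 hx.2.1.ge, hx⟩⟩

theorem mem_zeroDynamics_flowSet {z : ZeroSpace l}
    (hz : zeroEmbed l m z ∈ S.trans '' (O ×ˢ univ)) :
    z ∈ (S.zeroDynamics N).flowSet ↔ 0 ≤ S.height (S.transInv N (zeroEmbed l m z)).1 ∧
      ¬(S.height (S.transInv N (zeroEmbed l m z)).1 = 0 ∧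
        fderiv ℝ S.height (S.transInv N (zeroEmbed l m z)).1
          (S.transInv N (zeroEmbed l m z)).2 < 0) := by
  rw [← h.mem_guard_iff hz, ← h.mem_zeroSurface_iff hz]
  exact (h.mem_image_iff hz).trans ⟨fun hx => ⟨hx.1, fun hg => hx.2 ⟨hx.1, hg⟩⟩,
    fun hx => ⟨hx.1, fun hg => hx.2 hg.2⟩⟩

theorem xs_mem_guard : xs T ∈ S.guard := by
  have h1 := (h.mem_zeroDynamics_guard (h.zeroEmbed_mem h.right_mem)).1 h.periodic.2.2.2.2.2.1
  rw [h.transInv_zeroEmbed h.right_mem] at h1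
  exact ⟨h.subset_configs (h.subset (h.mem T h.right_mem)), h1⟩

theorem transImpact_zeroEmbed :
    S.transImpact N (zeroEmbed l m (S.zeroCoord (xs T))) = S.trans (xs 0) := by
  rw [transImpact, h.transInv_zeroEmbed h.right_mem, ← h.periodic.2.2.2.1]

theorem tendsto_transInv :
    Tendsto (S.transInv N) (𝓝 (zeroEmbed l m (S.zeroCoord (xs T)))) (𝓝 (xs T)) := by
  have h1 := (h.contDiffOn_transInv.contDiffAt
    (h.isOpen_image.mem_nhds (h.zeroEmbed_mem h.right_mem))).continuousAt.tendsto
  rwa [h.transInv_zeroEmbed h.right_mem] at h1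

/-- Impacts from states near the end of the orbit lead near its start. -/
theorem eventually_impact_mem : ∀ᶠ x in 𝓝[S.guard] (xs T), (S.impact x).1 ∈ O := by
  have h1 : ContinuousWithinAt S.impact S.guard (xs T) :=
    S.locallyLipschitzOn_impact.continuousOn _ h.xs_mem_guard
  have h2 : ContinuousWithinAt (fun x => (S.impact x).1) S.guard (xs T) := h1.fst
  refine h2.eventually_mem ?_
  simp only [← h.periodic.2.2.2.1]
  exact h.isOpen.mem_nhds (h.mem 0 h.left_mem)

theorem transImpact_mem : ∀ᶠ w in 𝓝 (zeroEmbed l m (S.zeroCoord (xs T))),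
    w ∈ S.trans '' (O ×ˢ univ) → S.height (S.transInv N w).1 = 0 →
      fderiv ℝ S.height (S.transInv N w).1 (S.transInv N w).2 < 0 →
      0 ≤ S.height (S.transInv N (S.transImpact N w)).1 ∧
        ¬(S.height (S.transInv N (S.transImpact N w)).1 = 0 ∧
          fderiv ℝ S.height (S.transInv N (S.transImpact N w)).1
            (S.transInv N (S.transImpact N w)).2 < 0) := by
  filter_upwards [h.tendsto_transInv.eventually
    (eventually_nhdsWithin_iff.1 h.eventually_impact_mem)] with w hw hwU h1 h2
  have hg : S.transInv N w ∈ S.guard := ⟨h.transInv_mem_configs hwU, h1, h2⟩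
  rw [transImpact, h.transInv_trans (h.subset (hw hg))]
  exact ⟨(S.impact_mem _ hg).2, S.impact_notMem _ hg⟩

theorem exists_lipschitzOnWith_transImpact : ∃ ρ > 0, ∃ L : NNReal,
    LipschitzOnWith L (S.transImpact N)
      (Metric.ball (zeroEmbed l m (S.zeroCoord (xs T))) ρ ∩
        {w | w ∈ S.trans '' (O ×ˢ univ) ∧ S.height (S.transInv N w).1 = 0 ∧
          fderiv ℝ S.height (S.transInv N w).1 (S.transInv N w).2 < 0}) := by
  obtain ⟨K₁, t₁, ht₁, hK₁⟩ := (h.contDiffOn_transInv.contDiffAt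
    (h.isOpen_image.mem_nhds (h.zeroEmbed_mem h.right_mem))).exists_lipschitzOnWith
  obtain ⟨K₂, t₂, ht₂, hK₂⟩ := S.locallyLipschitzOn_impact h.xs_mem_guard
  obtain ⟨K₃, t₃, ht₃, hK₃⟩ := ((contDiffAt_trans (S := S) (h.subset_configs (h.subset
    (h.mem 0 h.left_mem)))).of_le (by norm_num : (1 : WithTop ℕ∞) ≤ 2)).exists_lipschitzOnWith
  have h1 : ContinuousWithinAt S.impact S.guard (xs T) :=
    S.locallyLipschitzOn_impact.continuousOn _ h.xs_mem_guard
  have h2 : ∀ᶠ x in 𝓝[S.guard] (xs T), x ∈ t₂ ∧ S.impact x ∈ t₃ := by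
    refine Filter.Eventually.and ht₂ (h1.eventually_mem ?_)
    rwa [← h.periodic.2.2.2.1]
  obtain ⟨ρ, hρ, hball⟩ := Metric.eventually_nhds_iff_ball.1
    ((h.tendsto_transInv.eventually (eventually_nhdsWithin_iff.1 h2)).and
      (eventually_mem_set.2 ht₁))
  refine ⟨ρ, hρ, K₃ * (K₂ * K₁), ?_⟩
  have hmaps : ∀ w ∈ Metric.ball (zeroEmbed l m (S.zeroCoord (xs T))) ρ ∩
        {w | w ∈ S.trans '' (O ×ˢ univ) ∧ S.height (S.transInv N w).1 = 0 ∧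
          fderiv ℝ S.height (S.transInv N w).1 (S.transInv N w).2 < 0},
      S.transInv N w ∈ t₂ ∧ S.impact (S.transInv N w) ∈ t₃ := by
    rintro w ⟨hwρ, hwU, hw⟩
    exact (hball w hwρ).1 ⟨h.transInv_mem_configs hwU, hw⟩
  exact hK₃.comp (hK₂.comp (hK₁.mono fun w hw => (hball w hw.1).2) fun w hw => (hmaps w hw).1)
    fun w hw => (hmaps w hw).2

theorem contDiffOn_closedLoop_field (kp kd : ℝ) :
    ContDiffOn ℝ 1 (S.closedLoop N kp kd).field (S.trans '' (O ×ˢ univ)) := by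
  have h1 : ContDiffOn ℝ 1 (fun x => fderiv ℝ S.outVel x (S.closedField kp kd x))
      (S.configs ×ˢ univ) :=
    (S.contDiffOn_outVel.fderiv_of_isOpen S.isOpen_states (by norm_num)).clm_apply
      (S.contDiffOn_closedField kp kd)
  exact ((h.comp_transInv (S.contDiffOn_outVel.of_le (by norm_num))).toLp_prodMk
    (h.comp_transInv h1)).toLp_prodMk (h.comp_transInv S.contDiffOn_passiveField)

theorem outInertia_symm {q : Config l m} (hq : q ∈ O) (x y : EuclideanSpace ℝ (Fin m)) :
    inner ℝ (S.outInertia q x) y = inner ℝ x (S.outInertia q y) := by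
  have hM : (S.matM q)⁻¹ᵀ = (S.matM q)⁻¹ :=
    (posDef_matM (h.subset_configs (h.subset hq)) (isUnit_outJacA h.diffeo (h.subset hq)
      (h.subset_configs (h.subset hq)))).inv.isHermitian
  simp only [outInertia, actL_apply, act, EuclideanSpace.inner_eq_star_dotProduct, star_trivial]
  rw [dotProduct_comm, ← Matrix.vecMul_transpose, hM, ← Matrix.dotProduct_mulVec, dotProduct_comm,
    dotProduct_comm]

theorem outInertia_pos {q : Config l m} (hq : q ∈ O) {x : EuclideanSpace ℝ (Fin m)} (hx : x ≠ 0) :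
    0 < inner ℝ x (S.outInertia q x) := by
  have hM := (posDef_matM (h.subset_configs (h.subset hq)) (isUnit_outJacA h.diffeo (h.subset hq)
      (h.subset_configs (h.subset hq)))).inv
  have h1 := hM.dotProduct_mulVec_pos (x := x.ofLp) (by simpa using hx)
  rw [star_trivial, dotProduct_comm] at h1
  simpa only [outInertia, actL_apply, act, EuclideanSpace.inner_eq_star_dotProduct,
    star_trivial] using h1

theorem outInertia_matK_pos {q : Config l m} (hq : q ∈ O) {x : EuclideanSpace ℝ (Fin m)}
    (hx : x ≠ 0) : 0 < inner ℝ x (S.outInertia q (actL _ _ (S.matK q) x)) := by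
  have hqS := h.subset_configs (h.subset hq)
  have hJ := isUnit_outJacA h.diffeo (h.subset hq) hqS
  have hMu : IsUnit (S.matM q).det := (Matrix.isUnit_iff_isUnit_det _).1 (h.isUnit_matM hq)
  have h2 : S.outInertia q (actL _ _ (S.matK q) x) = act (S.matBe q) x := by
    rw [outInertia, actL_apply, actL_apply, ← act_mul, ← matM_mul_matBe hqS hJ,
      ← Matrix.mul_assoc, Matrix.nonsing_inv_mul _ hMu, Matrix.one_mul]
  have h1 := dotProduct_matBe_pos (h.small q (h.subset hq)).2 (x := x.ofLp) (by simpa using hx)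
  rw [h2]
  rw [dotProduct_comm] at h1
  simpa only [act, EuclideanSpace.inner_eq_star_dotProduct, star_trivial] using h1

/-- The robot near the orbit as a high-gain system. -/
noncomputable def normalForm :
    HighGainSystem (EuclideanSpace ℝ (Fin m)) (ZeroSpace l) (TransSpace l m) where
  pe := transOut l m
  pb := transVel l m
  pz := transZero l m
  ι := zeroEmbedL l m
  pe_ι _ := rfl
  pb_ι _ := rfl
  pz_ι _ := rfl
  norm_le := TransSpace.norm_le_add
  norm_pe_le := TransSpace.norm_transOut_le
  norm_pb_le := TransSpace.norm_transVel_le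
  norm_pz_le w := WithLp.norm_snd_le _ w
  U := S.trans '' (O ×ˢ univ)
  isOpen_U := h.isOpen_image
  full ε k := S.closedLoop N (ε ^ 2) (k * ε)
  zero := S.zeroDynamics N
  f w := fderiv ℝ S.outVel (S.transInv N w) (S.drift (S.transInv N w))
  K w := actL _ _ (S.matK (S.transInv N w).1)
  P w := S.outInertia (S.transInv N w).1
  P' w := fderiv ℝ S.outInertia (S.transInv N w).1 (S.transInv N w).2
  ψ w := S.passiveField (S.transInv N w)
  H w := S.height (S.transInv N w).1
  σ w := fderiv ℝ S.height (S.transInv N w).1 (S.transInv N w).2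
  Δ := S.transImpact N
  contDiffOn_f := h.comp_transInv ((S.contDiffOn_outVel.fderiv_of_isOpen S.isOpen_states
    (by norm_num)).clm_apply S.contDiffOn_drift)
  contDiffOn_K := h.comp_transInv_fst ((actL (Fin m) (Fin m)).contDiff.comp_contDiffOn
    ((S.contDiffOn_matK.of_le (by norm_num)).mono (h.subset.trans h.subset_configs)))
  contDiffOn_P := h.comp_transInv_fst (h.contDiffOn_outInertia.of_le (by norm_num))
  continuousOn_P' := by
    have h1 : ContinuousOn (fun q => fderiv ℝ S.outInertia q) O :=
      (h.contDiffOn_outInertia.fderiv_of_isOpen h.isOpen (m := 1) (by norm_num)).continuousOn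
    have h2 := h.contDiffOn_transInv.continuousOn
    exact (h1.comp h2.fst fun w hw => h.transInv_mem hw).clm_apply h2.snd
  contDiffOn_ψ := h.comp_transInv S.contDiffOn_passiveField
  contDiffOn_H := h.comp_transInv_fst ((S.contDiffOn_height.of_le (by norm_num)).mono
    (h.subset.trans h.subset_configs))
  contDiffOn_σ := h.comp_transInv (S.contDiffOn_fderiv_apply S.contDiffOn_height (by norm_num))
  contDiffOn_field ε k := h.contDiffOn_closedLoop_field _ _
  pe_field ε k w hw := (h.transVel_eq hw).symm
  pb_field ε k w hw := by
    rw [h.transOut_eq hw, h.transVel_eq hw]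
    exact fderiv_outVel_closedField _ _ (h.transInv_mem_configs hw)
  pz_field ε k w hw := rfl
  fderiv_P ε k w hw := h.fderiv_comp_transInv (h.contDiffOn_outInertia.of_le (by norm_num)) hw
    (h.transVel_eq hw).symm rfl
  fderiv_H w hw v h1 h2 := h.fderiv_comp_transInv ((S.contDiffOn_height.of_le (by norm_num)).mono
    (h.subset.trans h.subset_configs)) hw h1 h2
  P_symm w hw := h.outInertia_symm (h.transInv_mem hw)
  P_pos w hw x hx := h.outInertia_pos (h.transInv_mem hw) hx
  PK_pos w hw x hx := h.outInertia_matK_pos (h.transInv_mem hw) hx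
  mem_full_flowSet ε k w hw := h.mem_closedLoop_flowSet hw
  mem_full_guard ε k w hw := h.mem_closedLoop_guard hw
  full_reset ε k := rfl
  zero_field z hz := rfl
  mem_zero_flowSet z hz := h.mem_zeroDynamics_flowSet hz
  mem_zero_guard z hz := h.mem_zeroDynamics_guard hz
  zero_reset z := rfl
  T := T
  T_pos := h.periodic.1
  ζ t := S.zeroCoord (xs t)
  ζ_mem t ht := h.zeroEmbed_mem ht
  continuousOn_ζ := S.contDiffOn_zeroCoord.continuousOn.comp h.periodic.2.1
    fun t ht => ⟨h.subset_configs (h.subset (h.mem t ht)), mem_univ _⟩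
  deriv_ζ t ht := (h.periodic.2.2.2.2.2.2.2.1 t ht).2.mono_of_mem_nhdsWithin
    (mem_nhdsWithin.2 ⟨Iio T, isOpen_Iio, ht.2, fun s hs => ⟨ht.1.trans hs.2, hs.1⟩⟩)
  ζ_flow t ht := (h.mem_zeroDynamics_flowSet (h.zeroEmbed_mem ⟨ht.1, ht.2.le⟩)).1
    (h.periodic.2.2.2.2.2.2.2.1 t ht).1
  ζ_transverse t ht := by
    have h1 := h.transInv_zeroEmbed ht
    simp only [zeroEmbedL_apply, h1]
    exact h.transverse t ht
  ζ_guard := by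
    have h1 := h.transInv_zeroEmbed h.right_mem
    simp only [zeroEmbedL_apply, h1]
    exact h.xs_mem_guard.2
  ζ_start := by
    rw [zeroEmbedL_apply, h.transImpact_zeroEmbed]
    rfl
  reset_lipschitz := h.exists_lipschitzOnWith_transImpact
  reset_mem := h.transImpact_mem
  reset_ι z hz hH hσ := by
    have hg : S.transInv N (zeroEmbed l m z) ∈ S.guard := (h.mem_guard_iff hz).2 ⟨hH, hσ⟩
    exact (h.invariant ⟨hg, (h.mem_zeroSurface_iff hz).2 hH.ge⟩).2

end IsRegularOrbit

end WalkingRobot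

/-! ### Ultimate boundedness of the full-order system -/

theorem WalkingRobot.isRegularOrbit_tube {l m : ℕ} {S : WalkingRobot l m} {T r : ℝ}
    {xs : ℝ → State l m} (hr : 0 < r) (hinv : S.HybridInvariant)
    (hdiffeo : S.OutputsDiffeo (S.tube T r xs))
    (hsmall : S.OutputsSmallVariation (S.tube T r xs))
    (hper : S.IsPeriodicTrajectory (S.tube T r xs) T xs) (htrans : S.IsTransverse T xs) :
    S.IsRegularOrbit (S.tube T r xs)
      {q | q ∈ S.configs ∧ Metric.infDist q ((fun t => (xs t).1) '' Icc 0 T) < r} T xs where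
  isOpen := S.isOpen_configs.inter (isOpen_lt (Metric.continuous_infDist_pt _) continuous_const)
  subset q hq := ⟨hq.1, hq.2.le⟩
  subset_configs q hq := hq.1
  diffeo := hdiffeo
  small := hsmall
  invariant := hinv
  periodic := hper
  transverse := htrans
  mem t ht := by
    refine ⟨(hper.2.2.1 t ht).1.1, ?_⟩
    rwa [Metric.infDist_zero_of_mem (mem_image_of_mem (fun t => (xs t).1) ht)]

theorem theorem2 {l m : ℕ} (S : WalkingRobot l m) (T r : ℝ) (xs : ℝ → State l m)
    (hr : 0 < r)
    (hinv : S.HybridInvariant)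
    (hdiffeo : S.OutputsDiffeo (S.tube T r xs))
    (hsmall : S.OutputsSmallVariation (S.tube T r xs))
    (hper : S.IsPeriodicTrajectory (S.tube T r xs) T xs)
    (htrans : S.IsTransverse T xs)
    (hLES : (S.zeroDynamics (S.tube T r xs)).IsLES (S.orbitZ T xs) (S.zeroCoord (xs T))) :
    ∃ k₀ : ℝ, 1 < k₀ ∧ ∀ k : ℝ, k₀ ≤ k → ∀ d : ℝ, 0 < d →
      ∃ ε₀ : ℝ, 1 < ε₀ ∧ ∀ ε : ℝ, ε₀ ≤ ε →
        (S.closedLoop (S.tube T r xs) (ε ^ 2) (k * ε)).IsLEUB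
          (zeroEmbed l m '' S.orbitZ T xs) (zeroEmbed l m (S.zeroCoord (xs T))) d := by
  have h := WalkingRobot.isRegularOrbit_tube hr hinv hdiffeo hsmall hper htrans
  exact h.normalForm.isLEUB_full hLES
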